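/- Let $n\ge 1$, $\alpha\ge n$, and let $h:(0,\infty)\to\mathbb R$ be $C^1$, convex and bounded below, with $h(\delta)=\delta\,h(\delta^{-1})$ for all $\delta>0$ and $h'(1)=-n$. For a real $n\times n$ matrix $A$ with $\det A>0$ and singular values $v_1,\dots,v_n$ put $$\Psi(A)=\sum_{i=1}^n v_i^{\alpha}+\det A\,\Big(\sum_{i=1}^n v_i^{-\alpha}\Big)+h(\det A).$$ For bounded domains $\Omega_1,\Omega_2\subset\mathbb R^n$ let $\mathcal A_n=\mathcal A_n(\Omega_1,\Omega_2)$ be the set of $y\in W^{1,n}(\Omega_1,\mathbb R^n)$ that are homeomorphisms of $\Omega_1$ onto $\Omega_2$ with $\det Dy>0$ a.e. in $\Omega_1$ and $y^{-1}\in W^{1,n}(\Omega_2,\mathbb R^n)$. Then $\Psi\ge 0$, and the following holds for every $\lambda>0$, every $R\in SO(n)$ and every bounded domain $\Omega_1\subset\mathbb R^n$, where $M=\lambda R$ and $\Omega_2=M\Omega_1$. (1) For all $y\in\mathcal A_n(\Omega_1,\Omega_2)$, $$\frac{1}{\mathcal L^n(\Omega_1)}\int_{\Omega_1}\Psi(Dy(x))\,dx\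 \ge\ \Psi(M),$$ where the left-hand side may be $+\infty$. (2) If $\alpha=n$, suppose in addition that $h$ is not affine on any neighbourhood of $\lambda^n=\det M$ (for instance, that $h$ is strictly convex). Let $K\subset\mathbb R^m$ be nonempty, bounded, closed and convex, let $g:\mathbb R^m\times\mathbb R^m\to[0,\infty)$ be continuous and symmetric with $g(c,d)=0$ if and only if $c=d$, and let $c_1\in L^\infty(\Omega_1,K)$, $c_2\in L^\infty(\Omega_2,K)$ satisfy $c_2(Mx)=c_1(x)$ for a.e. $x\in\Omega_1$. Suppose that the following genericity condition holds: if $a\in\mathbb R^n$ and $Q\in SO(n)$ satisfy $$a+\lambda Q\Omega_1=\Omega_2\quad\text{and}\quad c_2(a+\lambda Qx)=c_2(\lambda Rx)\ \text{ for a.e. }x\in\Omega_1,$$ then $a=0$ and $Q=R$. Then $y(x)=\lambda Rx$ is the unique minimiser in $\mathcal A_n(\Omega_1,\Omega_2)$ of $$I_{P_1,P_2}(y)=\int_{\Omega_1}\Big(\Psi(Dy(x))+\big(1+\det Dy(x)\big)\,g\big(c_1(x),c_2(y(x))\big)\Big)\,dx .$$ -/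

import Mathlib

open MeasureTheory Set Filter Topology
open scoped ContDiff ENNReal

namespace ImageMatching

noncomputable section

/-- A bounded domain in `ℝⁿ`: bounded, open, connected and nonempty. -/
structure IsBoundedDomain {n : ℕ} (Ω : Set (EuclideanSpace ℝ (Fin n))) : Prop where
  isOpen : IsOpen Ω
  isConnected : IsConnected Ω
  isBounded : Bornology.IsBounded Ω

/-- `G` is a weak gradient of `y : Ω → ℝⁿ`: both are locally integrable on `Ω` and
`∫_Ω yᵢ ∂ⱼφ = - ∫_Ω Gᵢⱼ φ` for all smooth `φ` with compact support in `Ω`. -/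
structure IsWeakGradient {n : ℕ} (Ω : Set (EuclideanSpace ℝ (Fin n)))
    (y : EuclideanSpace ℝ (Fin n) → EuclideanSpace ℝ (Fin n))
    (G : EuclideanSpace ℝ (Fin n) → Matrix (Fin n) (Fin n) ℝ) : Prop where
  locallyIntegrableOn_map : ∀ i, LocallyIntegrableOn (fun x => y x i) Ω volume
  locallyIntegrableOn_grad : ∀ i j, LocallyIntegrableOn (fun x => G x i j) Ω volume
  integral_eq : ∀ φ : EuclideanSpace ℝ (Fin n) → ℝ,
    ContDiff ℝ ∞ φ → HasCompactSupport φ → tsupport φ ⊆ Ω → ∀ i j : Fin n,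
      ∫ x in Ω, y x i * fderiv ℝ φ x (EuclideanSpace.single j 1) = - ∫ x in Ω, G x i j * φ x

open Classical in
/-- The weak gradient `Dy` of `y` on `Ω` (determined almost everywhere on an open set `Ω`);
the zero matrix field if there is none. -/
def weakGradient {n : ℕ} (Ω : Set (EuclideanSpace ℝ (Fin n)))
    (y : EuclideanSpace ℝ (Fin n) → EuclideanSpace ℝ (Fin n)) :
    EuclideanSpace ℝ (Fin n) → Matrix (Fin n) (Fin n) ℝ :=
  if h : ∃ G, IsWeakGradient Ω y G then h.choose else 0

/-- `y ∈ W^{1,p}(Ω, ℝⁿ)`. -/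
def MemSobolev {n : ℕ} (p : ℝ≥0∞) (Ω : Set (EuclideanSpace ℝ (Fin n)))
    (y : EuclideanSpace ℝ (Fin n) → EuclideanSpace ℝ (Fin n)) : Prop :=
  MemLp y p (volume.restrict Ω) ∧
    ∃ G, IsWeakGradient Ω y G ∧ ∀ i j, MemLp (fun x => G x i j) p (volume.restrict Ω)

/-- The class `𝒜_p(Ω₁, Ω₂)`: maps `y ∈ W^{1,p}(Ω₁, ℝⁿ)` that restrict to a homeomorphism of `Ω₁`
onto `Ω₂`, are orientation preserving (`det Dy > 0` a.e. in `Ω₁`), and whose inverse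
`ξ : Ω₂ → Ω₁` is in `W^{1,p}(Ω₂, ℝⁿ)`. Only the values of `y` on `Ω₁` matter. -/
def admissible {n : ℕ} (p : ℝ≥0∞) (Ω₁ Ω₂ : Set (EuclideanSpace ℝ (Fin n))) :
    Set (EuclideanSpace ℝ (Fin n) → EuclideanSpace ℝ (Fin n)) :=
  {y | MemSobolev p Ω₁ y ∧ ContinuousOn y Ω₁ ∧
    (∀ᵐ x ∂volume.restrict Ω₁, 0 < (weakGradient Ω₁ y x).det) ∧
    ∃ ξ : EuclideanSpace ℝ (Fin n) → EuclideanSpace ℝ (Fin n),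
      MapsTo y Ω₁ Ω₂ ∧ MapsTo ξ Ω₂ Ω₁ ∧ InvOn ξ y Ω₁ Ω₂ ∧ ContinuousOn ξ Ω₂ ∧
        MemSobolev p Ω₂ ξ}

/-- `c ∈ L^∞(Ω, K)` for a bounded set `K`: `c` is (a.e. strongly) measurable on `Ω`, with values in
`K` a.e. in `Ω`. -/
def IsIntensityMap {n m : ℕ} (Ω : Set (EuclideanSpace ℝ (Fin n)))
    (K : Set (EuclideanSpace ℝ (Fin m)))
    (c : EuclideanSpace ℝ (Fin n) → EuclideanSpace ℝ (Fin m)) : Prop :=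
  AEStronglyMeasurable c (volume.restrict Ω) ∧ ∀ᵐ x ∂volume.restrict Ω, c x ∈ K

/-- The singular values `vᵢ(A)`, `i = 1, …, n`, of an `n × n` matrix `A`. -/
def singVal {n : ℕ} (A : Matrix (Fin n) (Fin n) ℝ) (i : Fin n) : ℝ :=
  (Matrix.toEuclideanLin A).singularValues i

/-- `Ψ(A) = ∑ vᵢ^α + det A · ∑ vᵢ^{-α} + h(det A)`. -/
def elasticEnergy {n : ℕ} (α : ℝ) (h : ℝ → ℝ) (A : Matrix (Fin n) (Fin n) ℝ) : ℝ :=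
  ∑ i, singVal A i ^ α + A.det * ∑ i, singVal A i ^ (-α) + h A.det

/-- `ψ(c, d, A) = Ψ(A) + (1 + det A) g(c, d)`. -/
def integrand {n m : ℕ} (Ψ : Matrix (Fin n) (Fin n) ℝ → ℝ)
    (g : EuclideanSpace ℝ (Fin m) → EuclideanSpace ℝ (Fin m) → ℝ)
    (c d : EuclideanSpace ℝ (Fin m)) (A : Matrix (Fin n) (Fin n) ℝ) : ℝ :=
  Ψ A + (1 + A.det) * g c d

/-- `I_{P₁,P₂}(y) = ∫_{Ω₁} ψ(c₁(x), c₂(y(x)), Dy(x)) dx ∈ [0, ∞]`, for `ψ` that is nonnegative on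
matrices of positive determinant and `y` with `det Dy > 0` a.e. -/
def functional {n m : ℕ}
    (ψ : EuclideanSpace ℝ (Fin m) → EuclideanSpace ℝ (Fin m) → Matrix (Fin n) (Fin n) ℝ → ℝ)
    (Ω₁ : Set (EuclideanSpace ℝ (Fin n)))
    (c₁ c₂ : EuclideanSpace ℝ (Fin n) → EuclideanSpace ℝ (Fin m))
    (y : EuclideanSpace ℝ (Fin n) → EuclideanSpace ℝ (Fin n)) : ℝ≥0∞ :=
  ∫⁻ x in Ω₁, ENNReal.ofReal (ψ (c₁ x) (c₂ (y x)) (weakGradient Ω₁ y x))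

/-- `y₀` is the unique minimiser of `I` in `𝒜`, maps being identified when they agree on `Ω`. -/
def IsUniqueMinimiser {n : ℕ} (Ω : Set (EuclideanSpace ℝ (Fin n)))
    (𝒜 : Set (EuclideanSpace ℝ (Fin n) → EuclideanSpace ℝ (Fin n)))
    (I : (EuclideanSpace ℝ (Fin n) → EuclideanSpace ℝ (Fin n)) → ℝ≥0∞)
    (y₀ : EuclideanSpace ℝ (Fin n) → EuclideanSpace ℝ (Fin n)) : Prop :=
  y₀ ∈ 𝒜 ∧ IsMinOn I 𝒜 y₀ ∧ ∀ y ∈ 𝒜, IsMinOn I 𝒜 y → EqOn y y₀ Ω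

end

end ImageMatching

namespace ImageMatching

/-! ### The degree formula for compactly supported perturbations of the identity -/

/-! The theorem is Jensen's inequality for a convex function of the Jacobian, followed by an
analysis of equality. Power means and AM-GM for the singular values give `Ψ(A) ≥ E(A) ≥ H(det A)`,
where `E` (`isotropicEnergy`) depends only on the Frobenius norm and the determinant, and `H(δ) = n
δ^(α/n) + n δ^(1-α/n) + h(δ)` (`dilationEnergy`) is the energy of a dilation. `H` lies above its
tangent lines (`dilationEnergy_tangent_le`). The symmetry of `h` and `h'(1) = -n` give `H(1) = H'(1)
= 0`, whence `Ψ ≥ 0`. By the area formula the mean of `det Dy` is `λ^n`, so integrating the tangent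
line at `λ^n` gives (1). The intensity term is nonnegative and vanishes at `y = λR`, so `λR` is a
minimiser.

For another minimiser every inequality is an equality almost everywhere
(`exists_affine_of_lintegral_le`). Contact with the tangent forces `det Dy = λ^n`: by strict
convexity of `δ^(α/n)` if `α > n`, and by the non-affinity of `h` together with the mean value if `α
= n`. Equality in AM-GM makes all singular values equal, so `Dy` is almost everywhere `λ` times a
rotation. Such a `y` is affine (`exists_affine_of_conformal`): its mollifications have derivatives
of norm at most `λ`, so it is `λ`-Lipschitz on balls; since volumes scale by exactly `λ^n`, balls go
onto balls; injectivity then gives the reverse distance estimate. A local similarity of a connected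
domain is affine, and genericity identifies it. The equality argument integrates `E` in place of
`Ψ`, so no measurability of singular values enters.

The analytic core is the area formula for homeomorphisms that are `W^{1,n}` together with their
inverses. It is built from an elementary degree theory. For a `C¹` map equal to the identity outside
a ball, `∫ φ(f) det Df = ∫ φ`: this is a change of variables for small perturbations, and extends to
all of them because for polynomial `φ` both sides are polynomials in the size of the perturbation.
Hence `det Df` pushes forward locally to a constant multiple of Lebesgue measure. Mollification
approximates `y` locally uniformly and its Jacobian in `L¹_loc`, so `y` and its inverse acquire
local degrees `c` and `c'`. Composition gives `c c' = 1`, positivity of the Jacobian gives `c > 0`,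
and covering of small balls gives `c ≥ 1` and `c' ≥ 1`. Thus `c = 1`. -/

theorem det_eq_matrix_det {n : ℕ}
    (A : EuclideanSpace ℝ (Fin n) →L[ℝ] EuclideanSpace ℝ (Fin n)) :
    A.det = (Matrix.of fun i j => A (EuclideanSpace.single j 1) i).det := by
  rw [ContinuousLinearMap.det,
    ← LinearMap.det_toMatrix (EuclideanSpace.basisFun (Fin n) ℝ).toBasis]
  congr 1

theorem exists_forall_norm_lt_det_one_add_pos {E : Type*} [NormedAddCommGroup E]
    [NormedSpace ℝ E] [FiniteDimensional ℝ E] :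
    ∃ δ : ℝ, 0 < δ ∧ ∀ A : E →L[ℝ] E, ‖A‖ < δ →
      0 < (ContinuousLinearMap.id ℝ E + A).det := by
  have hc : Continuous fun A : E →L[ℝ] E => (ContinuousLinearMap.id ℝ E + A).det :=
    ContinuousLinearMap.continuous_det.comp (continuous_const.add continuous_id)
  have h0 : (0 : ℝ) < (ContinuousLinearMap.id ℝ E + 0).det := by
    simp [ContinuousLinearMap.det]
  obtain ⟨δ, hδ, h⟩ := Metric.eventually_nhds_iff.1 (hc.tendsto 0 |>.eventually (lt_mem_nhds h0))
  exact ⟨δ, hδ, fun A hA => h (by simpa using hA)⟩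

/-- The contraction-mapping argument behind the inverse function theorem, applied globally with the
identity as linear model. -/
theorem bijective_id_add_of_lipschitz {E : Type*} [NormedAddCommGroup E] [NormedSpace ℝ E]
    [CompleteSpace E] {g : E → E} {K : NNReal} (hK : K < 1) (hg : LipschitzWith K g) :
    Function.Bijective fun x => x + g x := by
  have hA : ApproximatesLinearOn (fun x => x + g x)
      ((ContinuousLinearEquiv.refl ℝ E : E ≃L[ℝ] E) : E →L[ℝ] E) univ K := by
    intro x _ y _
    have := hg.norm_sub_le x y
    have e : x + g x - (y + g y) - (x - y) = g x - g y := by abel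
    simpa [e] using this
  have hc : Subsingleton E ∨ K < ‖((ContinuousLinearEquiv.refl ℝ E).symm : E →L[ℝ] E)‖₊⁻¹ := by
    rcases subsingleton_or_nontrivial E with h | h
    · exact Or.inl h
    · right
      have : ‖((ContinuousLinearEquiv.refl ℝ E).symm : E →L[ℝ] E)‖₊ = 1 := by
        ext; simp
      rw [this]; simpa using hK
  refine ⟨?_, hA.surjective hc⟩
  have := hA.injective hc
  intro a b hab
  simpa using @this ⟨a, mem_univ a⟩ ⟨b, mem_univ b⟩ hab

theorem image_eq_of_bijective_of_eq_self {E : Type*} {F : E → E} (hF : Function.Bijective F)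
    {K : Set E} (h : ∀ x ∉ K, F x = x) : F '' K = K := by
  apply Subset.antisymm
  · rintro _ ⟨x, hx, rfl⟩
    by_contra hn
    -- If `F x` lay outside `K` it would be fixed, so `F (F x) = F x`, and injectivity would give `F
    -- x = x ∈ K`.
    exact hn ((hF.1 (h _ hn)).symm ▸ hx)
  · intro z hz
    obtain ⟨x, rfl⟩ := hF.2 z
    by_cases hx : x ∈ K
    · exact ⟨x, hx, rfl⟩
    · rw [h x hx] at hz; exact absurd hz hx

section Degree

variable {n : ℕ}

local notation "𝔼" => EuclideanSpace ℝ (Fin n)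

/-- For small `t` the map `x + t g(x)` is a bijection of the ball onto itself with positive
Jacobian, so this is the classical change of variables. The bound on `t` does not depend on `φ`. -/
theorem eventually_integral_comp_id_add_smul {g : 𝔼 → 𝔼} (hg : ContDiff ℝ 1 g)
    {R : ℝ} (hR : ∀ x ∉ Metric.closedBall (0 : 𝔼) R, g x = 0) :
    ∃ ε : ℝ, 0 < ε ∧ ∀ t ∈ Ioo 0 ε, ∀ φ : 𝔼 → ℝ,
      ∫ x in Metric.closedBall (0 : 𝔼) R,
        φ (x + t • g x) * (ContinuousLinearMap.id ℝ 𝔼 + t • fderiv ℝ g x).det =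
      ∫ x in Metric.closedBall (0 : 𝔼) R, φ x := by
  have hcs : HasCompactSupport g :=
    HasCompactSupport.intro (isCompact_closedBall (0 : 𝔼) R) hR
  obtain ⟨K, hK⟩ := ContDiff.lipschitzWith_of_hasCompactSupport hcs hg one_ne_zero
  obtain ⟨δ, hδ, hdet⟩ := exists_forall_norm_lt_det_one_add_pos (E := 𝔼)
  -- The first bound makes `t g` a contraction, the second keeps `‖t Dg‖` below the threshold for a
  -- positive determinant; `K + 1` covers `K = 0`.
  refine ⟨min (1 / (K + 1)) (δ / (K + 1)), by positivity, fun t ht φ => ?_⟩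
  have hK1 : (0 : ℝ) < K + 1 := by positivity
  have ht1 : t * (K + 1) < 1 := (lt_div_iff₀ hK1).1 (ht.2.trans_le (min_le_left _ _))
  have ht2 : t * (K + 1) < δ := (lt_div_iff₀ hK1).1 (ht.2.trans_le (min_le_right _ _))
  have ht0 := ht.1
  have hlip : LipschitzWith (‖t‖₊ * K) fun x => t • g x := by
    simpa [Function.comp_def] using (lipschitzWith_smul t).comp hK
  have hbij : Function.Bijective fun x => x + t • g x := by
    refine bijective_id_add_of_lipschitz ?_ hlip
    rw [← NNReal.coe_lt_coe]
    simp only [NNReal.coe_mul, coe_nnnorm, Real.norm_eq_abs, abs_of_pos ht0, NNReal.coe_one]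
    linarith
  have himg : (fun x => x + t • g x) '' Metric.closedBall (0 : 𝔼) R = Metric.closedBall 0 R :=
    image_eq_of_bijective_of_eq_self hbij fun x hx => by simp [hR x hx]
  have hder : ∀ x : 𝔼, HasFDerivAt (fun x => x + t • g x)
      (ContinuousLinearMap.id ℝ 𝔼 + t • fderiv ℝ g x) x := fun x =>
    (hasFDerivAt_id x).add ((hg.differentiable one_ne_zero x).hasFDerivAt.const_smul t)
  have := integral_image_eq_integral_abs_det_fderiv_smul volume
    (measurableSet_closedBall (x := (0 : 𝔼)) (ε := R))
    (fun x _ => (hder x).hasFDerivWithinAt) hbij.1.injOn φ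
  rw [himg] at this
  rw [this]
  refine integral_congr_ae (Eventually.of_forall fun x => ?_)
  have hpos : 0 < (ContinuousLinearMap.id ℝ 𝔼 + t • fderiv ℝ g x).det := by
    apply hdet
    rw [norm_smul, Real.norm_eq_abs, abs_of_pos ht0]
    have : ‖fderiv ℝ g x‖ ≤ K := norm_fderiv_le_of_lipschitz ℝ hK
    nlinarith
  simp [abs_of_pos hpos, mul_comm]

open Polynomial in
theorem exists_polynomial_integral_eval (q : C(𝔼, ℝ)[X]) {K : Set 𝔼} (hK : IsCompact K) :
    ∃ Q : ℝ[X], ∀ t : ℝ,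
      ∫ x in K, (q.eval (ContinuousMap.const 𝔼 t)) x = Q.eval t := by
  refine ⟨∑ i ∈ Finset.range (q.natDegree + 1), C (∫ x in K, q.coeff i x) * X ^ i, fun t => ?_⟩
  rw [eval_finsetSum]
  simp only [eval_eq_sum_range (p := q), ContinuousMap.coe_sum, ContinuousMap.coe_mul, Finset.sum_apply,
    Pi.mul_apply, ContinuousMap.coe_pow, Pi.pow_apply, ContinuousMap.const_apply]
  rw [integral_finsetSum]
  · simp only [eval_mul, eval_C, eval_pow, eval_X, integral_mul_const]
  · intro i _
    exact ((q.coeff i).continuous.mul continuous_const).continuousOn.integrableOn_compact hK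

open Polynomial in
-- With `t g` in place of `g` the left side is a polynomial in `t`. It is constant on a small
-- interval, hence constant, and `t = 1` is the claim.
theorem integral_mvPolynomial_comp_id_add {g : 𝔼 → 𝔼} (hg : ContDiff ℝ 1 g)
    {R : ℝ} (hR : ∀ x ∉ Metric.closedBall (0 : 𝔼) R, g x = 0) (p : MvPolynomial (Fin n) ℝ) :
    ∫ x in Metric.closedBall (0 : 𝔼) R,
        MvPolynomial.eval (fun i => (x + g x) i) p *
          (ContinuousLinearMap.id ℝ 𝔼 + fderiv ℝ g x).det =
      ∫ x in Metric.closedBall (0 : 𝔼) R, MvPolynomial.eval (fun i => x i) p := by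
  -- `w` and `D` encode `x + t g(x)` and `I + t Dg(x)` with `t` as the indeterminate over the ring
  -- of continuous functions of `x`.
  let w : Fin n → C(𝔼, ℝ)[X] := fun i =>
    C ⟨fun x => x i, by fun_prop⟩ + X * C ⟨fun x => g x i, by have := hg.continuous; fun_prop⟩
  have hfd : Continuous (fderiv ℝ g) := hg.continuous_fderiv one_ne_zero
  let D : Matrix (Fin n) (Fin n) C(𝔼, ℝ)[X] := Matrix.of fun i j =>
    C (ContinuousMap.const 𝔼 ((EuclideanSpace.single j (1 : ℝ) : 𝔼) i)) +
      X * C ⟨fun x => fderiv ℝ g x (EuclideanSpace.single j 1) i, by fun_prop⟩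
  have key : ∀ (t : ℝ) (x : 𝔼),
      ((MvPolynomial.aeval w p * D.det).eval (ContinuousMap.const 𝔼 t)) x =
      MvPolynomial.eval (fun i => (x + t • g x) i) p *
          (ContinuousLinearMap.id ℝ 𝔼 + t • fderiv ℝ g x).det := by
    intro t x
    let e : C(𝔼, ℝ)[X] →+* ℝ :=
      (Pi.evalRingHom (fun _ : 𝔼 => ℝ) x).comp
        (ContinuousMap.coeFnRingHom.comp (evalRingHom (ContinuousMap.const 𝔼 t)))
    have he : ∀ q : C(𝔼, ℝ)[X], (q.eval (ContinuousMap.const 𝔼 t)) x = e q := fun q => rfl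
    rw [he, map_mul, det_eq_matrix_det]
    congr 1
    · rw [MvPolynomial.aeval_def, MvPolynomial.hom_eval₂]
      -- The identity is the only ring endomorphism of `ℝ`.
      have : e.comp (algebraMap ℝ C(𝔼, ℝ)[X]) = RingHom.id ℝ := Subsingleton.elim _ _
      rw [this]
      rw [MvPolynomial.eval, MvPolynomial.coe_eval₂Hom]
      congr 1
      ext i
      simp [← he, w]
      ring
    · rw [RingHom.map_det]
      congr 1
      ext i j
      simp [RingHom.mapMatrix_apply, Matrix.map_apply, ← he, D]
      ring
  obtain ⟨Q, hQ⟩ := exists_polynomial_integral_eval (MvPolynomial.aeval w p * D.det)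
    (isCompact_closedBall (0 : 𝔼) R)
  simp only [key] at hQ
  obtain ⟨ε, hε, hsmall⟩ := eventually_integral_comp_id_add_smul hg hR
  have hconst : Q = C (∫ x in Metric.closedBall (0 : 𝔼) R, MvPolynomial.eval (fun i => x i) p) := by
    apply Polynomial.eq_of_infinite_eval_eq
    refine (Ioo_infinite hε).mono fun t ht => ?_
    simp only [mem_ofPred_eq, eval_C]
    rw [← hQ t, hsmall t ht fun x => MvPolynomial.eval (fun i => x i) p]
  have h1 := hQ 1
  rw [hconst] at h1
  simpa using h1

/-- Stone–Weierstrass: the coordinate functions separate points. -/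
theorem exists_mvPolynomial_near {K : Set 𝔼} (hK : IsCompact K) {φ : 𝔼 → ℝ}
    (hφ : ContinuousOn φ K) {ε : ℝ} (hε : 0 < ε) :
    ∃ p : MvPolynomial (Fin n) ℝ, ∀ x ∈ K, |MvPolynomial.eval (fun i => x i) p - φ x| < ε := by
  have := isCompact_iff_compactSpace.1 hK
  let coord : Fin n → C(K, ℝ) := fun i => ⟨fun x => (x : 𝔼) i, by fun_prop⟩
  let A : Subalgebra ℝ C(K, ℝ) := (MvPolynomial.aeval (R := ℝ) coord).range
  have hev : ∀ (p : MvPolynomial (Fin n) ℝ) (x : K), (MvPolynomial.aeval (R := ℝ) coord p) x =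
      MvPolynomial.eval (fun i => (x : 𝔼) i) p := by
    intro p x
    induction p using MvPolynomial.induction_on with
    | C a => simp
    | add p q hp hq => simp [hp, hq]
    | mul_X p i hp => simp [hp, coord]
  have hsep : A.SeparatesPoints := by
    intro x y hxy
    have : ∃ i, (x : 𝔼) i ≠ (y : 𝔼) i := by
      by_contra! hc
      exact hxy (Subtype.ext (by ext i; exact hc i))
    obtain ⟨i, hi⟩ := this
    exact ⟨coord i, ⟨coord i, ⟨MvPolynomial.X i, by simp⟩, rfl⟩, hi⟩
  obtain ⟨⟨_, ⟨p, rfl⟩⟩, hg⟩ :=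
    ContinuousMap.exists_mem_subalgebra_near_continuous_of_separatesPoints A hsep
    (K.domRestrict φ) (continuousOn_iff_continuous_domRestrict.1 hφ) ε hε
  exact ⟨p, fun x hx => by simpa [hev] using hg ⟨x, hx⟩⟩

/-- The degree formula for a `C¹` map that is the identity outside a ball. -/
theorem integral_comp_id_add {g : 𝔼 → 𝔼} (hg : ContDiff ℝ 1 g)
    {R : ℝ} (hR : ∀ x ∉ Metric.closedBall (0 : 𝔼) R, g x = 0) {φ : 𝔼 → ℝ} (hφ : Continuous φ) :
    ∫ x in Metric.closedBall (0 : 𝔼) R,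
        φ (x + g x) * (ContinuousLinearMap.id ℝ 𝔼 + fderiv ℝ g x).det =
      ∫ x in Metric.closedBall (0 : 𝔼) R, φ x := by
  set B := Metric.closedBall (0 : 𝔼) R
  have hB : IsCompact B := isCompact_closedBall _ _
  have hgc := hg.continuous
  have hfd : Continuous (fderiv ℝ g) := hg.continuous_fderiv one_ne_zero
  set d : 𝔼 → ℝ := fun x => (ContinuousLinearMap.id ℝ 𝔼 + fderiv ℝ g x).det
  have hd : Continuous d := ContinuousLinearMap.continuous_det.comp (continuous_const.add hfd)
  set F : 𝔼 → 𝔼 := fun x => x + g x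
  have hF : Continuous F := continuous_id.add hgc
  -- The approximating polynomial is evaluated both at `x` and at `F x`, and `F` need not map `B`
  -- into itself a priori.
  have hK : IsCompact (B ∪ F '' B) := hB.union (hB.image hF)
  have hint : ∀ ψ : 𝔼 → ℝ, Continuous ψ → IntegrableOn ψ B := fun ψ h =>
    h.continuousOn.integrableOn_compact hB
  have hpc : ∀ p : MvPolynomial (Fin n) ℝ, Continuous fun x : 𝔼 =>
      MvPolynomial.eval (fun i => x i) p := fun p =>
    (MvPolynomial.continuous_eval p).comp (by fun_prop)
  set M := (∫ x in B, |d x|) + ∫ x in B, (1 : ℝ)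
  have hM : 0 ≤ M := add_nonneg (integral_nonneg fun _ => abs_nonneg _)
    (integral_nonneg fun _ => zero_le_one)
  by_contra hne
  have hpos : 0 < |(∫ x in B, φ (F x) * d x) - ∫ x in B, φ x| := abs_pos.2 (sub_ne_zero.2 hne)
  set η := |(∫ x in B, φ (F x) * d x) - ∫ x in B, φ x|
  obtain ⟨p, hp⟩ := exists_mvPolynomial_near hK hφ.continuousOn
    (show 0 < η / (M + 1) by positivity)
  set P : 𝔼 → ℝ := fun x => MvPolynomial.eval (fun i => x i) p
  have hP : (∫ x in B, P (F x) * d x) = ∫ x in B, P x := integral_mvPolynomial_comp_id_add hg hR p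
  have h1 : |(∫ x in B, φ (F x) * d x) - ∫ x in B, P (F x) * d x| ≤
      η / (M + 1) * ∫ x in B, |d x| := by
    have i1 : IntegrableOn (fun x => φ (F x) * d x) B := hint _ ((hφ.comp hF).mul hd)
    have i2 : IntegrableOn (fun x => P (F x) * d x) B := hint _ (((hpc p).comp hF).mul hd)
    rw [← integral_sub i1 i2, ← integral_const_mul]
    refine abs_integral_le_integral_abs.trans
      (setIntegral_mono_on (hint _ ?_) (hint _ ?_) hB.measurableSet fun x hx => ?_)
    · exact (((hφ.comp hF).mul hd).sub (((hpc p).comp hF).mul hd)).abs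
    · exact continuous_const.mul hd.abs
    · rw [← sub_mul, abs_mul]
      gcongr
      rw [abs_sub_comm]
      exact (hp _ (Or.inr ⟨x, hx, rfl⟩)).le
  have h2 : |(∫ x in B, P x) - ∫ x in B, φ x| ≤ η / (M + 1) * ∫ x in B, (1 : ℝ) := by
    rw [← integral_sub (hint _ (hpc p)) (hint _ hφ), ← integral_const_mul]
    refine abs_integral_le_integral_abs.trans
      (setIntegral_mono_on (hint _ ((hpc p).sub hφ).abs) (hint _ (by fun_prop))
        hB.measurableSet fun x hx => ?_)
    rw [mul_one]
    exact (hp _ (Or.inl hx)).le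
  have h3 : η ≤ η / (M + 1) * M := by
    calc η ≤ |(∫ x in B, φ (F x) * d x) - ∫ x in B, P (F x) * d x| +
          |(∫ x in B, P x) - ∫ x in B, φ x| := by
          rw [hP]; exact abs_sub_le _ _ _
      _ ≤ _ := by rw [mul_add]; exact add_le_add h1 h2
  have h4 : η / (M + 1) * M < η := by
    rw [div_mul_eq_mul_div, div_lt_iff₀ (by positivity)]
    nlinarith
  linarith

end Degree

/-! ### Local degree of `C¹` maps -/

section LocalDegree

variable {n : ℕ}

local notation "𝔼" => EuclideanSpace ℝ (Fin n)

theorem exists_contDiff_zero_nhds_one_nhds {s t : Set 𝔼} (hs : IsClosed s) (ht : IsClosed t)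
    (hd : Disjoint s t) : ∃ χ : 𝔼 → ℝ, ContDiff ℝ ∞ χ ∧ (∀ x ∈ s, ∀ᶠ y in 𝓝 x, χ y = 0) ∧
      (∀ x ∈ t, ∀ᶠ y in 𝓝 x, χ y = 1) ∧ ∀ x, χ x ∈ Icc (0 : ℝ) 1 := by
  obtain ⟨χ, h0, h1, h2⟩ := exists_contMDiffMap_zero_one_nhds_of_isClosed
    (modelWithCornersSelf ℝ 𝔼) (n := (⊤ : ℕ∞)) hs ht hd
  exact ⟨χ, χ.contMDiff.contDiff, eventually_nhdsSet_iff_forall.1 h0,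
    eventually_nhdsSet_iff_forall.1 h1, h2⟩

theorem continuous_det_fderiv {f : 𝔼 → 𝔼} (hf : ContDiff ℝ 1 f) :
    Continuous fun x => (fderiv ℝ f x).det :=
  ContinuousLinearMap.continuous_det.comp (hf.continuous_fderiv one_ne_zero)

/-- The integral of `φ ∘ f · det Df` only depends on the values of `f` near the boundary. -/
theorem setIntegral_comp_mul_det_congr {f₀ f₁ : 𝔼 → 𝔼} (h₀ : ContDiff ℝ 1 f₀)
    (h₁ : ContDiff ℝ 1 f₁) {R : ℝ} (hR : 0 < R)
    (heq : ∀ x ∉ Metric.closedBall (0 : 𝔼) R, f₀ x = f₁ x) {φ : 𝔼 → ℝ} (hφ : Continuous φ) :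
    ∫ x in Metric.closedBall (0 : 𝔼) R, φ (f₀ x) * (fderiv ℝ f₀ x).det =
      ∫ x in Metric.closedBall (0 : 𝔼) R, φ (f₁ x) * (fderiv ℝ f₁ x).det := by
  -- Since `χ = 1` on a neighbourhood of the ball of radius `R`, the map `id + χ (f - id)` has the
  -- derivative of `f` there; it is the identity outside radius `R + 2`, where the degree formula
  -- applies. The two integrands coincide in the shell between.
  let χ : ContDiffBump (0 : 𝔼) := ⟨R + 1, R + 2, by linarith, by linarith⟩
  have hsmooth : ∀ f : 𝔼 → 𝔼, ContDiff ℝ 1 f → ContDiff ℝ 1 fun x => χ x • (f x - x) :=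
    fun f hf => χ.contDiff.smul (hf.sub contDiff_id)
  have hzero : ∀ f : 𝔼 → 𝔼, ∀ x ∉ Metric.closedBall (0 : 𝔼) (R + 2), χ x • (f x - x) = 0 := by
    intro f x hx
    rw [χ.zero_of_le_dist (by simpa using (not_le.1 (fun h => hx (by simpa using h))).le), zero_smul]
  set u : (𝔼 → 𝔼) → 𝔼 → ℝ := fun f x => φ (x + χ x • (f x - x)) *
    (ContinuousLinearMap.id ℝ 𝔼 + fderiv ℝ (fun x => χ x • (f x - x)) x).det with hu
  have hcont : ∀ f : 𝔼 → 𝔼, ContDiff ℝ 1 f → Continuous (u f) := by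
    intro f hf
    have h := hsmooth f hf
    refine (hφ.comp (continuous_id.add h.continuous)).mul
      (ContinuousLinearMap.continuous_det.comp
        (continuous_const.add (h.continuous_fderiv one_ne_zero)))
  have hin : ∀ f : 𝔼 → 𝔼, ContDiff ℝ 1 f → ∀ x ∈ Metric.closedBall (0 : 𝔼) R,
      u f x = φ (f x) * (fderiv ℝ f x).det := by
    intro f hf x hx
    have hx' : x ∈ Metric.ball (0 : 𝔼) (R + 1) := by
      simp only [Metric.mem_closedBall, Metric.mem_ball] at hx ⊢; linarith
    have hev : (fun y => χ y • (f y - y)) =ᶠ[𝓝 x] fun y => f y - y := by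
      filter_upwards [χ.eventuallyEq_one_of_mem_ball hx'] with y hy
      simp [hy]
    have hder : fderiv ℝ (fun y => χ y • (f y - y)) x =
        fderiv ℝ f x - ContinuousLinearMap.id ℝ 𝔼 := by
      rw [hev.fderiv_eq]
      exact ((hf.differentiable one_ne_zero x).hasFDerivAt.sub (hasFDerivAt_id x)).fderiv
    simp only [hu, hder, hev.self_of_nhds]
    simp
  have hout : ∀ x ∉ Metric.closedBall (0 : 𝔼) R, u f₀ x = u f₁ x := by
    intro x hx
    have hev : (fun y => χ y • (f₀ y - y)) =ᶠ[𝓝 x] fun y => χ y • (f₁ y - y) := by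
      filter_upwards [Metric.isClosed_closedBall.isOpen_compl.mem_nhds hx] with y hy
      rw [heq y hy]
    simp only [hu, hev.fderiv_eq, hev.self_of_nhds]
  have hint : ∀ f : 𝔼 → 𝔼, ContDiff ℝ 1 f → ∀ r, IntegrableOn (u f) (Metric.closedBall 0 r) :=
    fun f hf r => (hcont f hf).continuousOn.integrableOn_compact (isCompact_closedBall _ _)
  have htot : ∫ x in Metric.closedBall (0 : 𝔼) (R + 2), u f₀ x =
      ∫ x in Metric.closedBall (0 : 𝔼) (R + 2), u f₁ x :=
    (integral_comp_id_add (hsmooth f₀ h₀) (hzero f₀) hφ).trans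
      (integral_comp_id_add (hsmooth f₁ h₁) (hzero f₁) hφ).symm
  have hsub : ∫ x in Metric.closedBall (0 : 𝔼) (R + 2), (u f₀ x - u f₁ x) =
      ∫ x in Metric.closedBall (0 : 𝔼) R, (u f₀ x - u f₁ x) :=
    setIntegral_eq_of_subset_of_forall_sdiff_eq_zero measurableSet_closedBall
      (Metric.closedBall_subset_closedBall (by linarith))
      fun x hx => sub_eq_zero.2 (hout x hx.2)
  rw [integral_sub (hint _ h₀ _) (hint _ h₁ _), htot, sub_self,
    integral_sub (hint _ h₀ _) (hint _ h₁ _)] at hsub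
  rw [← setIntegral_congr_fun measurableSet_closedBall (hin f₀ h₀),
    ← setIntegral_congr_fun measurableSet_closedBall (hin f₁ h₁)]
  linarith

theorem exists_pos_subset_closedBall_zero {C : Set 𝔼} (hC : IsCompact C) :
    ∃ R : ℝ, 0 < R ∧ C ⊆ Metric.closedBall 0 R := by
  obtain ⟨R, hR⟩ := hC.isBounded.subset_closedBall (0 : 𝔼)
  exact ⟨max R 1, by positivity, hR.trans (Metric.closedBall_subset_closedBall (le_max_left _ _))⟩

/-- A map near the identity has local degree one: glue it to the identity across the shell between
radii `2s` and `3s`, which does not affect the integral, and compare with the identity. -/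
theorem setIntegral_comp_mul_det_of_near_id {F : 𝔼 → 𝔼} (hF : ContDiff ℝ 1 F) {x₀ : 𝔼} {s : ℝ}
    (hs : 0 < s) (hnear : ∀ x ∈ Metric.closedBall x₀ (3 * s), dist (F x) x < s)
    {φ : 𝔼 → ℝ} (hφ : Continuous φ) (hsupp : ∀ x, φ x ≠ 0 → dist x x₀ ≤ s) :
    ∫ x in Metric.ball x₀ (2 * s), φ (F x) * (fderiv ℝ F x).det = ∫ x, φ x := by
  let χ : ContDiffBump x₀ := ⟨2 * s, 3 * s, by linarith, by linarith⟩
  set f : 𝔼 → 𝔼 := fun x => x + χ x • (F x - x) with hf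
  have hfs : ContDiff ℝ 1 f := contDiff_id.add (χ.contDiff.smul (hF.sub contDiff_id))
  obtain ⟨R, hR, hRsub⟩ := exists_pos_subset_closedBall_zero (isCompact_closedBall x₀ (3 * s))
  have hχ0 : ∀ x ∉ Metric.closedBall x₀ (3 * s), χ x = 0 := fun x hx =>
    χ.zero_of_le_dist (not_le.1 hx).le
  have key := setIntegral_comp_mul_det_congr (contDiff_id (𝕜 := ℝ) (E := 𝔼) (n := 1)) hfs hR
    (fun x hx => by simp [hf, hχ0 x (fun h => hx (hRsub h))]) hφ
  have hbR : Metric.ball x₀ (2 * s) ⊆ Metric.closedBall 0 R :=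
    (Metric.ball_subset_closedBall.trans
      (Metric.closedBall_subset_closedBall (by linarith))).trans hRsub
  -- Points at distance at least `2s` move by less than `s`, hence miss the support of `φ`.
  have hz : ∀ x, 2 * s ≤ dist x x₀ → φ (f x) = 0 := by
    intro x hx
    by_contra hne
    have h1 := hsupp _ hne
    by_cases hx3 : x ∈ Metric.closedBall x₀ (3 * s)
    · have h2 : dist (f x) x < s := by
        have : dist (f x) x = χ x * dist (F x) x := by
          simp [hf, dist_eq_norm, norm_smul, abs_of_nonneg χ.nonneg]
        rw [this]
        have := hnear x hx3
        have h0 := χ.nonneg (x := x)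
        have h1 := χ.le_one (x := x)
        have := dist_nonneg (x := F x) (y := x)
        nlinarith
      have := dist_triangle_left x x₀ (f x)
      linarith
    · have : f x = x := by simp [hf, hχ0 x hx3]
      rw [this] at h1
      linarith
  have e1 : ∫ x in Metric.closedBall (0 : 𝔼) R, φ (f x) * (fderiv ℝ f x).det =
      ∫ x in Metric.ball x₀ (2 * s), φ (f x) * (fderiv ℝ f x).det :=
    setIntegral_eq_of_subset_of_forall_sdiff_eq_zero measurableSet_closedBall hbR
      fun x hx => by rw [hz x (not_lt.1 hx.2), zero_mul]
  have e2 : ∫ x in Metric.ball x₀ (2 * s), φ (f x) * (fderiv ℝ f x).det =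
      ∫ x in Metric.ball x₀ (2 * s), φ (F x) * (fderiv ℝ F x).det := by
    refine setIntegral_congr_fun measurableSet_ball fun x hx => ?_
    have hev : f =ᶠ[𝓝 x] F := by
      filter_upwards [χ.eventuallyEq_one_of_mem_ball hx] with y hy
      simp [hf, hy]
    simp only [hev.fderiv_eq, hev.self_of_nhds]
  have e3 : ∫ x in Metric.closedBall (0 : 𝔼) R, φ (id x) * (fderiv ℝ (id : 𝔼 → 𝔼) x).det =
      ∫ x, φ x := by
    simp only [id, fderiv_id, ContinuousLinearMap.det, ContinuousLinearMap.coe_id,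
      LinearMap.det_id, mul_one]
    refine setIntegral_eq_integral_of_forall_compl_eq_zero fun x hx => ?_
    by_contra hne
    exact hx (hRsub (by have := hsupp x hne; simp only [Metric.mem_closedBall]; linarith))
  rw [← e3, key, e1, e2]

/-- Translation invariance of the local degree. The translation is switched on by a cut-off that
leaves `f` unchanged near the complement of `V`, so the integral keeps its value. -/
theorem setIntegral_comp_add_mul_det {f : 𝔼 → 𝔼} (hf : ContDiff ℝ 1 f) {C V : Set 𝔼}
    (hC : IsCompact C) (hV : IsOpen V) (hVC : V ⊆ C) {z₀ : 𝔼} {r : ℝ} (hr : 0 < r)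
    (hfar : ∀ x ∈ C \ V, 4 * r ≤ dist (f x) z₀) {φ : 𝔼 → ℝ} (hφ : Continuous φ)
    (hsupp : ∀ z, φ z ≠ 0 → dist z z₀ ≤ r) {v : 𝔼} (hv : ‖v‖ ≤ 2 * r) :
    ∫ x in V, φ (f x + v) * (fderiv ℝ f x).det = ∫ x in V, φ (f x) * (fderiv ℝ f x).det := by
  -- Off `K`, any shift by at most `2r` leaves `f x` more than `r` away from `z₀`, where `φ`
  -- vanishes. The margin `4r` puts `K` inside `V`.
  set K := C ∩ f ⁻¹' Metric.closedBall z₀ (3 * r) with hK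
  have hKc : IsClosed K := hC.isClosed.inter (Metric.isClosed_closedBall.preimage hf.continuous)
  have hKV : K ⊆ V := by
    intro x hx
    by_contra hn
    have h1 := hfar x ⟨hx.1, hn⟩
    have h2 : dist (f x) z₀ ≤ 3 * r := hx.2
    linarith
  obtain ⟨χ, hχ, hχ0, hχ1, hχI⟩ := exists_contDiff_zero_nhds_one_nhds hV.isClosed_compl hKc
    (disjoint_compl_left_iff_subset.2 hKV)
  set f₁ : 𝔼 → 𝔼 := fun x => f x + χ x • v with hf₁
  have hf₁s : ContDiff ℝ 1 f₁ :=
    hf.add ((hχ.of_le (by exact_mod_cast le_top)).smul contDiff_const)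
  obtain ⟨R, hR, hRC⟩ := exists_pos_subset_closedBall_zero hC
  have hnotV : ∀ x ∉ V, f₁ =ᶠ[𝓝 x] f := fun x hx => by
    filter_upwards [hχ0 x hx] with y hy
    simp [hf₁, hy]
  have key := setIntegral_comp_mul_det_congr hf hf₁s hR
    (fun x hx => (hnotV x fun h => hx (hRC (hVC h))).self_of_nhds.symm) hφ
  have i0 : Continuous fun x => φ (f x) * (fderiv ℝ f x).det :=
    (hφ.comp hf.continuous).mul (continuous_det_fderiv hf)
  have i1 : Continuous fun x => φ (f₁ x) * (fderiv ℝ f₁ x).det :=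
    (hφ.comp hf₁s.continuous).mul (continuous_det_fderiv hf₁s)
  have hint : ∀ {u : 𝔼 → ℝ}, Continuous u → IntegrableOn u (Metric.closedBall 0 R) := fun h =>
    h.continuousOn.integrableOn_compact (isCompact_closedBall _ _)
  have hVR : V ⊆ Metric.closedBall 0 R := hVC.trans hRC
  have hsub : ∫ x in Metric.closedBall (0 : 𝔼) R,
        (φ (f x) * (fderiv ℝ f x).det - φ (f₁ x) * (fderiv ℝ f₁ x).det) =
      ∫ x in V, (φ (f x) * (fderiv ℝ f x).det - φ (f₁ x) * (fderiv ℝ f₁ x).det) :=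
    setIntegral_eq_of_subset_of_forall_sdiff_eq_zero measurableSet_closedBall hVR
      fun x hx => by rw [(hnotV x hx.2).fderiv_eq, (hnotV x hx.2).self_of_nhds, sub_self]
  rw [integral_sub (hint i0) (hint i1), key, sub_self,
    integral_sub ((hint i0).mono_set hVR) ((hint i1).mono_set hVR)] at hsub
  have e : ∫ x in V, φ (f₁ x) * (fderiv ℝ f₁ x).det =
      ∫ x in V, φ (f x + v) * (fderiv ℝ f x).det := by
    refine setIntegral_congr_fun hV.measurableSet fun x hx => ?_
    by_cases hxK : x ∈ K
    · have hev : f₁ =ᶠ[𝓝 x] fun y => f y + v := by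
        filter_upwards [hχ1 x hxK] with y hy
        simp [hf₁, hy]
      simp only [hev.fderiv_eq, hev.self_of_nhds, fderiv_add_const]
    · have h3 : 3 * r < dist (f x) z₀ := by
        by_contra hn
        exact hxK ⟨hVC hx, not_lt.1 hn⟩
      have hz : ∀ a ∈ Icc (0 : ℝ) 1, φ (f x + a • v) = 0 := by
        intro a ha
        by_contra hne
        have h1 := hsupp _ hne
        have h2 : dist (f x) (f x + a • v) ≤ 2 * r := by
          rw [dist_self_add_right, norm_smul, Real.norm_eq_abs, abs_of_nonneg ha.1]
          nlinarith [ha.1, ha.2, norm_nonneg v]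
        have := dist_triangle (f x) (f x + a • v) z₀
        linarith
      have ha := hz 1 (by simp)
      rw [one_smul] at ha
      simp only [hf₁, hz _ (hχI x), ha, zero_mul]
  rw [← e]
  linarith

theorem integral_integral_swap_of_continuous {H : 𝔼 → 𝔼 → ℝ}
    (hH : Continuous (Function.uncurry H)) {A C V : Set 𝔼} (hA : IsCompact A) (hC : IsCompact C)
    (hVC : V ⊆ C) :
    ∫ w in A, ∫ x in V, H w x = ∫ x in V, ∫ w in A, H w x := by
  apply integral_integral_swap
  rw [Measure.prod_restrict]
  exact (hH.continuousOn.integrableOn_compact (hA.prod hC)).mono_set (prod_mono_right hVC)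

/-- Over a ball that is far from the image of the boundary, the push-forward of `det Df` is a
constant multiple of Lebesgue measure. -/
theorem exists_setIntegral_comp_mul_det_eq {f : 𝔼 → 𝔼} (hf : ContDiff ℝ 1 f) {C V : Set 𝔼}
    (hC : IsCompact C) (hV : IsOpen V) (hVC : V ⊆ C) {z₀ : 𝔼} {r : ℝ} (hr : 0 < r)
    (hfar : ∀ x ∈ C \ V, 4 * r ≤ dist (f x) z₀) :
    ∃ c : ℝ, ∀ φ : 𝔼 → ℝ, Continuous φ → (∀ z, φ z ≠ 0 → dist z z₀ ≤ r) →
      ∫ x in V, φ (f x) * (fderiv ℝ f x).det = c * ∫ z, φ z := by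
  let b : ContDiffBump (0 : 𝔼) := ⟨r / 2, r, by linarith, by linarith⟩
  set ψ : 𝔼 → ℝ := b.normed volume
  have hψc : Continuous ψ := b.continuous_normed
  have hψ0 : ∀ w, r < ‖w‖ → ψ w = 0 := by
    intro w hw
    have : w ∉ Function.support ψ := by
      rw [b.support_normed_eq]; simpa using hw.le
    simpa using this
  set J : 𝔼 → ℝ := fun x => (fderiv ℝ f x).det
  have hJ : Continuous J := continuous_det_fderiv hf
  have hfc := hf.continuous
  refine ⟨∫ x in V, ψ (f x - z₀) * J x, fun φ hφ hsupp => ?_⟩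
  set c := ∫ x in V, ψ (f x - z₀) * J x
  -- By translation invariance the kernel in the definition of `c` may be centred at any `w` in the
  -- support of `φ`.
  have h1 : ∀ w, φ w * c = ∫ x in V, φ w * (ψ (f x - w) * J x) := by
    intro w
    rw [integral_const_mul]
    by_cases hw : φ w = 0
    · simp [hw]
    · congr 1
      have := setIntegral_comp_add_mul_det hf hC hV hVC hr hfar (φ := fun z => ψ (z - z₀))
        (by fun_prop) (fun z hz => by
          rw [dist_eq_norm]; exact not_lt.1 fun h => hz (hψ0 _ h)) (v := z₀ - w) (by
          rw [← dist_eq_norm, dist_comm]; linarith [hsupp w hw])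
      refine this.symm.trans (integral_congr_ae (Eventually.of_forall fun x => ?_))
      simp only [J]
      congr 2
      abel
  have hA : IsCompact (Metric.closedBall z₀ r) := isCompact_closedBall _ _
  have hA0 : IsCompact (Metric.closedBall (0 : 𝔼) r) := isCompact_closedBall _ _
  have s1 : c * ∫ z, φ z = ∫ w in Metric.closedBall z₀ r, ∫ x in V, φ w * (ψ (f x - w) * J x) := by
    rw [← integral_const_mul, ← setIntegral_eq_integral_of_forall_compl_eq_zero
      (s := Metric.closedBall z₀ r) (f := fun z => c * φ z)]
    · simp_rw [← h1, mul_comm c]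
    · intro z hz
      by_contra hne
      exact hz (hsupp z fun h => hne (by rw [h, mul_zero]))
  have s2 : (∫ w in Metric.closedBall z₀ r, ∫ x in V, φ w * (ψ (f x - w) * J x)) =
      ∫ x in V, ∫ w in Metric.closedBall z₀ r, φ w * (ψ (f x - w) * J x) :=
    integral_integral_swap_of_continuous (by simp only [Function.uncurry_def]; fun_prop) hA hC hVC
  -- The substitution `w = f x - v` moves the shift into `φ`; after a second exchange of integrals,
  -- invariance removes the shift and `∫ ψ = 1` remains.
  have s3 : (∫ x in V, ∫ w in Metric.closedBall z₀ r, φ w * (ψ (f x - w) * J x)) =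
      ∫ x in V, ∫ v in Metric.closedBall (0 : 𝔼) r, φ (f x - v) * (ψ v * J x) := by
    congr 1
    ext x
    rw [setIntegral_eq_integral_of_forall_compl_eq_zero,
      setIntegral_eq_integral_of_forall_compl_eq_zero,
      ← integral_sub_left_eq_self (fun w => φ w * (ψ (f x - w) * J x)) volume (f x)]
    · simp
    · intro v hv
      rw [hψ0 v (by simpa using hv)]; simp
    · intro w hw
      by_contra hne
      exact hw (hsupp w fun h => hne (by rw [h, zero_mul]))
  have s4 : (∫ x in V, ∫ v in Metric.closedBall (0 : 𝔼) r, φ (f x - v) * (ψ v * J x)) =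
      ∫ v in Metric.closedBall (0 : 𝔼) r, ∫ x in V, φ (f x - v) * (ψ v * J x) :=
    (integral_integral_swap_of_continuous (by simp only [Function.uncurry_def]; fun_prop)
      hA0 hC hVC).symm
  have s5 : (∫ v in Metric.closedBall (0 : 𝔼) r, ∫ x in V, φ (f x - v) * (ψ v * J x)) =
      ∫ v in Metric.closedBall (0 : 𝔼) r, ψ v * ∫ x in V, φ (f x) * J x := by
    refine setIntegral_congr_fun measurableSet_closedBall fun v hv => ?_
    have hv' : ‖v‖ ≤ r := by simpa using hv
    have := setIntegral_comp_add_mul_det hf hC hV hVC hr hfar hφ hsupp (v := -v)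
      (by rw [norm_neg]; linarith)
    refine Eq.trans ?_ (congrArg (ψ v * ·) this)
    rw [← integral_const_mul]
    refine integral_congr_ae (Eventually.of_forall fun x => ?_)
    simp only [J, ← sub_eq_add_neg]
    ring
  have s6 : ∫ v in Metric.closedBall (0 : 𝔼) r, ψ v = 1 := by
    rw [setIntegral_eq_integral_of_forall_compl_eq_zero, b.integral_normed]
    intro v hv
    exact hψ0 v (by simpa using hv)
  rw [s1, s2, s3, s4, s5, integral_mul_const, s6, one_mul]

theorem exists_continuous_supported_integral_pos (z : 𝔼) {ρ : ℝ} (hρ : 0 < ρ) :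
    ∃ φ : 𝔼 → ℝ, Continuous φ ∧ (∀ w, 0 ≤ φ w) ∧ (∀ w, φ w ≠ 0 → dist w z < ρ) ∧
      0 < ∫ w, φ w := by
  let b : ContDiffBump z := ⟨ρ / 2, ρ, by linarith, by linarith⟩
  refine ⟨b, b.continuous, fun w => b.nonneg, fun w hw => ?_, b.integral_pos⟩
  by_contra hn
  exact hw (b.zero_of_le_dist (not_lt.1 hn))

/-- A ball over which the degree does not vanish is covered by the image. -/
theorem volume_closedBall_le_lintegral_abs_det {f : 𝔼 → 𝔼} (hf : ContDiff ℝ 1 f) {C V : Set 𝔼}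
    (hC : IsCompact C) (hV : IsOpen V) (hVC : V ⊆ C) {z₀ : 𝔼} {r : ℝ} (hr : 0 < r)
    (hfar : ∀ x ∈ C \ V, 4 * r ≤ dist (f x) z₀) {c : ℝ} (hc : c ≠ 0)
    (hdeg : ∀ φ : 𝔼 → ℝ, Continuous φ → (∀ z, φ z ≠ 0 → dist z z₀ ≤ r) →
      ∫ x in V, φ (f x) * (fderiv ℝ f x).det = c * ∫ z, φ z) {a : ℝ} (ha : a < r) :
    volume (Metric.closedBall z₀ a) ≤
      ∫⁻ x in V ∩ f ⁻¹' Metric.closedBall z₀ a, ENNReal.ofReal |(fderiv ℝ f x).det| := by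
  have hcov : Metric.closedBall z₀ a ⊆ f '' (V ∩ f ⁻¹' Metric.closedBall z₀ a) := by
    intro z hz
    have hza : dist z z₀ ≤ a := hz
    have hzC : z ∈ f '' C := by
      -- A point missed by the compact set `f '' C` has a neighbourhood missed by it. A bump there,
      -- of radius at most `r - a` to stay in the admissible ball, would give `c ∫ φ = 0`.
      by_contra hn
      obtain ⟨ρ, hρ, hρs⟩ := Metric.isOpen_iff.1
        (hC.image hf.continuous).isClosed.isOpen_compl z hn
      obtain ⟨φ, hφc, -, hφs, hφp⟩ := exists_continuous_supported_integral_pos z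
        (show 0 < min ρ (r - a) from lt_min hρ (by linarith))
      have h1 := hdeg φ hφc fun w hw => by
        have := (hφs w hw).trans_le (min_le_right _ _)
        have := dist_triangle w z z₀
        linarith
      have h2 : ∫ x in V, φ (f x) * (fderiv ℝ f x).det = 0 := by
        refine setIntegral_eq_zero_of_forall_eq_zero fun x hx => ?_
        have : φ (f x) = 0 := by
          by_contra hne
          exact hρs ((hφs _ hne).trans_le (min_le_left _ _)) ⟨x, hVC hx, rfl⟩
        rw [this, zero_mul]
      rw [h2] at h1
      exact (mul_ne_zero hc hφp.ne') h1.symm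
    obtain ⟨x, hx, rfl⟩ := hzC
    refine ⟨x, ⟨?_, hz⟩, rfl⟩
    by_contra hn
    linarith [hfar x ⟨hx, hn⟩]
  refine (measure_mono hcov).trans (addHaar_image_le_lintegral_abs_det_fderiv volume
    (hV.measurableSet.inter (Metric.isClosed_closedBall.preimage hf.continuous).measurableSet)
    fun x _ => (hf.differentiable one_ne_zero x).hasFDerivAt.hasFDerivWithinAt)

end LocalDegree

/-! ### Strong limits of Jacobians -/

section Limit

variable {n : ℕ}

local notation "𝔼" => EuclideanSpace ℝ (Fin n)

/-- `y : Ω₁ → Ω₂` and `ξ : Ω₂ → Ω₁` are mutually inverse homeomorphisms of open sets. -/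
structure IsHomeoPair (Ω₁ Ω₂ : Set (EuclideanSpace ℝ (Fin n)))
    (y ξ : EuclideanSpace ℝ (Fin n) → EuclideanSpace ℝ (Fin n)) : Prop where
  isOpen_left : IsOpen Ω₁
  isOpen_right : IsOpen Ω₂
  mapsTo : MapsTo y Ω₁ Ω₂
  mapsTo_inv : MapsTo ξ Ω₂ Ω₁
  invOn : InvOn ξ y Ω₁ Ω₂
  continuousOn : ContinuousOn y Ω₁
  continuousOn_inv : ContinuousOn ξ Ω₂

theorem IsHomeoPair.symm {Ω₁ Ω₂ : Set 𝔼} {y ξ : 𝔼 → 𝔼} (h : IsHomeoPair Ω₁ Ω₂ y ξ) :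
    IsHomeoPair Ω₂ Ω₁ ξ y :=
  ⟨h.isOpen_right, h.isOpen_left, h.mapsTo_inv, h.mapsTo, h.invOn.symm, h.continuousOn_inv,
    h.continuousOn⟩

theorem IsHomeoPair.image_inv_eq {Ω₁ Ω₂ : Set 𝔼} {y ξ : 𝔼 → 𝔼} (h : IsHomeoPair Ω₁ Ω₂ y ξ)
    {S : Set 𝔼} (hS : S ⊆ Ω₂) : ξ '' S = Ω₁ ∩ y ⁻¹' S := by
  ext x
  constructor
  · rintro ⟨z, hz, rfl⟩
    exact ⟨h.mapsTo_inv (hS hz), by rw [mem_preimage, h.invOn.2 (hS hz)]; exact hz⟩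
  · rintro ⟨hx, hxS⟩
    exact ⟨y x, hxS, h.invOn.1 hx⟩

theorem IsHomeoPair.image_eq {Ω₁ Ω₂ : Set 𝔼} {y ξ : 𝔼 → 𝔼} (h : IsHomeoPair Ω₁ Ω₂ y ξ)
    {S : Set 𝔼} (hS : S ⊆ Ω₁) : y '' S = Ω₂ ∩ ξ ⁻¹' S := h.symm.image_inv_eq hS

theorem IsHomeoPair.isOpen_preimage {Ω₁ Ω₂ : Set 𝔼} {y ξ : 𝔼 → 𝔼} (h : IsHomeoPair Ω₁ Ω₂ y ξ)
    {S : Set 𝔼} (hS : IsOpen S) : IsOpen (Ω₁ ∩ y ⁻¹' S) :=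
  h.continuousOn.isOpen_inter_preimage h.isOpen_left hS

theorem IsHomeoPair.isCompact_preimage {Ω₁ Ω₂ : Set 𝔼} {y ξ : 𝔼 → 𝔼}
    (h : IsHomeoPair Ω₁ Ω₂ y ξ) {S : Set 𝔼} (hS : IsCompact S) (hSΩ : S ⊆ Ω₂) :
    IsCompact (Ω₁ ∩ y ⁻¹' S) := by
  rw [← h.image_inv_eq hSΩ]
  exact hS.image_of_continuousOn (h.continuousOn_inv.mono hSΩ)

/-- The maps `f k` are `C¹`, converge to `y` locally uniformly on `Ω`, and their Jacobians converge
to `J` in `L¹_loc(Ω)`. -/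
structure JacobianApprox (Ω : Set (EuclideanSpace ℝ (Fin n)))
    (y : EuclideanSpace ℝ (Fin n) → EuclideanSpace ℝ (Fin n))
    (J : EuclideanSpace ℝ (Fin n) → ℝ)
    (f : ℕ → EuclideanSpace ℝ (Fin n) → EuclideanSpace ℝ (Fin n)) : Prop where
  contDiff : ∀ k, ContDiff ℝ 1 (f k)
  tendstoUniformlyOn : ∀ C ⊆ Ω, IsCompact C → TendstoUniformlyOn f y atTop C
  integrableOn : ∀ C ⊆ Ω, IsCompact C → IntegrableOn J C
  tendsto_integral : ∀ C ⊆ Ω, IsCompact C →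
    Tendsto (fun k => ∫ x in C, |(fderiv ℝ (f k) x).det - J x|) atTop (𝓝 0)

/-- Uniform convergence times `L¹` convergence, by the splitting `u d - u₀ J = u (d - J) + (u - u₀)
J`. -/
theorem tendsto_setIntegral_mul_of_tendstoUniformlyOn {u : ℕ → 𝔼 → ℝ} {u₀ : 𝔼 → ℝ}
    {d : ℕ → 𝔼 → ℝ} {J : 𝔼 → ℝ} {C V : Set 𝔼} (hC : IsCompact C) (hVC : V ⊆ C)
    (hu : ∀ᶠ k in atTop, ContinuousOn (u k) C) (hu₀ : ContinuousOn u₀ C)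
    (hd : ∀ k, Continuous (d k)) (hJ : IntegrableOn J C)
    (hlim : TendstoUniformlyOn u u₀ atTop C)
    (hdJ : Tendsto (fun k => ∫ x in C, |d k x - J x|) atTop (𝓝 0)) :
    Tendsto (fun k => ∫ x in V, u k x * d k x) atTop (𝓝 (∫ x in V, u₀ x * J x)) := by
  obtain ⟨M, hM⟩ := hC.exists_bound_of_continuousOn hu₀
  set I := ∫ x in C, |J x|
  have hI : 0 ≤ I := integral_nonneg fun _ => abs_nonneg _
  rw [Metric.tendsto_atTop]
  intro ε hε
  set η := ε / (2 * (I + 1))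
  have hη : 0 < η := by positivity
  have hηI : η * I < ε / 2 := by
    rw [show η * I = ε * I / (2 * (I + 1)) by simp [η]; ring, div_lt_div_iff₀ (by positivity)
      two_pos]
    nlinarith
  set M' := |M| + 1
  have h1 := Metric.tendstoUniformlyOn_iff.1 hlim (min η 1) (by positivity)
  have h2 : ∀ᶠ k in atTop, ∫ x in C, |d k x - J x| < ε / (2 * M') :=
    hdJ.eventually (gt_mem_nhds (by positivity))
  obtain ⟨N, hN⟩ := eventually_atTop.1 (h1.and (h2.and hu))
  refine ⟨N, fun k hk => ?_⟩
  obtain ⟨hk1, hk2, hk3⟩ := hN k hk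
  have idk : IntegrableOn (d k) C := (hd k).continuousOn.integrableOn_compact hC
  have i1 : IntegrableOn (fun x => u k x * d k x) C :=
    (hk3.mul (hd k).continuousOn).integrableOn_compact hC
  have i2 : IntegrableOn (fun x => u₀ x * J x) C := hJ.continuousOn_mul hu₀ hC
  have i3 : IntegrableOn (fun x => |d k x - J x|) C := (idk.sub hJ).abs
  rw [Real.dist_eq, ← integral_sub (i1.mono_set hVC) (i2.mono_set hVC)]
  calc |∫ x in V, (u k x * d k x - u₀ x * J x)|
      ≤ ∫ x in V, |u k x * d k x - u₀ x * J x| := abs_integral_le_integral_abs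
    _ ≤ ∫ x in C, |u k x * d k x - u₀ x * J x| :=
        setIntegral_mono_set (i1.sub i2).abs (Eventually.of_forall fun _ => abs_nonneg _)
          hVC.eventuallyLE
    _ ≤ ∫ x in C, (M' * |d k x - J x| + η * |J x|) := by
        refine setIntegral_mono_on (i1.sub i2).abs ((i3.const_mul _).add (hJ.abs.const_mul _))
          hC.measurableSet fun x hx => ?_
        have e : u k x * d k x - u₀ x * J x = u k x * (d k x - J x) + (u k x - u₀ x) * J x := by
          ring
        have b1 : |u k x - u₀ x| < min η 1 := by
          have := hk1 x hx
          rwa [dist_comm, Real.dist_eq] at this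
        have b2 : |u k x| ≤ M' := by
          have h3 : |u₀ x| ≤ M := by simpa using hM x hx
          have h4 := abs_sub_abs_le_abs_sub (u k x) (u₀ x)
          have h5 := b1.trans_le (min_le_right _ _)
          have h6 := le_abs_self M
          simp only [M']
          linarith
        rw [e]
        refine (abs_add_le _ _).trans ?_
        rw [abs_mul, abs_mul]
        gcongr
        exact (b1.trans_le (min_le_left _ _)).le
    _ = M' * (∫ x in C, |d k x - J x|) + η * I := by
        rw [integral_add (i3.const_mul _) (hJ.abs.const_mul _), integral_const_mul,
          integral_const_mul]
    _ < ε := by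
        have : M' * (∫ x in C, |d k x - J x|) < ε / 2 := by
          have hM' : 0 < M' := by positivity
          calc _ < M' * (ε / (2 * M')) := by gcongr
            _ = ε / 2 := by field_simp
        linarith

theorem hasCompactSupport_of_forall_dist_le {φ : 𝔼 → ℝ} {z₀ : 𝔼} {r : ℝ}
    (hsupp : ∀ z, φ z ≠ 0 → dist z z₀ ≤ r) : HasCompactSupport φ :=
  HasCompactSupport.intro (isCompact_closedBall z₀ r) fun x hx => by
    by_contra hne
    exact hx (hsupp x hne)

theorem JacobianApprox.tendsto_setIntegral_comp {Ω : Set 𝔼} {y : 𝔼 → 𝔼} {J : 𝔼 → ℝ}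
    {f : ℕ → 𝔼 → 𝔼} (h : JacobianApprox Ω y J f) (hy : ContinuousOn y Ω) {C V : Set 𝔼}
    (hC : IsCompact C) (hCΩ : C ⊆ Ω) (hVC : V ⊆ C) {φ : 𝔼 → ℝ} (hφ : Continuous φ)
    (hφs : HasCompactSupport φ) :
    Tendsto (fun k => ∫ x in V, φ (f k x) * (fderiv ℝ (f k) x).det) atTop
      (𝓝 (∫ x in V, φ (y x) * J x)) := by
  refine tendsto_setIntegral_mul_of_tendstoUniformlyOn (u := fun k x => φ (f k x)) hC hVC
    (Eventually.of_forall fun k => (hφ.comp (h.contDiff k).continuous).continuousOn)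
    (hφ.comp_continuousOn (hy.mono hCΩ)) (fun k => continuous_det_fderiv (h.contDiff k))
    (h.integrableOn C hCΩ hC) ?_ (h.tendsto_integral C hCΩ hC)
  exact (hφs.uniformContinuous_of_continuous hφ).comp_tendstoUniformlyOn
    (h.tendstoUniformlyOn C hCΩ hC)

/-- Locally, the push-forward of `J` under `y` is a constant multiple of Lebesgue measure; if the
constant is not zero then `J` dominates the volume of the image. -/
theorem JacobianApprox.exists_degree {Ω₁ Ω₂ : Set 𝔼} {y ξ : 𝔼 → 𝔼} {J : 𝔼 → ℝ}
    {f : ℕ → 𝔼 → 𝔼} (hp : IsHomeoPair Ω₁ Ω₂ y ξ) (h : JacobianApprox Ω₁ y J f) {z₀ : 𝔼} {r : ℝ}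
    (hr : 0 < r) (hball : Metric.closedBall z₀ (5 * r) ⊆ Ω₂) :
    ∃ c : ℝ, (∀ φ : 𝔼 → ℝ, Continuous φ → (∀ z, φ z ≠ 0 → dist z z₀ ≤ r) →
        ∫ x in Ω₁, φ (y x) * J x = c * ∫ z, φ z) ∧
      (c ≠ 0 → ∀ a b, a < b → b ≤ r → volume (Metric.closedBall z₀ a) ≤
        ∫⁻ x in Ω₁ ∩ y ⁻¹' Metric.closedBall z₀ b, ENNReal.ofReal |J x|) := by
  -- On `C \ V` the values of `y` are at distance at least `5r` from `z₀`; uniform closeness within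
  -- `r` leaves the margin `4r` for `f k`.
  set C := Ω₁ ∩ y ⁻¹' Metric.closedBall z₀ (5 * r)
  set V := Ω₁ ∩ y ⁻¹' Metric.ball z₀ (5 * r)
  have hC : IsCompact C := hp.isCompact_preimage (isCompact_closedBall _ _) hball
  have hCΩ : C ⊆ Ω₁ := inter_subset_left
  have hV : IsOpen V := hp.isOpen_preimage Metric.isOpen_ball
  have hVC : V ⊆ C := inter_subset_inter_right _ (preimage_mono Metric.ball_subset_closedBall)
  have hunif : ∀ ε > 0, ∀ᶠ k in atTop, ∀ x ∈ C, dist (y x) (f k x) < ε := fun ε hε =>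
    Metric.tendstoUniformlyOn_iff.1 (h.tendstoUniformlyOn C hCΩ hC) ε hε
  have hfar : ∀ᶠ k in atTop, ∀ x ∈ C \ V, 4 * r ≤ dist (f k x) z₀ := by
    filter_upwards [hunif r hr] with k hk x hx
    have h1 : 5 * r ≤ dist (y x) z₀ := not_lt.1 fun hlt => hx.2 ⟨hx.1.1, hlt⟩
    have h2 := hk x hx.1
    have := dist_triangle (y x) (f k x) z₀
    linarith
  have hex : ∃ c : ℕ → ℝ, ∀ᶠ k in atTop, ∀ φ : 𝔼 → ℝ, Continuous φ →
      (∀ z, φ z ≠ 0 → dist z z₀ ≤ r) →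
      ∫ x in V, φ (f k x) * (fderiv ℝ (f k) x).det = c k * ∫ z, φ z := by
    have : ∀ k, ∃ c : ℝ, (∀ x ∈ C \ V, 4 * r ≤ dist (f k x) z₀) → ∀ φ : 𝔼 → ℝ, Continuous φ →
        (∀ z, φ z ≠ 0 → dist z z₀ ≤ r) →
        ∫ x in V, φ (f k x) * (fderiv ℝ (f k) x).det = c * ∫ z, φ z := by
      intro k
      by_cases hk : ∀ x ∈ C \ V, 4 * r ≤ dist (f k x) z₀
      · obtain ⟨c, hc⟩ := exists_setIntegral_comp_mul_det_eq (h.contDiff k) hC hV hVC hr hk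
        exact ⟨c, fun _ => hc⟩
      · exact ⟨0, fun hk' => absurd hk' hk⟩
    choose c hc using this
    exact ⟨c, hfar.mono hc⟩
  obtain ⟨c, hc⟩ := hex
  have hlim : ∀ φ : 𝔼 → ℝ, Continuous φ → (∀ z, φ z ≠ 0 → dist z z₀ ≤ r) →
      Tendsto (fun k => c k * ∫ z, φ z) atTop (𝓝 (∫ x in Ω₁, φ (y x) * J x)) := by
    intro φ hφ hs
    have e : ∫ x in Ω₁, φ (y x) * J x = ∫ x in V, φ (y x) * J x := by
      refine setIntegral_eq_of_subset_of_forall_sdiff_eq_zero hp.isOpen_left.measurableSet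
        inter_subset_left fun x hx => ?_
      have : φ (y x) = 0 := by
        by_contra hne
        exact hx.2 ⟨hx.1, (hs _ hne).trans_lt (by linarith)⟩
      rw [this, zero_mul]
    rw [e]
    refine (h.tendsto_setIntegral_comp hp.continuousOn hC hCΩ hVC hφ
      (hasCompactSupport_of_forall_dist_le hs)).congr' ?_
    filter_upwards [hc] with k hk
    exact hk φ hφ hs
  -- A single bump of positive mass recovers each degree as a quotient, so the degrees converge.
  obtain ⟨φ₁, hφ₁, -, hs₁, hpos⟩ := exists_continuous_supported_integral_pos z₀ hr
  have hs₁' : ∀ z, φ₁ z ≠ 0 → dist z z₀ ≤ r := fun z hz => (hs₁ z hz).le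
  set c₀ := (∫ x in Ω₁, φ₁ (y x) * J x) / ∫ z, φ₁ z
  have hc₀ : Tendsto c atTop (𝓝 c₀) := by
    refine ((hlim φ₁ hφ₁ hs₁').div_const (∫ z, φ₁ z)).congr fun k => ?_
    field_simp
  refine ⟨c₀, fun φ hφ hs => tendsto_nhds_unique (hlim φ hφ hs) (hc₀.mul_const _), ?_⟩
  intro hne a b hab hbr
  have hSm : MeasurableSet (Ω₁ ∩ y ⁻¹' Metric.closedBall z₀ b) :=
    (hp.isCompact_preimage (isCompact_closedBall _ _)
      ((Metric.closedBall_subset_closedBall (by linarith)).trans hball)).measurableSet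
  have hSC : Ω₁ ∩ y ⁻¹' Metric.closedBall z₀ b ⊆ C :=
    inter_subset_inter_right _ (preimage_mono (Metric.closedBall_subset_closedBall (by linarith)))
  have hlim2 : Tendsto (fun k => (∫⁻ x in Ω₁ ∩ y ⁻¹' Metric.closedBall z₀ b,
      ENNReal.ofReal |J x|) + ENNReal.ofReal (∫ x in C, |(fderiv ℝ (f k) x).det - J x|)) atTop
      (𝓝 ((∫⁻ x in Ω₁ ∩ y ⁻¹' Metric.closedBall z₀ b, ENNReal.ofReal |J x|) + 0)) := by
    refine tendsto_const_nhds.add ?_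
    rw [← ENNReal.ofReal_zero]
    exact ENNReal.tendsto_ofReal (h.tendsto_integral C hCΩ hC)
  rw [add_zero] at hlim2
  refine ge_of_tendsto hlim2 ?_
  -- For large `k` the degree is nonzero, so the covering estimate holds for `f k`; closeness within
  -- `b - a` carries the preimage of the `a`-ball into the `y`-preimage of the `b`-ball.
  filter_upwards [hc, hfar, hc₀.eventually_ne hne, hunif (b - a) (by linarith)]
    with k hk1 hk2 hk3 hk4
  have iJ := h.integrableOn C hCΩ hC
  have id : IntegrableOn (fun x => (fderiv ℝ (f k) x).det) C :=
    (continuous_det_fderiv (h.contDiff k)).continuousOn.integrableOn_compact hC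
  calc volume (Metric.closedBall z₀ a)
      ≤ ∫⁻ x in V ∩ f k ⁻¹' Metric.closedBall z₀ a, ENNReal.ofReal |(fderiv ℝ (f k) x).det| :=
        volume_closedBall_le_lintegral_abs_det (h.contDiff k) hC hV hVC hr hk2 hk3 hk1
          (hab.trans_le hbr)
    _ ≤ ∫⁻ x in Ω₁ ∩ y ⁻¹' Metric.closedBall z₀ b, ENNReal.ofReal |(fderiv ℝ (f k) x).det| := by
        refine lintegral_mono_set fun x hx => ⟨hx.1.1, ?_⟩
        have h1 := hk4 x (hVC hx.1)
        have h2 : dist (f k x) z₀ ≤ a := hx.2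
        have := dist_triangle (y x) (f k x) z₀
        simp only [mem_preimage, Metric.mem_closedBall]
        linarith
    _ ≤ ∫⁻ x in Ω₁ ∩ y ⁻¹' Metric.closedBall z₀ b,
          (ENNReal.ofReal |J x| + ENNReal.ofReal |(fderiv ℝ (f k) x).det - J x|) := by
        refine lintegral_mono fun x => ?_
        rw [← ENNReal.ofReal_add (abs_nonneg _) (abs_nonneg _)]
        refine ENNReal.ofReal_le_ofReal ?_
        have := abs_add_le (J x) ((fderiv ℝ (f k) x).det - J x)
        rwa [add_sub_cancel] at this
    _ = (∫⁻ x in Ω₁ ∩ y ⁻¹' Metric.closedBall z₀ b, ENNReal.ofReal |J x|) +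
          ∫⁻ x in Ω₁ ∩ y ⁻¹' Metric.closedBall z₀ b,
            ENNReal.ofReal |(fderiv ℝ (f k) x).det - J x| :=
        lintegral_add_left' ((iJ.mono_set hSC).aestronglyMeasurable.aemeasurable.abs.ennreal_ofReal)
          _
    _ ≤ _ := by
        gcongr
        have ii : IntegrableOn (fun x => |(fderiv ℝ (f k) x).det - J x|) C := (id.sub iJ).abs
        rw [ofReal_integral_eq_lintegral_ofReal ii
          (Eventually.of_forall fun _ => abs_nonneg _)]
        exact lintegral_mono_set hSC

end Limit

/-! ### Multiplicativity of the local degree -/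

section Multiplicativity

variable {n : ℕ}

local notation "𝔼" => EuclideanSpace ℝ (Fin n)

theorem det_fderiv_comp {f g : 𝔼 → 𝔼} (hf : ContDiff ℝ 1 f) (hg : ContDiff ℝ 1 g) (x : 𝔼) :
    (fderiv ℝ (fun x => g (f x)) x).det = (fderiv ℝ g (f x)).det * (fderiv ℝ f x).det := by
  have h : fderiv ℝ (fun x => g (f x)) x = (fderiv ℝ g (f x)).comp (fderiv ℝ f x) :=
    fderiv_comp x (hg.differentiable one_ne_zero _) (hf.differentiable one_ne_zero _)
  rw [h]
  exact LinearMap.det_comp _ _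

/-- The local degrees of a homeomorphism and of its inverse are mutually inverse. -/
theorem JacobianApprox.degree_mul {Ω₁ Ω₂ : Set 𝔼} {y ξ : 𝔼 → 𝔼} {J J' : 𝔼 → ℝ}
    {f g : ℕ → 𝔼 → 𝔼} (hp : IsHomeoPair Ω₁ Ω₂ y ξ) (hf : JacobianApprox Ω₁ y J f)
    (hg : JacobianApprox Ω₂ ξ J' g) {x₀ z₀ : 𝔼} {r s c : ℝ} (hs : 0 < s)
    (hsub : Metric.closedBall x₀ (3 * s) ⊆ Ω₁)
    (himg : ∀ x ∈ Metric.closedBall x₀ (3 * s), dist (y x) z₀ ≤ r)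
    (hc : ∀ φ : 𝔼 → ℝ, Continuous φ → (∀ z, φ z ≠ 0 → dist z z₀ ≤ r) →
        ∫ x in Ω₁, φ (y x) * J x = c * ∫ z, φ z)
    {φ : 𝔼 → ℝ} (hφ : Continuous φ) (hφs : ∀ x, φ x ≠ 0 → dist x x₀ ≤ s) :
    c * ∫ z in Ω₂, φ (ξ z) * J' z = ∫ x, φ x := by
  set C := Metric.closedBall x₀ (3 * s)
  have hC : IsCompact C := isCompact_closedBall _ _
  set Y := Ω₂ ∩ ξ ⁻¹' C
  have hY : IsCompact Y := hp.symm.isCompact_preimage hC hsub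
  have hYΩ : Y ⊆ Ω₂ := inter_subset_left
  obtain ⟨ρ, hρ, hρΩ⟩ := hY.exists_cthickening_subset_open hp.isOpen_right hYΩ
  set N := Metric.cthickening ρ Y
  have hN : IsCompact N := hY.cthickening
  set B := Ω₂ ∩ ξ ⁻¹' Metric.ball x₀ (2 * s)
  have hB : IsOpen B := hp.symm.isOpen_preimage Metric.isOpen_ball
  have hballC : Metric.ball x₀ (2 * s) ⊆ C :=
    Metric.ball_subset_closedBall.trans (Metric.closedBall_subset_closedBall (by linarith))
  have hBY : B ⊆ Y := inter_subset_inter_right _ (preimage_mono hballC)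
  -- The support of `φ` has radius `s`; the extra `s / 2` allows for the error in replacing `ξ` by
  -- `g j`.
  set D := Ω₂ ∩ ξ ⁻¹' Metric.closedBall x₀ (3 / 2 * s)
  have hD : IsCompact D := hp.symm.isCompact_preimage (isCompact_closedBall _ _)
    ((Metric.closedBall_subset_closedBall (by linarith)).trans hsub)
  have hDB : D ⊆ B := inter_subset_inter_right _
    (preimage_mono (Metric.closedBall_subset_ball (by linarith)))
  obtain ⟨η, hηs, hη0, hη1, hηI⟩ := exists_contDiff_zero_nhds_one_nhds hB.isClosed_compl
    hD.isClosed (disjoint_compl_left_iff_subset.2 hDB)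
  have hηc : Continuous η := hηs.continuous
  have hηB : ∀ z, η z ≠ 0 → z ∈ B := fun z hz => by
    by_contra hn
    exact hz (hη0 z hn).self_of_nhds
  have hηD : ∀ z ∈ D, η z = 1 := fun z hz => (hη1 z hz).self_of_nhds
  -- Including the Jacobian of `g j` in the test function turns the degree formula for `y` into one
  -- for a composition. The cut-off `η` localises `θ j`, since away from `N` nothing is known about
  -- `g j`.
  set θ : ℕ → 𝔼 → ℝ := fun j z => η z * φ (g j z) * (fderiv ℝ (g j) z).det with hθ
  have hθc : ∀ j, Continuous (θ j) := fun j =>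
    (hηc.mul (hφ.comp (hg.contDiff j).continuous)).mul (continuous_det_fderiv (hg.contDiff j))
  have hθB : ∀ j z, θ j z ≠ 0 → z ∈ B := fun j z hz => hηB z fun h => hz (by simp [hθ, h])
  have hθs : ∀ j z, θ j z ≠ 0 → dist z z₀ ≤ r := fun j z hz => by
    have h1 := hθB j z hz
    have h2 := himg (ξ z) (hballC h1.2)
    rwa [hp.invOn.2 h1.1] at h2
  -- With `j` fixed, let `k → ∞`: the map `g j ∘ f k` is close to the identity, so it has local
  -- degree one. The limit `j → ∞` is taken afterwards.
  have hfix : ∀ᶠ j in atTop, c * ∫ z, θ j z = ∫ x, φ x := by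
    filter_upwards [Metric.tendstoUniformlyOn_iff.1 (hg.tendstoUniformlyOn N hρΩ hN) (s / 2)
      (by linarith)] with j hj
    have hk : ∀ᶠ k in atTop, ∀ x ∈ C, f k x ∈ N ∧ dist (ξ (f k x)) x < s / 2 := by
      have huc : UniformContinuousOn ξ N :=
        hN.uniformContinuousOn_of_continuous (hp.continuousOn_inv.mono hρΩ)
      obtain ⟨δ, hδ, hδu⟩ := Metric.uniformContinuousOn_iff.1 huc (s / 2) (by linarith)
      filter_upwards [Metric.tendstoUniformlyOn_iff.1 (hf.tendstoUniformlyOn C hsub hC) (min δ ρ)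
        (lt_min hδ hρ)] with k hk x hx
      have hd := hk x hx
      have hyY : y x ∈ Y := ⟨hp.mapsTo (hsub hx), by rw [mem_preimage, hp.invOn.1 (hsub hx)]; exact hx⟩
      have hfN : f k x ∈ N := Metric.mem_cthickening_of_dist_le _ (y x) _ _ hyY
        (by rw [dist_comm]; exact (hd.trans_le (min_le_right _ _)).le)
      refine ⟨hfN, ?_⟩
      have := hδu (f k x) hfN (y x) (Metric.self_subset_cthickening _ hyY)
        (by rw [dist_comm]; exact hd.trans_le (min_le_left _ _))
      rwa [hp.invOn.1 (hsub hx)] at this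
    have hev : ∀ᶠ k in atTop,
        ∫ x in Metric.ball x₀ (2 * s), θ j (f k x) * (fderiv ℝ (f k) x).det = ∫ x, φ x := by
      filter_upwards [hk] with k hk
      rw [← setIntegral_comp_mul_det_of_near_id ((hg.contDiff j).comp (hf.contDiff k)) hs
        (fun x hx => ?_) hφ hφs]
      · refine setIntegral_congr_fun measurableSet_ball fun x hx => ?_
        obtain ⟨h1, h2⟩ := hk x (hballC hx)
        simp only [hθ, Function.comp_def, det_fderiv_comp (hf.contDiff k) (hg.contDiff j)]
        by_cases h0 : φ (g j (f k x)) = 0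
        · simp [h0]
        · have h3 := hφs _ h0
          have h4 := hj (f k x) h1
          have : f k x ∈ D := by
            refine ⟨hρΩ h1, ?_⟩
            have := dist_triangle (ξ (f k x)) (g j (f k x)) x₀
            simp only [mem_preimage, Metric.mem_closedBall]
            linarith
          rw [hηD _ this]
          ring
      · obtain ⟨h1, h2⟩ := hk x hx
        have h4 := hj (f k x) h1
        have := dist_triangle_left (g j (f k x)) x (ξ (f k x))
        simp only [Function.comp_apply]
        linarith
    have hl := hf.tendsto_setIntegral_comp hp.continuousOn hC hsub hballC (hθc j)
      (hasCompactSupport_of_forall_dist_le (hθs j))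
    rw [← hc (θ j) (hθc j) (hθs j)]
    have e : ∫ x in Ω₁, θ j (y x) * J x =
        ∫ x in Metric.ball x₀ (2 * s), θ j (y x) * J x := by
      refine setIntegral_eq_of_subset_of_forall_sdiff_eq_zero hp.isOpen_left.measurableSet
        (hballC.trans hsub) fun x hx => ?_
      have : θ j (y x) = 0 := by
        by_contra hne
        have h1 := (hθB j _ hne).2
        rw [mem_preimage, hp.invOn.1 hx.1] at h1
        exact hx.2 h1
      rw [this, zero_mul]
    rw [e]
    exact tendsto_nhds_unique hl (tendsto_const_nhds.congr' (hev.mono fun k hk => hk.symm))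
  have hφu : UniformContinuous φ :=
    (hasCompactSupport_of_forall_dist_le hφs).uniformContinuous_of_continuous hφ
  have hunif : TendstoUniformlyOn (fun j z => η z * φ (g j z)) (fun z => η z * φ (ξ z)) atTop Y := by
    have h1 := hφu.comp_tendstoUniformlyOn (hg.tendstoUniformlyOn Y hYΩ hY)
    rw [Metric.tendstoUniformlyOn_iff] at h1 ⊢
    intro ε hε
    filter_upwards [h1 ε hε] with j hj z hz
    have := hj z hz
    simp only [Function.comp_apply, Real.dist_eq] at this ⊢
    rw [← mul_sub, abs_mul, abs_of_nonneg (hηI z).1]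
    have h2 := (hηI z).2
    nlinarith [abs_nonneg (φ (ξ z) - φ (g j z)), (hηI z).1]
  have hlim := tendsto_setIntegral_mul_of_tendstoUniformlyOn hY Subset.rfl
    (Eventually.of_forall fun j =>
      (hηc.mul (hφ.comp (hg.contDiff j).continuous)).continuousOn)
    (hηc.continuousOn.mul (hφ.comp_continuousOn (hp.continuousOn_inv.mono hYΩ)))
    (fun j => continuous_det_fderiv (hg.contDiff j)) (hg.integrableOn Y hYΩ hY) hunif
    (hg.tendsto_integral Y hYΩ hY)
  have e1 : ∀ j, ∫ z in Y, η z * φ (g j z) * (fderiv ℝ (g j) z).det = ∫ z, θ j z := fun j =>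
    setIntegral_eq_integral_of_forall_compl_eq_zero fun z hz => by
      by_contra hne
      exact hz (hBY (hθB j z hne))
  have e2 : ∫ z in Ω₂, φ (ξ z) * J' z = ∫ z in Y, η z * φ (ξ z) * J' z := by
    have hDof : ∀ z ∈ Ω₂, φ (ξ z) ≠ 0 → z ∈ D := fun z hz hne =>
      ⟨hz, (hφs _ hne).trans (by linarith)⟩
    rw [setIntegral_eq_of_subset_of_forall_sdiff_eq_zero hp.isOpen_right.measurableSet hYΩ]
    · refine setIntegral_congr_fun hY.measurableSet fun z hz => ?_
      by_cases h0 : φ (ξ z) = 0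
      · simp [h0]
      · simp [hηD z (hDof z (hYΩ hz) h0)]
    · intro z hz
      have : φ (ξ z) = 0 := by
        by_contra hne
        exact hz.2 (hBY (hDB (hDof z hz.1 hne)))
      rw [this, zero_mul]
  rw [e2]
  refine tendsto_nhds_unique (hlim.const_mul c) (tendsto_const_nhds.congr' ?_)
  filter_upwards [hfix] with j hj
  exact hj.symm.trans (congrArg (c * ·) (e1 j).symm)

end Multiplicativity

/-! ### The area formula -/

section Area

variable {n : ℕ}

local notation "𝔼" => EuclideanSpace ℝ (Fin n)

/-- Multiply both measures by the weight `max 0 (r - dist z z₀)`. The weighted measures are finite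
and agree on all bounded continuous functions; dividing by the weight, which is positive on the open
ball, recovers the originals. -/
theorem restrict_ball_eq_of_forall_integral_eq {μ ν : Measure 𝔼} {z₀ : 𝔼} {r : ℝ}
    (hμ : μ (Metric.closedBall z₀ r) ≠ ⊤) (hν : ν (Metric.closedBall z₀ r) ≠ ⊤)
    (h : ∀ φ : 𝔼 → ℝ, Continuous φ → (∀ z, φ z ≠ 0 → dist z z₀ ≤ r) →
      ∫ z, φ z ∂μ = ∫ z, φ z ∂ν) :
    μ.restrict (Metric.ball z₀ r) = ν.restrict (Metric.ball z₀ r) := by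
  set θ : 𝔼 → ℝ := fun z => max 0 (r - dist z z₀) with hθ
  have hθc : Continuous θ := by fun_prop
  have hθ0 : ∀ z, 0 ≤ θ z := fun z => le_max_left _ _
  have hθs : ∀ z, θ z ≠ 0 → dist z z₀ ≤ r := fun z hz => by
    by_contra hn
    exact hz (max_eq_left (by linarith))
  set Θ : 𝔼 → ℝ≥0∞ := fun z => ENNReal.ofReal (θ z)
  have hΘm : Measurable Θ := hθc.measurable.ennreal_ofReal
  have hfin : ∀ ρ : Measure 𝔼, ρ (Metric.closedBall z₀ r) ≠ ⊤ →
      IsFiniteMeasure (ρ.withDensity Θ) := by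
    intro ρ hρ
    refine isFiniteMeasure_withDensity (ne_of_lt ?_)
    calc ∫⁻ z, Θ z ∂ρ ≤ ∫⁻ z, (Metric.closedBall z₀ r).indicator (fun _ => ENNReal.ofReal r) z ∂ρ := by
          refine lintegral_mono fun z => ?_
          by_cases hz : z ∈ Metric.closedBall z₀ r
          · rw [indicator_of_mem hz]
            refine ENNReal.ofReal_le_ofReal (max_le ?_ ?_)
            · exact dist_nonneg.trans hz
            · linarith [dist_nonneg (x := z) (y := z₀)]
          · rw [indicator_of_notMem hz]
            have : θ z = 0 := by
              by_contra hne
              exact hz (hθs z hne)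
            simp [Θ, this]
      _ = ENNReal.ofReal r * ρ (Metric.closedBall z₀ r) :=
          lintegral_indicator_const measurableSet_closedBall _
      _ < ⊤ := ENNReal.mul_lt_top ENNReal.ofReal_lt_top hρ.lt_top
  have := hfin μ hμ
  have := hfin ν hν
  have hint : ∀ ρ : Measure 𝔼, ∀ f : 𝔼 → ℝ,
      ∫ z, f z ∂(ρ.withDensity Θ) = ∫ z, θ z * f z ∂ρ := by
    intro ρ f
    rw [integral_withDensity_eq_integral_toReal_smul hΘm
      (Eventually.of_forall fun _ => ENNReal.ofReal_lt_top)]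
    simp [Θ, ENNReal.toReal_ofReal (hθ0 _)]
  have heq : μ.withDensity Θ = ν.withDensity Θ := by
    refine ext_of_forall_integral_eq_of_IsFiniteMeasure fun f => ?_
    rw [hint, hint]
    exact h _ (hθc.mul f.continuous) fun z hz => hθs z (left_ne_zero_of_mul hz)
  have hrec : ∀ ρ : Measure 𝔼, ∀ S : Set 𝔼, MeasurableSet S → S ⊆ Metric.ball z₀ r →
      ρ S = ∫⁻ z, S.indicator (fun z => (Θ z)⁻¹) z ∂(ρ.withDensity Θ) := by
    intro ρ S hS hSb
    have hgm : Measurable (S.indicator fun z => (Θ z)⁻¹) := hΘm.inv.indicator hS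
    rw [lintegral_withDensity_eq_lintegral_mul _ hΘm hgm,
      ← lintegral_indicator_one hS]
    refine lintegral_congr fun z => ?_
    by_cases hz : z ∈ S
    · have : 0 < θ z := lt_max_of_lt_right (by have := hSb hz; simp at this; linarith)
      simp only [indicator_of_mem hz, Pi.one_apply, Pi.mul_apply]
      exact (ENNReal.mul_inv_cancel (by simpa [Θ] using this) ENNReal.ofReal_ne_top).symm
    · simp [indicator_of_notMem hz]
  ext S hS
  rw [Measure.restrict_apply hS, Measure.restrict_apply hS,
    hrec μ _ (hS.inter measurableSet_ball) inter_subset_right,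
    hrec ν _ (hS.inter measurableSet_ball) inter_subset_right, heq]

/-- Scaling of ball volumes gives `a ^ n ≤ c * b ^ n`; let `a` increase to `b`. -/
theorem one_le_of_forall_volume_closedBall_le {z₀ : 𝔼} {r c : ℝ} (hr : 0 < r) (hc : 0 ≤ c)
    (h : ∀ a b, 0 < a → a < b → b < r → volume (Metric.closedBall z₀ a) ≤
      ENNReal.ofReal c * volume (Metric.closedBall z₀ b)) : 1 ≤ c := by
  set b := r / 2
  have hb : 0 < b := by positivity
  have hle : ∀ a ∈ Ioo 0 b, a ^ n ≤ c * b ^ n := by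
    intro a ha
    have h1 := h a b ha.1 ha.2 (by simp only [b]; linarith)
    rw [Measure.addHaar_closedBall _ _ ha.1.le, Measure.addHaar_closedBall _ _ hb.le,
      ← mul_assoc, ← ENNReal.ofReal_mul hc, finrank_euclideanSpace_fin,
      ENNReal.mul_le_mul_iff_left (Metric.measure_ball_pos _ _ one_pos).ne' measure_ball_lt_top.ne,
      ENNReal.ofReal_le_ofReal_iff (by positivity)] at h1
    exact h1
  have hlim : Tendsto (fun a : ℝ => a ^ n) (𝓝[<] b) (𝓝 (b ^ n)) :=
    ((continuous_pow n).tendsto b).mono_left nhdsWithin_le_nhds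
  have h2 : b ^ n ≤ c * b ^ n :=
    le_of_tendsto hlim (by filter_upwards [Ioo_mem_nhdsLT hb] with a ha using hle a ha)
  have : 0 < b ^ n := by positivity
  nlinarith

/-- The push-forward of `J dx` under `y`. -/
noncomputable def jacobianPush (Ω : Set (EuclideanSpace ℝ (Fin n)))
    (y : EuclideanSpace ℝ (Fin n) → EuclideanSpace ℝ (Fin n))
    (J : EuclideanSpace ℝ (Fin n) → ℝ) : Measure (EuclideanSpace ℝ (Fin n)) :=
  ((volume.restrict Ω).withDensity fun x => ENNReal.ofReal (J x)).map y

variable {Ω₁ Ω₂ : Set (EuclideanSpace ℝ (Fin n))}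
  {y ξ : EuclideanSpace ℝ (Fin n) → EuclideanSpace ℝ (Fin n)}
  {J J' : EuclideanSpace ℝ (Fin n) → ℝ}
  {f g : ℕ → EuclideanSpace ℝ (Fin n) → EuclideanSpace ℝ (Fin n)}

theorem jacobianPush_apply (hy : Measurable y) {S : Set 𝔼} (hS : MeasurableSet S) :
    jacobianPush Ω₁ y J S = ∫⁻ x in Ω₁ ∩ y ⁻¹' S, ENNReal.ofReal (J x) := by
  rw [jacobianPush, Measure.map_apply hy hS, withDensity_apply _ (hy hS),
    Measure.restrict_restrict (hy hS), inter_comm]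

theorem integral_jacobianPush (hy : Measurable y) (hJ : AEMeasurable J (volume.restrict Ω₁))
    (hpos : ∀ᵐ x ∂volume.restrict Ω₁, 0 ≤ J x) {φ : 𝔼 → ℝ}
    (hφ : AEStronglyMeasurable φ (jacobianPush Ω₁ y J)) :
    ∫ z, φ z ∂(jacobianPush Ω₁ y J) = ∫ x in Ω₁, φ (y x) * J x := by
  rw [jacobianPush] at hφ ⊢
  rw [integral_map hy.aemeasurable hφ, integral_withDensity_eq_integral_toReal_smul₀
    hJ.ennreal_ofReal (Eventually.of_forall fun _ => ENNReal.ofReal_lt_top)]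
  refine integral_congr_ae ?_
  filter_upwards [hpos] with x hx
  simp [ENNReal.toReal_ofReal hx, mul_comm]

theorem setLIntegral_jacobianPush (hy : Measurable y)
    (hJ : AEMeasurable J (volume.restrict Ω₁)) {S : Set 𝔼} (hS : MeasurableSet S)
    {F : 𝔼 → ℝ≥0∞} (hF : AEMeasurable F ((jacobianPush Ω₁ y J).restrict S)) :
    ∫⁻ z in S, F z ∂(jacobianPush Ω₁ y J) =
      ∫⁻ x in Ω₁ ∩ y ⁻¹' S, ENNReal.ofReal (J x) * F (y x) := by
  have e : (jacobianPush Ω₁ y J).restrict S =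
      ((volume.restrict (Ω₁ ∩ y ⁻¹' S)).withDensity fun x => ENNReal.ofReal (J x)).map y := by
    rw [jacobianPush, Measure.restrict_map hy hS, restrict_withDensity (hy hS),
      Measure.restrict_restrict (hy hS), inter_comm]
  have hJ' : AEMeasurable (fun x => ENNReal.ofReal (J x)) (volume.restrict (Ω₁ ∩ y ⁻¹' S)) :=
    (hJ.mono_set inter_subset_left).ennreal_ofReal
  rw [e] at hF ⊢
  rw [lintegral_map' hF hy.aemeasurable]
  exact lintegral_withDensity_eq_lintegral_mul₀' hJ' (hF.comp_measurable hy)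

theorem JacobianApprox.restrict_jacobianPush_ball (hp : IsHomeoPair Ω₁ Ω₂ y ξ)
    (hf : JacobianApprox Ω₁ y J f) (hy : Measurable y)
    (hJm : AEMeasurable J (volume.restrict Ω₁)) (hpos : ∀ᵐ x ∂volume.restrict Ω₁, 0 < J x)
    {z₀ : 𝔼} {r c : ℝ} (hball : Metric.closedBall z₀ r ⊆ Ω₂) (hc0 : 0 ≤ c)
    (hc : ∀ φ : 𝔼 → ℝ, Continuous φ → (∀ z, φ z ≠ 0 → dist z z₀ ≤ r) →
        ∫ x in Ω₁, φ (y x) * J x = c * ∫ z, φ z) :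
    (jacobianPush Ω₁ y J).restrict (Metric.ball z₀ r) =
      (ENNReal.ofReal c • volume).restrict (Metric.ball z₀ r) := by
  refine restrict_ball_eq_of_forall_integral_eq ?_ ?_ fun φ hφ hs => ?_
  · rw [jacobianPush_apply hy measurableSet_closedBall]
    exact (hf.integrableOn _ inter_subset_left
      (hp.isCompact_preimage (isCompact_closedBall _ _) hball)).lintegral_lt_top.ne
  · exact ENNReal.mul_ne_top ENNReal.ofReal_ne_top
      (measure_closedBall_lt_top (μ := volume)).ne
  · rw [integral_jacobianPush hy hJm (hpos.mono fun x hx => hx.le)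
      hφ.aestronglyMeasurable, hc φ hφ hs, integral_smul_measure, ENNReal.toReal_ofReal hc0,
      smul_eq_mul]

/-- Local form of the area formula: the local degree of an orientation preserving homeomorphism
is one. -/
theorem JacobianApprox.exists_restrict_jacobianPush_eq (hp : IsHomeoPair Ω₁ Ω₂ y ξ)
    (hf : JacobianApprox Ω₁ y J f) (hg : JacobianApprox Ω₂ ξ J' g) (hy : Measurable y)
    (hJm : AEMeasurable J (volume.restrict Ω₁)) (hJm' : AEMeasurable J' (volume.restrict Ω₂))
    (hpos : ∀ᵐ x ∂volume.restrict Ω₁, 0 < J x) {z₀ : 𝔼} (hz₀ : z₀ ∈ Ω₂) :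
    ∃ r > 0, Metric.ball z₀ r ⊆ Ω₂ ∧
      (jacobianPush Ω₁ y J).restrict (Metric.ball z₀ r) = volume.restrict (Metric.ball z₀ r) := by
  have hΩ₁ := hp.isOpen_left.measurableSet
  have hΩ₂ := hp.isOpen_right.measurableSet
  obtain ⟨r₀, hr₀, hr₀s⟩ := Metric.nhds_basis_closedBall.mem_iff.1 (hp.isOpen_right.mem_nhds hz₀)
  set r := r₀ / 5
  have hr : 0 < r := by positivity
  have h5r : Metric.closedBall z₀ (5 * r) ⊆ Ω₂ := by
    rwa [show 5 * r = r₀ by simp only [r]; ring]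
  have hrΩ : Metric.closedBall z₀ r ⊆ Ω₂ :=
    (Metric.closedBall_subset_closedBall (by linarith)).trans h5r
  obtain ⟨c, hc, hcov⟩ := hf.exists_degree hp hr h5r
  set x₀ := ξ z₀
  have hW : IsOpen (Ω₁ ∩ y ⁻¹' Metric.ball z₀ r) := hp.isOpen_preimage Metric.isOpen_ball
  have hx₀W : x₀ ∈ Ω₁ ∩ y ⁻¹' Metric.ball z₀ r :=
    ⟨hp.mapsTo_inv hz₀, by rw [mem_preimage, hp.invOn.2 hz₀]; exact Metric.mem_ball_self hr⟩
  obtain ⟨s₀, hs₀, hs₀s⟩ := Metric.nhds_basis_closedBall.mem_iff.1 (hW.mem_nhds hx₀W)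
  set s := s₀ / 5
  have hs : 0 < s := by positivity
  have h5s : Metric.closedBall x₀ (5 * s) ⊆ Ω₁ ∩ y ⁻¹' Metric.ball z₀ r := by
    rwa [show 5 * s = s₀ by simp only [s]; ring]
  have h3s : Metric.closedBall x₀ (3 * s) ⊆ Ω₁ ∩ y ⁻¹' Metric.ball z₀ r :=
    (Metric.closedBall_subset_closedBall (by linarith)).trans h5s
  have h5Ω : Metric.closedBall x₀ (5 * s) ⊆ Ω₁ := fun x hx => (h5s hx).1
  have h3Ω : Metric.closedBall x₀ (3 * s) ⊆ Ω₁ := fun x hx => (h3s hx).1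
  have h3r : ∀ x ∈ Metric.closedBall x₀ (3 * s), dist (y x) z₀ ≤ r := fun x hx =>
    le_of_lt (h3s hx).2
  have h1s : Metric.closedBall x₀ s ⊆ Ω₁ ∩ y ⁻¹' Metric.ball z₀ r :=
    (Metric.closedBall_subset_closedBall (by linarith)).trans h5s
  obtain ⟨c', hc', hcov'⟩ := hg.exists_degree hp.symm hs h5Ω
  have hmul : ∀ φ : 𝔼 → ℝ, Continuous φ → (∀ x, φ x ≠ 0 → dist x x₀ ≤ s) →
      c * ∫ z in Ω₂, φ (ξ z) * J' z = ∫ x, φ x := fun φ hφ hφs =>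
    hf.degree_mul hp hg hs h3Ω h3r hc hφ hφs
  have hcc : c * c' = 1 := by
    obtain ⟨φ, hφ, -, hφs, hφp⟩ := exists_continuous_supported_integral_pos x₀ hs
    have h1 := hmul φ hφ fun x hx => (hφs x hx).le
    rw [hc' φ hφ fun x hx => (hφs x hx).le, ← mul_assoc] at h1
    exact mul_right_cancel₀ hφp.ne' (h1.trans (one_mul _).symm)
  have hc0 : 0 < c := by
    have hne : c ≠ 0 := left_ne_zero_of_mul (hcc.trans_ne one_ne_zero)
    suffices h : 0 ≤ c from h.lt_of_ne hne.symm
    obtain ⟨φ, hφ, hφ0, hφs, hφp⟩ := exists_continuous_supported_integral_pos z₀ hr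
    have h1 := hc φ hφ fun x hx => (hφs x hx).le
    have h2 : 0 ≤ ∫ x in Ω₁, φ (y x) * J x := integral_nonneg_of_ae <| by
      filter_upwards [hpos] with x hx using mul_nonneg (hφ0 _) hx.le
    rw [h1] at h2
    exact nonneg_of_mul_nonneg_left h2 hφp
  have hc0' : 0 < c' := (pos_iff_pos_of_mul_pos (by rw [hcc]; exact one_pos)).1 hc0
  have hν := hf.restrict_jacobianPush_ball hp hy hJm hpos hrΩ hc0.le hc
  have hνT : ∀ T ⊆ Metric.ball z₀ r, (jacobianPush Ω₁ y J).restrict T =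
      ENNReal.ofReal c • volume.restrict T := by
    intro T hTb
    rw [← Measure.restrict_smul, ← Measure.restrict_restrict_of_subset hTb, hν,
      Measure.restrict_restrict_of_subset hTb]
  -- the volume of small balls around `z₀`
  have hc1 : 1 ≤ c := by
    refine one_le_of_forall_volume_closedBall_le (z₀ := z₀) hr hc0.le fun a b _ hab hbr => ?_
    refine (hcov hc0.ne' a b hab hbr.le).trans_eq ?_
    have e := congrArg (fun ρ : Measure 𝔼 => ρ univ)
      (hνT _ (Metric.closedBall_subset_ball hbr))
    simp only [Measure.restrict_apply_univ, Measure.smul_apply, smul_eq_mul] at e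
    rw [← e, jacobianPush_apply hy measurableSet_closedBall]
    refine lintegral_congr_ae ?_
    filter_upwards [ae_restrict_of_ae_restrict_of_subset inter_subset_left hpos] with x hx
    rw [abs_of_pos hx]
  -- the chain rule for the Jacobians
  set W := Ω₂ ∩ ξ ⁻¹' Metric.closedBall x₀ s
  have hWc : IsCompact W :=
    hp.symm.isCompact_preimage (isCompact_closedBall _ _) (h1s.trans inter_subset_left)
  have hWb : W ⊆ Metric.ball z₀ r := fun z hz => by
    have := (h1s hz.2).2
    rwa [mem_preimage, hp.invOn.2 hz.1] at this
  have hpre : ∀ T ⊆ Metric.closedBall x₀ s, Ω₁ ∩ y ⁻¹' (Ω₂ ∩ ξ ⁻¹' T) = T := by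
    intro T hT
    rw [← hp.image_eq ((hT.trans h1s).trans inter_subset_left)]
    ext x
    constructor
    · rintro ⟨hx, w, hw, hwx⟩
      rwa [← hp.invOn.1.injOn ((h1s (hT hw)).1) hx hwx]
    · intro hx
      exact ⟨(h1s (hT hx)).1, x, hx, rfl⟩
  have hJW' : AEStronglyMeasurable J' ((jacobianPush Ω₁ y J).restrict W) := by
    rw [hνT W hWb]
    exact ((hJm'.mono_set inter_subset_left).aestronglyMeasurable).smul_measure _
  have hlint : ∀ T ⊆ Metric.closedBall x₀ s, IsCompact T →
      ∫⁻ x in T, ENNReal.ofReal (J x) * ENNReal.ofReal |J' (y x)| =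
      ENNReal.ofReal c * ∫⁻ z in Ω₂ ∩ ξ ⁻¹' T, ENNReal.ofReal |J' z| := by
    intro T hT hTc
    have hsub : Ω₂ ∩ ξ ⁻¹' T ⊆ W := inter_subset_inter_right _ (preimage_mono hT)
    have hm : MeasurableSet (Ω₂ ∩ ξ ⁻¹' T) :=
      (hp.symm.isCompact_preimage hTc ((hT.trans h1s).trans inter_subset_left)).measurableSet
    have h1 := setLIntegral_jacobianPush hy hJm hm (F := fun z => ENNReal.ofReal |J' z|)
      ((hJW'.mono_measure (Measure.restrict_mono_set _ hsub)).aemeasurable.abs.ennreal_ofReal)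
    rw [hνT _ (hsub.trans hWb), lintegral_smul_measure, hpre T hT] at h1
    exact h1.symm
  have hchain : ∀ᵐ x ∂volume, x ∈ Metric.ball x₀ s → J' (y x) * J x - 1 = 0 := by
    have hBs : Metric.ball x₀ s ⊆ Metric.closedBall x₀ s := Metric.ball_subset_closedBall
    have hmeas : AEStronglyMeasurable (fun x => J' (y x) * J x)
        (volume.restrict (Metric.closedBall x₀ s)) := by
      -- Since `J > 0` almost everywhere, Lebesgue null sets are the null sets of `J dx`; this
      -- transfers measurability of `J'` for the push-forward to measurability of `J' ∘ y`.
      have hres : (volume.restrict (Metric.closedBall x₀ s)) ≪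
          (volume.restrict (Metric.closedBall x₀ s)).withDensity fun x => ENNReal.ofReal (J x) := by
        refine withDensity_absolutelyContinuous'
          (hJm.mono_set (h1s.trans inter_subset_left)).ennreal_ofReal ?_
        filter_upwards [ae_restrict_of_ae_restrict_of_subset (h1s.trans inter_subset_left) hpos]
          with x hx
        simpa using hx
      have hmap : ((volume.restrict (Metric.closedBall x₀ s)).withDensity
          fun x => ENNReal.ofReal (J x)).map y = (jacobianPush Ω₁ y J).restrict W := by
        rw [jacobianPush, Measure.restrict_map hy hWc.measurableSet,
          restrict_withDensity (hy hWc.measurableSet),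
          Measure.restrict_restrict (hy hWc.measurableSet), inter_comm, hpre _ Subset.rfl]
      rw [← hmap] at hJW'
      exact ((hJW'.comp_measurable hy).mono_ac hres).mul
        (hJm.mono_set (h1s.trans inter_subset_left)).aestronglyMeasurable
    have hint : IntegrableOn (fun x => J' (y x) * J x) (Metric.closedBall x₀ s) := by
      refine ⟨hmeas, ?_⟩
      rw [hasFiniteIntegral_iff_norm]
      calc ∫⁻ x in Metric.closedBall x₀ s, ENNReal.ofReal ‖J' (y x) * J x‖
          = ∫⁻ x in Metric.closedBall x₀ s, ENNReal.ofReal (J x) * ENNReal.ofReal |J' (y x)| := by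
            refine lintegral_congr_ae ?_
            filter_upwards [ae_restrict_of_ae_restrict_of_subset
              (h1s.trans inter_subset_left) hpos] with x hx
            rw [← ENNReal.ofReal_mul hx.le, Real.norm_eq_abs, abs_mul, abs_of_pos hx, mul_comm]
        _ = ENNReal.ofReal c * ∫⁻ z in W, ENNReal.ofReal |J' z| :=
            hlint _ Subset.rfl (isCompact_closedBall _ _)
        _ < ⊤ := ENNReal.mul_lt_top ENNReal.ofReal_lt_top
            (hg.integrableOn W inter_subset_left hWc).abs.lintegral_lt_top
    -- Multiplicativity of the degree, pulled back by `y`, says that `J'(y) J` and `1` have the same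
    -- integral against every test function.
    refine IsOpen.ae_eq_zero_of_integral_contDiff_smul_eq_zero
      (f := fun x => J' (y x) * J x - 1) Metric.isOpen_ball ?_ ?_
    · exact ((hint.mono_set hBs).sub (integrableOn_const measure_ball_lt_top.ne)).locallyIntegrableOn
    · intro φ hφ hφc hφs
      have hφ1 : ∀ x, φ x ≠ 0 → x ∈ Metric.ball x₀ s := fun x hx =>
        hφs (subset_tsupport φ hx)
      have hφ2 : ∀ x, φ x ≠ 0 → dist x x₀ ≤ s := fun x hx => (Metric.mem_ball.1 (hφ1 x hx)).le
      have h1 := hmul φ hφ.continuous hφ2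
      have h2 : ∫ z in Ω₂, φ (ξ z) * J' z = ∫ z in W, φ (ξ z) * J' z := by
        refine setIntegral_eq_of_subset_of_forall_sdiff_eq_zero hΩ₂ inter_subset_left
          fun z hz => ?_
        have : φ (ξ z) = 0 := by
          by_contra hne
          exact hz.2 ⟨hz.1, hφ2 _ hne⟩
        rw [this, zero_mul]
      have h3 : c * ∫ z in W, φ (ξ z) * J' z =
          ∫ z, W.indicator (fun z => φ (ξ z) * J' z) z ∂(jacobianPush Ω₁ y J) := by
        rw [integral_indicator hWc.measurableSet, hνT W hWb, integral_smul_measure,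
          ENNReal.toReal_ofReal hc0.le, smul_eq_mul]
      have h4 : AEStronglyMeasurable (W.indicator fun z => φ (ξ z) * J' z)
          (jacobianPush Ω₁ y J) := by
        rw [aestronglyMeasurable_indicator_iff hWc.measurableSet]
        have h5 : ContinuousOn (fun z => φ (ξ z)) W :=
          hφ.continuous.comp_continuousOn (hp.continuousOn_inv.mono inter_subset_left)
        exact (h5.aestronglyMeasurable hWc.measurableSet).mul hJW'
      rw [h2, h3, integral_jacobianPush hy hJm (hpos.mono fun x hx => hx.le) h4] at h1
      have h5 : ∫ x in Ω₁, W.indicator (fun z => φ (ξ z) * J' z) (y x) * J x =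
          ∫ x in Metric.closedBall x₀ s, φ x * (J' (y x) * J x) := by
        rw [setIntegral_eq_of_subset_of_forall_sdiff_eq_zero hΩ₁ (h1s.trans inter_subset_left)]
        · refine setIntegral_congr_fun measurableSet_closedBall fun x hx => ?_
          have hxW : y x ∈ W := ((hpre _ Subset.rfl).symm ▸ hx :
            x ∈ Ω₁ ∩ y ⁻¹' (Ω₂ ∩ ξ ⁻¹' Metric.closedBall x₀ s)).2
          simp only [indicator_of_mem hxW, hp.invOn.1 (h1s hx).1]
          ring
        · intro x hx
          have hxW : y x ∉ W := fun h => hx.2 (by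
            have := (hpre _ Subset.rfl).subset ⟨hx.1, h⟩
            exact this)
          rw [indicator_of_notMem hxW, zero_mul]
      rw [h5, ← setIntegral_eq_integral_of_forall_compl_eq_zero
        (s := Metric.closedBall x₀ s) (f := φ)] at h1
      · rw [← setIntegral_eq_integral_of_forall_compl_eq_zero (s := Metric.closedBall x₀ s)]
        · have i1 : IntegrableOn (fun x => φ x * (J' (y x) * J x)) (Metric.closedBall x₀ s) :=
            hint.continuousOn_mul hφ.continuous.continuousOn (isCompact_closedBall _ _)
          have i2 : IntegrableOn φ (Metric.closedBall x₀ s) :=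
            hφ.continuous.continuousOn.integrableOn_compact (isCompact_closedBall _ _)
          simp only [smul_eq_mul, mul_sub, mul_one]
          rw [integral_sub i1 i2, h1, sub_self]
        · intro x hx
          have : φ x = 0 := by
            by_contra hne
            exact hx (hφ2 x hne)
          rw [this, zero_smul]
      · intro x hx
        by_contra hne
        exact hx (hφ2 x hne)
  -- By the chain rule the integral of `|J'|` over the preimage of a small ball is `1/c = c'` times
  -- the volume of the ball, so the covering argument applies to the inverse although `J'` has no
  -- prescribed sign.
  have hc1' : 1 ≤ c' := by
    refine one_le_of_forall_volume_closedBall_le (z₀ := x₀) hs hc0'.le fun a b _ hab hbs => ?_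
    refine (hcov' hc0'.ne' a b hab hbs.le).trans_eq ?_
    have h1 := hlint _ (Metric.closedBall_subset_closedBall hbs.le) (isCompact_closedBall x₀ b)
    have h2 : ∫⁻ x in Metric.closedBall x₀ b, ENNReal.ofReal (J x) * ENNReal.ofReal |J' (y x)| =
        volume (Metric.closedBall x₀ b) := by
      rw [← setLIntegral_one]
      refine lintegral_congr_ae ?_
      have hbsub : Metric.closedBall x₀ b ⊆ Metric.ball x₀ s := Metric.closedBall_subset_ball hbs
      filter_upwards [ae_restrict_of_ae_restrict_of_subset
        ((hbsub.trans Metric.ball_subset_closedBall).trans (h1s.trans inter_subset_left)) hpos,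
        ae_restrict_of_ae hchain, ae_restrict_mem measurableSet_closedBall] with x hx hx1 hx2
      have h3 : J x * |J' (y x)| = 1 := by
        calc J x * |J' (y x)| = |J' (y x) * J x| := by rw [abs_mul, abs_of_pos hx, mul_comm]
          _ = 1 := by rw [sub_eq_zero.1 (hx1 (hbsub hx2)), abs_one]
      rw [← ENNReal.ofReal_mul hx.le, h3, ENNReal.ofReal_one]
    rw [← h2, h1, ← mul_assoc, ← ENNReal.ofReal_mul hc0'.le, mul_comm c', hcc]
    simp
  have hc_eq : c = 1 := le_antisymm ((le_mul_of_one_le_right hc0.le hc1').trans_eq hcc) hc1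
  refine ⟨r, hr, Metric.ball_subset_closedBall.trans hrΩ, ?_⟩
  rw [hν, hc_eq]
  simp

end Area

/-! ### Globalising the area formula -/

section AreaFormula

variable {n : ℕ}

local notation "𝔼" => EuclideanSpace ℝ (Fin n)

variable {Ω₁ Ω₂ : Set (EuclideanSpace ℝ (Fin n))}
  {y y' ξ : EuclideanSpace ℝ (Fin n) → EuclideanSpace ℝ (Fin n)}
  {J J' : EuclideanSpace ℝ (Fin n) → ℝ}
  {f g : ℕ → EuclideanSpace ℝ (Fin n) → EuclideanSpace ℝ (Fin n)}

theorem IsHomeoPair.congr (hp : IsHomeoPair Ω₁ Ω₂ y ξ) (h : EqOn y y' Ω₁) :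
    IsHomeoPair Ω₁ Ω₂ y' ξ where
  isOpen_left := hp.isOpen_left
  isOpen_right := hp.isOpen_right
  mapsTo := hp.mapsTo.congr h
  mapsTo_inv := hp.mapsTo_inv
  invOn := ⟨fun x hx => by rw [← h hx]; exact hp.invOn.1 hx,
    fun z hz => by rw [← h (hp.mapsTo_inv hz)]; exact hp.invOn.2 hz⟩
  continuousOn := hp.continuousOn.congr h.symm
  continuousOn_inv := hp.continuousOn_inv

theorem JacobianApprox.congr (hf : JacobianApprox Ω₁ y J f) (h : EqOn y y' Ω₁) :
    JacobianApprox Ω₁ y' J f where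
  contDiff := hf.contDiff
  tendstoUniformlyOn C hC hCc := (hf.tendstoUniformlyOn C hC hCc).congr_right (h.mono hC)
  integrableOn := hf.integrableOn
  tendsto_integral := hf.tendsto_integral

/-- The area formula for orientation preserving homeomorphisms whose Jacobian, and whose inverse's
Jacobian, are strong limits of Jacobians of smooth maps. -/
theorem JacobianApprox.setLIntegral_eq_volume (hp : IsHomeoPair Ω₁ Ω₂ y ξ)
    (hf : JacobianApprox Ω₁ y J f) (hg : JacobianApprox Ω₂ ξ J' g)
    (hJm : AEMeasurable J (volume.restrict Ω₁)) (hJm' : AEMeasurable J' (volume.restrict Ω₂))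
    (hpos : ∀ᵐ x ∂volume.restrict Ω₁, 0 < J x) {S : Set 𝔼} (hS : MeasurableSet S)
    (hSΩ : S ⊆ Ω₂) :
    ∫⁻ x in Ω₁ ∩ y ⁻¹' S, ENNReal.ofReal (J x) = volume S := by
  classical
  -- Outside `Ω₁` the map `y` is arbitrary; redefining it there makes it Borel, as the push-forward
  -- argument requires.
  set y₁ : 𝔼 → 𝔼 := Ω₁.piecewise y fun _ => 0
  have hy₁ : EqOn y y₁ Ω₁ := fun x hx => (piecewise_eq_of_mem _ _ _ hx).symm
  have hym : Measurable y₁ :=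
    hp.continuousOn.measurable_piecewise continuousOn_const hp.isOpen_left.measurableSet
  have hloc : ∀ z ∈ Ω₂, ∃ r > 0, Metric.ball z r ⊆ Ω₂ ∧
      (jacobianPush Ω₁ y₁ J).restrict (Metric.ball z r) = volume.restrict (Metric.ball z r) :=
    fun z hz => (hf.congr hy₁).exists_restrict_jacobianPush_eq (hp.congr hy₁) hg hym hJm hJm'
      hpos hz
  choose! r hr hrΩ hreq using hloc
  -- Lindelöf: countably many of the local balls cover `Ω₂`, and measures agreeing on each agree on
  -- the union.
  obtain ⟨t, ht, htc, hcov⟩ := TopologicalSpace.countable_cover_nhdsWithin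
    (f := fun z => Metric.ball z (r z)) (s := Ω₂)
    fun z hz => mem_nhdsWithin_of_mem_nhds (Metric.ball_mem_nhds z (hr z hz))
  have hres : (jacobianPush Ω₁ y₁ J).restrict (⋃ z ∈ t, Metric.ball z (r z)) =
      volume.restrict (⋃ z ∈ t, Metric.ball z (r z)) :=
    (Measure.restrict_biUnion_congr htc).2 fun z hz => hreq z (ht hz)
  have hSU := hSΩ.trans hcov
  have e := congrArg (fun ρ : Measure 𝔼 => ρ S) hres
  simp only [Measure.restrict_apply hS, inter_eq_self_of_subset_left hSU] at e
  rw [← e, jacobianPush_apply hym hS]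
  congr 2
  ext x
  constructor
  · rintro ⟨hx, hxS⟩
    exact ⟨hx, by rw [mem_preimage, ← hy₁ hx]; exact hxS⟩
  · rintro ⟨hx, hxS⟩
    exact ⟨hx, by rw [mem_preimage, hy₁ hx]; exact hxS⟩

end AreaFormula

/-! ### Mollification of Sobolev maps -/

section Mollify

variable {n : ℕ}

local notation "𝔼" => EuclideanSpace ℝ (Fin n)

/-- A sequence of bump functions shrinking to the origin. -/
noncomputable def shrinkingBump (n : ℕ) (k : ℕ) : ContDiffBump (0 : EuclideanSpace ℝ (Fin n)) where
  rIn := 1 / (2 * ((k : ℝ) + 1))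
  rOut := 1 / ((k : ℝ) + 1)
  rIn_pos := by positivity
  rIn_lt_rOut := one_div_lt_one_div_of_lt (by positivity) (by linarith [k.cast_nonneg (α := ℝ)])

/-- The normalized mollifiers. -/
noncomputable def mollifier (n : ℕ) (k : ℕ) : EuclideanSpace ℝ (Fin n) → ℝ :=
  (shrinkingBump n k).normed volume

/-- Mollification of a function. -/
noncomputable def mollify {F : Type*} [NormedAddCommGroup F] [NormedSpace ℝ F] (k : ℕ)
    (u : EuclideanSpace ℝ (Fin n) → F) : EuclideanSpace ℝ (Fin n) → F :=
  convolution (mollifier n k) u (ContinuousLinearMap.lsmul ℝ ℝ) volume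

variable {F : Type*} [NormedAddCommGroup F] [NormedSpace ℝ F]

theorem mollifier_nonneg (k : ℕ) (x : 𝔼) : 0 ≤ mollifier n k x :=
  (shrinkingBump n k).nonneg_normed x

theorem mollifier_contDiff (k : ℕ) : ContDiff ℝ ∞ (mollifier n k) :=
  (shrinkingBump n k).contDiff_normed

theorem mollifier_hasCompactSupport (k : ℕ) : HasCompactSupport (mollifier n k) :=
  (shrinkingBump n k).hasCompactSupport_normed

theorem integral_mollifier (k : ℕ) : ∫ x, mollifier n k x = 1 :=
  (shrinkingBump n k).integral_normed

theorem integrable_mollifier (k : ℕ) : Integrable (mollifier n k) :=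
  (shrinkingBump n k).integrable_normed

theorem tsupport_mollifier (k : ℕ) :
    tsupport (mollifier n k) = Metric.closedBall 0 (1 / ((k : ℝ) + 1)) :=
  (shrinkingBump n k).tsupport_normed_eq

theorem mollify_apply (k : ℕ) (u : 𝔼 → F) (x : 𝔼) :
    mollify k u x = ∫ t, mollifier n k (x - t) • u t :=
  convolution_lsmul_swap

theorem integrable_mollifier_smul {u : 𝔼 → F} (hu : LocallyIntegrable u) (k : ℕ) (x : 𝔼) :
    Integrable fun t => mollifier n k (x - t) • u t :=
  ((mollifier_hasCompactSupport k).convolutionExists_left (ContinuousLinearMap.lsmul ℝ ℝ)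
    (mollifier_contDiff k).continuous hu x).integrable_swap

theorem integral_mollifier_sub (k : ℕ) (x : 𝔼) : ∫ t, mollifier n k (x - t) = 1 := by
  rw [integral_sub_left_eq_self (mollifier n k) volume x, integral_mollifier]

theorem mollify_contDiff {u : 𝔼 → F} (hu : LocallyIntegrable u) (k : ℕ) :
    ContDiff ℝ 1 (mollify k u) :=
  (mollifier_hasCompactSupport k).contDiff_convolution_left (n := 1) _
    ((mollifier_contDiff k).of_le (by exact_mod_cast le_top)) hu

theorem tendsto_one_div_add_one : Tendsto (fun k : ℕ => 1 / ((k : ℝ) + 1)) atTop (𝓝 0) :=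
  tendsto_one_div_add_atTop_nhds_zero_nat

theorem ae_tendsto_mollify [CompleteSpace F] {u : 𝔼 → F} (hu : LocallyIntegrable u) :
    ∀ᵐ x, Tendsto (fun k => mollify k u x) atTop (𝓝 (u x)) := by
  refine ContDiffBump.ae_convolution_tendsto_right_of_locallyIntegrable (K := 2)
    (φ := shrinkingBump n) tendsto_one_div_add_one (Eventually.of_forall fun k => ?_) hu
  simp only [shrinkingBump]
  apply le_of_eq
  field_simp

/-- Jensen's inequality for the probability density `mollifier n k (x - ·)`, by integrating the
tangent line of `a ^ p` at the mean `m`. -/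
theorem mollify_pow_le {u : 𝔼 → ℝ} (hu : LocallyIntegrable u) {p : ℕ} (hp : p ≠ 0)
    (hup : LocallyIntegrable fun x => |u x| ^ p) (k : ℕ) (x : 𝔼) :
    |mollify k u x| ^ p ≤ mollify k (fun x => |u x| ^ p) x := by
  have hi0 : Integrable fun t => mollifier n k (x - t) := by
    have := (integrable_mollifier (n := n) k).comp_sub_left x
    exact this
  have hi1 : Integrable fun t => mollifier n k (x - t) * |u t| := by
    have := (integrable_mollifier_smul hu k x).abs
    refine this.congr (Eventually.of_forall fun t => ?_)
    simp [abs_mul, abs_of_nonneg (mollifier_nonneg k _)]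
  have hi2 : Integrable fun t => mollifier n k (x - t) * |u t| ^ p := by
    simpa using integrable_mollifier_smul hup k x
  set m := ∫ t, mollifier n k (x - t) * |u t|
  have hm : 0 ≤ m := integral_nonneg fun t => mul_nonneg (mollifier_nonneg k _) (abs_nonneg _)
  have h1 : |mollify k u x| ≤ m := by
    rw [mollify_apply]
    refine abs_integral_le_integral_abs.trans (le_of_eq ?_)
    refine integral_congr_ae (Eventually.of_forall fun t => ?_)
    simp [abs_mul, abs_of_nonneg (mollifier_nonneg k _)]
  -- For `m > 0` this is Bernoulli's inequality for `a / m`.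
  have h2 : ∀ a : ℝ, 0 ≤ a → m ^ p + p * m ^ (p - 1) * (a - m) ≤ a ^ p := by
    intro a ha
    rcases hm.eq_or_lt with h | h
    · rw [← h]
      rcases Nat.lt_or_ge 1 p with hp1 | hp1
      · have : p - 1 ≠ 0 := by omega
        simp [hp, this, pow_nonneg ha]
      · have : p = 1 := by omega
        simp [this]
    · have hb := one_add_mul_sub_le_pow (a := a / m) (by have : 0 ≤ a / m := by positivity
                                                         linarith) p
      rw [div_pow, le_div_iff₀ (by positivity)] at hb
      refine le_trans (le_of_eq ?_) hb
      obtain ⟨q, rfl⟩ : ∃ q, p = q + 1 := ⟨p - 1, by omega⟩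
      simp only [Nat.add_sub_cancel, pow_succ]
      field_simp
  refine (pow_le_pow_left₀ (abs_nonneg _) h1 p).trans ?_
  rw [mollify_apply]
  simp only [smul_eq_mul]
  have h3 : ∫ t, (mollifier n k (x - t) * (m ^ p - p * m ^ (p - 1) * m) +
      p * m ^ (p - 1) * (mollifier n k (x - t) * |u t|)) = m ^ p := by
    rw [integral_add (hi0.mul_const _) (hi1.const_mul _), integral_mul_const, integral_const_mul,
      integral_mollifier_sub]
    simp only [m]
    ring
  rw [← h3]
  refine integral_mono ((hi0.mul_const _).add (hi1.const_mul _)) hi2 fun t => ?_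
  have := mul_le_mul_of_nonneg_left (h2 |u t| (abs_nonneg _)) (mollifier_nonneg k (x - t))
  simp only
  linarith

/-- The derivative of the mollification is the mollification of the weak gradient. -/
theorem fderiv_mollify_apply {Ω : Set 𝔼} (hΩ : MeasurableSet Ω) {y : 𝔼 → 𝔼}
    {G : 𝔼 → Matrix (Fin n) (Fin n) ℝ} (hG : IsWeakGradient Ω y G)
    (hy : LocallyIntegrable (Ω.indicator y)) {k : ℕ} {x : 𝔼}
    (hx : Metric.closedBall x (1 / ((k : ℝ) + 1)) ⊆ Ω) (i j : Fin n) :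
    fderiv ℝ (mollify k (Ω.indicator y)) x (EuclideanSpace.single j 1) i =
      mollify k (Ω.indicator fun t => G t i j) x := by
  have hφ1 : ContDiff ℝ 1 (mollifier n k) := (mollifier_contDiff k).of_le (by exact_mod_cast le_top)
  have hφc := mollifier_hasCompactSupport (n := n) k
  have hD := hφc.hasFDerivAt_convolution_left (ContinuousLinearMap.lsmul ℝ ℝ) hφ1 hy x
  have hfd : Continuous (fderiv ℝ (mollifier n k)) := hφ1.continuous_fderiv one_ne_zero
  have hI := ((hφc.fderiv (𝕜 := ℝ)).convolutionExists_left
    (ContinuousLinearMap.precompL 𝔼 (ContinuousLinearMap.lsmul ℝ ℝ)) hfd hy x).integrable_swap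
  let T : (𝔼 →L[ℝ] 𝔼) →L[ℝ] ℝ :=
    (EuclideanSpace.proj i).comp
      (ContinuousLinearMap.apply ℝ 𝔼 (EuclideanSpace.single j (1 : ℝ) : 𝔼))
  have hT : ∀ A : 𝔼 →L[ℝ] 𝔼, A (EuclideanSpace.single j 1) i = T A := fun A => rfl
  have hf : fderiv ℝ (mollify k (Ω.indicator y)) x = _ := hD.fderiv
  rw [hT, hf, convolution_eq_swap, ← T.integral_comp_comm hI]
  -- The reflected kernel is an admissible test function; the sign from the reflection cancels the
  -- one in the definition of the weak gradient.
  set Φ : 𝔼 → ℝ := fun t => mollifier n k (x - t) with hΦ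
  have hΦder : ∀ t, fderiv ℝ Φ t = -fderiv ℝ (mollifier n k) (x - t) := by
    intro t
    have h1 : HasFDerivAt (fun t : 𝔼 => x - t) (-ContinuousLinearMap.id ℝ 𝔼) t := by
      simpa using (hasFDerivAt_id t).const_sub x
    have h2 := ((hφ1.differentiable one_ne_zero (x - t)).hasFDerivAt.comp t h1).fderiv
    rw [show Φ = mollifier n k ∘ fun t => x - t from rfl, h2]
    ext v
    simp
  have hΦs : ContDiff ℝ ∞ Φ := (mollifier_contDiff k).comp (contDiff_const.sub contDiff_id)
  have hΦt : tsupport Φ ⊆ Metric.closedBall x (1 / ((k : ℝ) + 1)) := by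
    refine closure_minimal (fun t ht => ?_) Metric.isClosed_closedBall
    have : x - t ∈ tsupport (mollifier n k) := subset_tsupport _ ht
    rw [tsupport_mollifier] at this
    rw [Metric.mem_closedBall, dist_comm, dist_eq_norm]
    simpa using this
  have hweak := hG.integral_eq Φ hΦs ((isCompact_closedBall x _).of_isClosed_subset
    (isClosed_tsupport _) hΦt) (hΦt.trans hx) i j
  have e1 : ∫ t, T ((ContinuousLinearMap.precompL 𝔼 (ContinuousLinearMap.lsmul ℝ ℝ))
      (fderiv ℝ (mollifier n k) (x - t)) (Ω.indicator y t)) =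
      -∫ t in Ω, y t i * fderiv ℝ Φ t (EuclideanSpace.single j 1) := by
    rw [← integral_neg, ← integral_indicator hΩ]
    refine integral_congr_ae (Eventually.of_forall fun t => ?_)
    by_cases ht : t ∈ Ω
    · simp only [T, indicator_of_mem ht, hΦder]
      simp [ContinuousLinearMap.precompL_apply, mul_comm]
    · simp only [T, indicator_of_notMem ht]
      simp
  rw [e1, hweak, neg_neg, mollify_apply, ← integral_indicator hΩ]
  refine integral_congr_ae (Eventually.of_forall fun t => ?_)
  by_cases ht : t ∈ Ω
  · simp [indicator_of_mem ht, hΦ, mul_comm]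
  · simp [indicator_of_notMem ht]

theorem eventually_forall_closedBall_subset {Ω C : Set 𝔼} (hΩ : IsOpen Ω) (hC : IsCompact C)
    (hCΩ : C ⊆ Ω) :
    ∀ᶠ k : ℕ in atTop, ∀ x ∈ C, Metric.closedBall x (1 / ((k : ℝ) + 1)) ⊆ Ω := by
  obtain ⟨δ, hδ, hδs⟩ := hC.exists_cthickening_subset_open hΩ hCΩ
  filter_upwards [tendsto_one_div_add_one.eventually (gt_mem_nhds hδ)] with k hk x hx
  exact (Metric.closedBall_subset_closedBall hk.le).trans
    ((Metric.closedBall_subset_cthickening hx δ).trans hδs)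

theorem tendstoUniformlyOn_mollify [CompleteSpace F] {Ω C : Set 𝔼} (hΩ : IsOpen Ω) {y : 𝔼 → F}
    (hy : ContinuousOn y Ω) (hym : AEStronglyMeasurable (Ω.indicator y))
    (hC : IsCompact C) (hCΩ : C ⊆ Ω) :
    TendstoUniformlyOn (fun k => mollify k (Ω.indicator y)) y atTop C := by
  obtain ⟨δ, hδ, hδs⟩ := hC.exists_cthickening_subset_open hΩ hCΩ
  have huc := hC.cthickening (r := δ) |>.uniformContinuousOn_of_continuous (hy.mono hδs)
  rw [Metric.tendstoUniformlyOn_iff]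
  intro ε hε
  obtain ⟨η, hη, hηu⟩ := Metric.uniformContinuousOn_iff.1 huc (ε / 2) (by linarith)
  filter_upwards [tendsto_one_div_add_one.eventually (gt_mem_nhds (lt_min hδ hη))] with k hk x hx
  have hmem : ∀ t ∈ Metric.ball x (1 / ((k : ℝ) + 1)), t ∈ Metric.cthickening δ C := fun t ht =>
    Metric.closedBall_subset_cthickening hx δ
      ((Metric.mem_ball.1 ht).le.trans (hk.le.trans (min_le_left _ _)))
  have hxm : x ∈ Metric.cthickening δ C := Metric.self_subset_cthickening C hx
  have h := ContDiffBump.dist_normed_convolution_le (φ := shrinkingBump n k) (x₀ := x)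
    (ε := ε / 2) hym fun t ht => by
      have ht' := hmem t ht
      rw [indicator_of_mem (hδs ht'), indicator_of_mem (hδs hxm)]
      exact (hηu t ht' x hxm ((Metric.mem_ball.1 ht).trans (hk.trans_le (min_le_right _ _)))).le
  rw [indicator_of_mem (hδs hxm)] at h
  rw [dist_comm]
  exact h.trans_lt (by linarith)

end Mollify

/-! ### Dominated convergence with moving majorants -/

/-- From `D ≤ min D H + (h - H) + max (H - h) 0`: the outer terms tend to zero in mean by dominated
convergence with the fixed majorant `H`, the middle one by convergence of the integrals. -/
theorem tendsto_integral_zero_of_le_of_tendsto {X : Type*} [MeasurableSpace X] {μ : Measure X}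
    {D h : ℕ → X → ℝ} {H : X → ℝ} (hD : ∀ k, AEStronglyMeasurable (D k) μ)
    (hD0 : ∀ k x, 0 ≤ D k x) (hh : ∀ k, Integrable (h k) μ) (hH : Integrable H μ)
    (hh0 : ∀ k x, 0 ≤ h k x) (hH0 : ∀ x, 0 ≤ H x)
    (hle : ∀ᶠ k in atTop, ∀ x, D k x ≤ h k x)
    (hDlim : ∀ᵐ x ∂μ, Tendsto (fun k => D k x) atTop (𝓝 0))
    (hhlim : ∀ᵐ x ∂μ, Tendsto (fun k => h k x) atTop (𝓝 (H x)))
    (hint : Tendsto (fun k => ∫ x, h k x ∂μ) atTop (𝓝 (∫ x, H x ∂μ))) :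
    Tendsto (fun k => ∫ x, D k x ∂μ) atTop (𝓝 0) := by
  have m1 : ∀ k, AEStronglyMeasurable (fun x => min (D k x) (H x)) μ := fun k =>
    (hD k).inf hH.aestronglyMeasurable
  have m2 : ∀ k, AEStronglyMeasurable (fun x => max (H x - h k x) 0) μ := fun k =>
    (hH.aestronglyMeasurable.sub (hh k).aestronglyMeasurable).sup aestronglyMeasurable_const
  have b1 : ∀ k x, ‖min (D k x) (H x)‖ ≤ H x := fun k x => by
    rw [Real.norm_eq_abs, abs_of_nonneg (le_min (hD0 k x) (hH0 x))]
    exact min_le_right _ _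
  have b2 : ∀ k x, ‖max (H x - h k x) 0‖ ≤ H x := fun k x => by
    rw [Real.norm_eq_abs, abs_of_nonneg (le_max_right _ _)]
    exact max_le (by linarith [hh0 k x]) (hH0 x)
  have t1 : Tendsto (fun k => ∫ x, min (D k x) (H x) ∂μ) atTop (𝓝 (∫ _, (0 : ℝ) ∂μ)) := by
    refine tendsto_integral_of_dominated_convergence H m1 hH
      (fun k => Eventually.of_forall (b1 k)) ?_
    filter_upwards [hDlim] with x hx
    simpa [min_eq_left (hH0 x)] using hx.min (tendsto_const_nhds (x := H x))
  have t2 : Tendsto (fun k => ∫ x, max (H x - h k x) 0 ∂μ) atTop (𝓝 (∫ _, (0 : ℝ) ∂μ)) := by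
    refine tendsto_integral_of_dominated_convergence H m2 hH
      (fun k => Eventually.of_forall (b2 k)) ?_
    filter_upwards [hhlim] with x hx
    simpa using (hx.const_sub (H x)).max (tendsto_const_nhds (x := (0 : ℝ)))
  have t3 := (t1.add (hint.sub_const (∫ x, H x ∂μ))).add t2
  simp only [integral_zero, sub_self, add_zero] at t3
  refine squeeze_zero' (Eventually.of_forall fun k => integral_nonneg (hD0 k)) ?_ t3
  filter_upwards [hle] with k hk
  have i1 : Integrable (fun x => min (D k x) (H x)) μ :=
    hH.mono' (m1 k) (Eventually.of_forall (b1 k))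
  have i2 : Integrable (fun x => max (H x - h k x) 0) μ :=
    hH.mono' (m2 k) (Eventually.of_forall (b2 k))
  rw [← integral_sub (hh k) hH]
  have i12 : Integrable (fun x => min (D k x) (H x) + (h k x - H x)) μ := i1.add ((hh k).sub hH)
  have i3 : Integrable (fun x => h k x - H x) μ := (hh k).sub hH
  rw [← integral_add i1 i3, ← integral_add i12 i2]
  refine integral_mono_of_nonneg (Eventually.of_forall (hD0 k)) (i12.add i2)
    (Eventually.of_forall fun x => ?_)
  have := hk x
  simp only
  rcases min_cases (D k x) (H x) with h1 | h1 <;> rcases max_cases (H x - h k x) 0 with h2 | h2 <;>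
    linarith [hh0 k x]

/-! ### Sobolev maps: approximation of Jacobians and the area formula -/

section SobolevApprox

variable {n : ℕ}

local notation "𝔼" => EuclideanSpace ℝ (Fin n)

/-- This degree-`n` growth is why `W^{1,n}` is the natural space: it makes the Jacobian integrable.
Bound every entry by the largest one. -/
theorem abs_det_le_sum_pow (hn : n ≠ 0) (A : Matrix (Fin n) (Fin n) ℝ) :
    |A.det| ≤ n.factorial * ∑ i, ∑ j, |A i j| ^ n := by
  have : Nonempty (Fin n × Fin n) := ⟨⟨⟨0, Nat.pos_of_ne_zero hn⟩, ⟨0, Nat.pos_of_ne_zero hn⟩⟩⟩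
  obtain ⟨p, -, hp⟩ := Finset.exists_max_image (Finset.univ : Finset (Fin n × Fin n))
    (fun p => |A p.1 p.2|) Finset.univ_nonempty
  have h := Matrix.det_le (A := A) (abv := AbsoluteValue.abs) (x := |A p.1 p.2|)
    fun i j => hp (i, j) (Finset.mem_univ _)
  simp only [Fintype.card_fin, nsmul_eq_mul, AbsoluteValue.abs_apply] at h
  refine h.trans ?_
  gcongr
  calc |A p.1 p.2| ^ n ≤ ∑ j, |A p.1 j| ^ n :=
        Finset.single_le_sum (f := fun j => |A p.1 j| ^ n) (fun _ _ => by positivity)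
          (Finset.mem_univ _)
    _ ≤ _ := Finset.single_le_sum (f := fun i => ∑ j, |A i j| ^ n)
          (fun _ _ => Finset.sum_nonneg fun _ _ => by positivity) (Finset.mem_univ _)

theorem aestronglyMeasurable_det {X : Type*} [MeasurableSpace X] {μ : Measure X}
    {G : X → Matrix (Fin n) (Fin n) ℝ} (hG : ∀ i j, AEStronglyMeasurable (fun x => G x i j) μ) :
    AEStronglyMeasurable (fun x => (G x).det) μ := by
  simp only [Matrix.det_apply]
  refine Finset.aestronglyMeasurable_fun_sum _ fun σ _ => ?_
  exact (Finset.aestronglyMeasurable_fun_prod _ fun i _ => hG _ _).const_smul _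

theorem integrable_mollify {u : 𝔼 → ℝ} (hu : Integrable u) (k : ℕ) : Integrable (mollify k u) :=
  (integrable_mollifier k).integrable_convolution _ hu

theorem integral_mollify {u : 𝔼 → ℝ} (hu : Integrable u) (k : ℕ) :
    ∫ x, mollify k u x = ∫ x, u x := by
  unfold mollify
  rw [integral_convolution _ (integrable_mollifier k) hu, integral_mollifier]
  simp

/-- On a compact set and for large `k` the derivative of the mollified map is the mollified weak
gradient, so Jacobians converge almost everywhere. By Jensen they are dominated by mollifications of
the `n`-th powers of the entries. -/
theorem IsWeakGradient.jacobianApprox (hn : n ≠ 0) {Ω : Set 𝔼} (hΩ : IsOpen Ω)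
    (hΩf : volume Ω ≠ ⊤) {y : 𝔼 → 𝔼} {G : 𝔼 → Matrix (Fin n) (Fin n) ℝ}
    (hG : IsWeakGradient Ω y G) (hy : ContinuousOn y Ω) (hyi : Integrable (Ω.indicator y))
    (hGp : ∀ i j, MemLp (fun x => G x i j) (n : ℝ≥0∞) (volume.restrict Ω)) :
    JacobianApprox Ω y (fun x => (G x).det) fun k => mollify k (Ω.indicator y) := by
  have hΩm := hΩ.measurableSet
  have : IsFiniteMeasure (volume.restrict Ω) := ⟨by simpa using hΩf.lt_top⟩
  have hn1 : (1 : ℝ≥0∞) ≤ n := by exact_mod_cast Nat.one_le_iff_ne_zero.2 hn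
  set g : Fin n → Fin n → 𝔼 → ℝ := fun i j => Ω.indicator fun t => G t i j with hg
  have hgi : ∀ i j, Integrable (g i j) := fun i j =>
    (integrable_indicator_iff hΩm).2 ((hGp i j).integrable hn1)
  have hgp : ∀ i j, Integrable fun x => |g i j x| ^ n := by
    intro i j
    have h1 : IntegrableOn (fun x => |G x i j| ^ n) Ω := (hGp i j).integrable_norm_pow hn
    refine ((integrable_indicator_iff hΩm).2 h1).congr (Eventually.of_forall fun x => ?_)
    by_cases hx : x ∈ Ω
    · simp [hg, hx]
    · simp [hg, hx, hn]
  set H₀ : 𝔼 → ℝ := fun x => ∑ i, ∑ j, |g i j x| ^ n with hH₀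
  have hH₀i : Integrable H₀ :=
    integrable_finsetSum _ fun i _ => integrable_finsetSum _ fun j _ => hgp i j
  have hH₀0 : ∀ x, 0 ≤ H₀ x := fun x => by positivity
  have hdetG : ∀ x ∈ Ω, |(G x).det| ≤ n.factorial * H₀ x := fun x hx => by
    simpa [hH₀, hg, hx] using abs_det_le_sum_pow hn (G x)
  have hGdm : AEStronglyMeasurable (fun x => (G x).det) (volume.restrict Ω) :=
    aestronglyMeasurable_det fun i j => (hGp i j).aestronglyMeasurable
  have hint : IntegrableOn (fun x => (G x).det) Ω := by
    refine (hH₀i.integrableOn.const_mul (n.factorial : ℝ)).mono' hGdm ?_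
    filter_upwards [ae_restrict_mem hΩm] with x hx using hdetG x hx
  refine ⟨mollify_contDiff hyi.locallyIntegrable, fun C hC hCc =>
    tendstoUniformlyOn_mollify hΩ hy hyi.aestronglyMeasurable hCc hC,
    fun C hC _ => hint.mono_set hC, fun C hC hCc => ?_⟩
  set d : ℕ → 𝔼 → ℝ := fun k x => (fderiv ℝ (mollify k (Ω.indicator y)) x).det with hd
  have hdc : ∀ k, Continuous (d k) := fun k =>
    continuous_det_fderiv (mollify_contDiff hyi.locallyIntegrable k)
  have hdmat : ∀ᶠ k in atTop, ∀ x ∈ C, d k x = (Matrix.of fun i j => mollify k (g i j) x).det := by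
    filter_upwards [eventually_forall_closedBall_subset hΩ hCc hC] with k hk x hx
    simp only [hd]
    rw [det_eq_matrix_det]
    congr 1
    ext i j
    exact fderiv_mollify_apply hΩm hG hyi.locallyIntegrable (hk x hx) i j
  set h : ℕ → 𝔼 → ℝ := fun k x => n.factorial *
    ((∑ i, ∑ j, mollify k (fun x => |g i j x| ^ n) x) + H₀ x) with hh
  set H : 𝔼 → ℝ := fun x => n.factorial * (H₀ x + H₀ x)
  have hmp0 : ∀ k i j x, 0 ≤ mollify k (fun x => |g i j x| ^ n) x := fun k i j x =>
    le_trans (by positivity) (mollify_pow_le (hgi i j).locallyIntegrable hn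
      (hgp i j).locallyIntegrable k x)
  have hsi : ∀ k, Integrable fun x => ∑ i, ∑ j, mollify k (fun x => |g i j x| ^ n) x := fun k =>
    integrable_finsetSum _ fun i _ => integrable_finsetSum _ fun j _ => integrable_mollify (hgp i j) k
  have key := tendsto_integral_zero_of_le_of_tendsto (μ := volume)
    (D := fun k => C.indicator fun x => |d k x - (G x).det|) (h := h) (H := H) ?_ ?_ ?_ ?_ ?_ ?_ ?_ ?_
      ?_ ?_
  · simpa only [integral_indicator hCc.measurableSet] using key
  · intro k
    rw [aestronglyMeasurable_indicator_iff hCc.measurableSet]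
    exact ((hdc k).aestronglyMeasurable.sub
      (hGdm.mono_measure (Measure.restrict_mono_set _ hC))).norm
  · intro k x
    exact indicator_nonneg (fun _ _ => abs_nonneg _) x
  · intro k
    exact ((hsi k).add hH₀i).const_mul _
  · exact (hH₀i.add hH₀i).const_mul _
  · intro k x
    refine mul_nonneg (Nat.cast_nonneg _) (add_nonneg ?_ (hH₀0 x))
    exact Finset.sum_nonneg fun i _ => Finset.sum_nonneg fun j _ => hmp0 k i j x
  · intro x
    exact mul_nonneg (Nat.cast_nonneg _) (add_nonneg (hH₀0 x) (hH₀0 x))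
  · filter_upwards [hdmat] with k hk x
    by_cases hx : x ∈ C
    · rw [indicator_of_mem hx, hk x hx]
      refine (abs_sub _ _).trans ?_
      simp only [hh, mul_add]
      refine add_le_add ((abs_det_le_sum_pow hn _).trans ?_) (hdetG x (hC hx))
      gcongr with i _ j _
      exact mollify_pow_le (hgi i j).locallyIntegrable hn (hgp i j).locallyIntegrable k x
    · rw [indicator_of_notMem hx]
      refine mul_nonneg (Nat.cast_nonneg _) (add_nonneg ?_ (hH₀0 x))
      exact Finset.sum_nonneg fun i _ => Finset.sum_nonneg fun j _ => hmp0 k i j x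
  · have hae : ∀ᵐ x, ∀ i j, Tendsto (fun k => mollify k (g i j) x) atTop (𝓝 (g i j x)) :=
      ae_all_iff.2 fun i => ae_all_iff.2 fun j => ae_tendsto_mollify (hgi i j).locallyIntegrable
    filter_upwards [hae] with x hx
    by_cases hxC : x ∈ C
    · simp only [indicator_of_mem hxC]
      have h1 : Tendsto (fun k => (Matrix.of fun i j => mollify k (g i j) x).det) atTop
          (𝓝 (G x).det) := by
        have hc : Continuous fun A : Matrix (Fin n) (Fin n) ℝ => A.det := continuous_id.matrix_det
        refine (hc.tendsto (G x)).comp ?_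
        refine tendsto_pi_nhds.2 fun i => tendsto_pi_nhds.2 fun j => ?_
        have := hx i j
        simpa [hg, hC hxC] using this
      have h2 : Tendsto (fun k => d k x) atTop (𝓝 (G x).det) :=
        h1.congr' (hdmat.mono fun k hk => (hk x hxC).symm)
      simpa using (h2.sub_const (G x).det).abs
    · simp [indicator_of_notMem hxC]
  · have hae : ∀ᵐ x, ∀ i j, Tendsto (fun k => mollify k (fun x => |g i j x| ^ n) x) atTop
        (𝓝 (|g i j x| ^ n)) :=
      ae_all_iff.2 fun i => ae_all_iff.2 fun j => ae_tendsto_mollify (hgp i j).locallyIntegrable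
    filter_upwards [hae] with x hx
    refine Tendsto.const_mul _ (Tendsto.add ?_ tendsto_const_nhds)
    exact tendsto_finsetSum _ fun i _ => tendsto_finsetSum _ fun j _ => hx i j
  -- Mollification preserves integrals, so the majorants all have the integral of their limit.
  · refine tendsto_const_nhds.congr fun k => ?_
    simp only [hh, H]
    rw [integral_const_mul, integral_const_mul, integral_add hH₀i hH₀i, integral_add (hsi k) hH₀i]
    congr 2
    rw [integral_finsetSum _ fun i _ => integrable_finsetSum _ fun j _ => hgp i j,
      integral_finsetSum _ fun i _ => integrable_finsetSum _ fun j _ => integrable_mollify (hgp i j) k]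
    refine Finset.sum_congr rfl fun i _ => ?_
    rw [integral_finsetSum _ fun j _ => hgp i j,
      integral_finsetSum _ fun j _ => integrable_mollify (hgp i j) k]
    exact Finset.sum_congr rfl fun j _ => (integral_mollify (hgp i j) k).symm

theorem MemSobolev.exists_weakGradient {p : ℝ≥0∞} {Ω : Set 𝔼} {y : 𝔼 → 𝔼}
    (h : MemSobolev p Ω y) : IsWeakGradient Ω y (weakGradient Ω y) := by
  obtain ⟨-, G, hG, -⟩ := h
  have hex : ∃ G, IsWeakGradient Ω y G := ⟨G, hG⟩
  rw [weakGradient, dif_pos hex]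
  exact hex.choose_spec

/-- The fundamental lemma of the calculus of variations. It makes the arbitrary choice in
`weakGradient` harmless. -/
theorem IsWeakGradient.ae_eq {Ω : Set 𝔼} (hΩ : IsOpen Ω) {y : 𝔼 → 𝔼}
    {G G' : 𝔼 → Matrix (Fin n) (Fin n) ℝ} (hG : IsWeakGradient Ω y G)
    (hG' : IsWeakGradient Ω y G') : ∀ᵐ x ∂volume.restrict Ω, G x = G' x := by
  have h : ∀ i j, ∀ᵐ x ∂volume, x ∈ Ω → G x i j - G' x i j = 0 := by
    intro i j
    refine IsOpen.ae_eq_zero_of_integral_contDiff_smul_eq_zero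
      (f := fun x => G x i j - G' x i j) hΩ
      ((hG.locallyIntegrableOn_grad i j).sub (hG'.locallyIntegrableOn_grad i j)) fun φ hφ hφc hφs => ?_
    have h1 := (hG.integral_eq φ hφ hφc hφs i j).symm.trans (hG'.integral_eq φ hφ hφc hφs i j)
    have hint : ∀ {K : 𝔼 → Matrix (Fin n) (Fin n) ℝ}, IsWeakGradient Ω y K →
        IntegrableOn (fun x => K x i j * φ x) Ω := by
      intro K hK
      have h2 : IntegrableOn (fun x => K x i j) (tsupport φ) :=
        (hK.locallyIntegrableOn_grad i j).integrableOn_compact_subset hφs hφc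
      have h3 : IntegrableOn (fun x => K x i j * φ x) (tsupport φ) :=
        h2.mul_continuousOn hφ.continuous.continuousOn hφc
      refine h3.of_forall_sdiff_eq_zero hΩ.measurableSet fun x hx => ?_
      rw [image_eq_zero_of_notMem_tsupport hx.2, mul_zero]
    rw [← setIntegral_eq_integral_of_forall_compl_eq_zero (s := Ω)]
    · simp only [smul_eq_mul, mul_comm (φ _), sub_mul]
      rw [integral_sub (hint hG) (hint hG'), neg_injective h1, sub_self]
    · intro x hx
      rw [image_eq_zero_of_notMem_tsupport fun h => hx (hφs h), zero_smul]
  rw [ae_restrict_iff' hΩ.measurableSet]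
  filter_upwards [ae_all_iff.2 fun i => ae_all_iff.2 fun j => h i j] with x hx hxΩ
  ext i j
  exact sub_eq_zero.1 (hx i j hxΩ)

theorem MemSobolev.memLp_weakGradient {p : ℝ≥0∞} {Ω : Set 𝔼} (hΩ : IsOpen Ω) {y : 𝔼 → 𝔼}
    (h : MemSobolev p Ω y) (i j : Fin n) :
    MemLp (fun x => weakGradient Ω y x i j) p (volume.restrict Ω) := by
  obtain ⟨G, hG, hGp⟩ := h.2
  refine (hGp i j).ae_eq ?_
  filter_upwards [hG.ae_eq hΩ h.exists_weakGradient] with x hx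
  rw [hx]

theorem MemSobolev.integrable_indicator (hn : n ≠ 0) {Ω : Set 𝔼} (hΩ : MeasurableSet Ω)
    (hΩf : volume Ω ≠ ⊤) {y : 𝔼 → 𝔼} (h : MemSobolev (n : ℝ≥0∞) Ω y) :
    Integrable (Ω.indicator y) := by
  have : IsFiniteMeasure (volume.restrict Ω) := ⟨by simpa using hΩf.lt_top⟩
  exact (integrable_indicator_iff hΩ).2
    (h.1.integrable (by exact_mod_cast Nat.one_le_iff_ne_zero.2 hn))

theorem MemSobolev.jacobianApprox (hn : n ≠ 0) {Ω : Set 𝔼} (hΩ : IsOpen Ω)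
    (hΩf : volume Ω ≠ ⊤) {y : 𝔼 → 𝔼} (h : MemSobolev (n : ℝ≥0∞) Ω y) (hy : ContinuousOn y Ω) :
    JacobianApprox Ω y (fun x => (weakGradient Ω y x).det) fun k => mollify k (Ω.indicator y) :=
  h.exists_weakGradient.jacobianApprox hn hΩ hΩf hy
    (h.integrable_indicator hn hΩ.measurableSet hΩf) (h.memLp_weakGradient hΩ)

/-- The area formula for maps in the admissible class. -/
theorem setLIntegral_det_weakGradient_eq_volume (hn : n ≠ 0) {Ω₁ Ω₂ : Set 𝔼} {y ξ : 𝔼 → 𝔼}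
    (hp : IsHomeoPair Ω₁ Ω₂ y ξ) (hΩ₁ : volume Ω₁ ≠ ⊤) (hΩ₂ : volume Ω₂ ≠ ⊤)
    (hy : MemSobolev (n : ℝ≥0∞) Ω₁ y) (hξ : MemSobolev (n : ℝ≥0∞) Ω₂ ξ)
    (hpos : ∀ᵐ x ∂volume.restrict Ω₁, 0 < (weakGradient Ω₁ y x).det) {S : Set 𝔼}
    (hS : MeasurableSet S) (hSΩ : S ⊆ Ω₂) :
    ∫⁻ x in Ω₁ ∩ y ⁻¹' S, ENNReal.ofReal (weakGradient Ω₁ y x).det = volume S :=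
  (hy.jacobianApprox hn hp.isOpen_left hΩ₁ hp.continuousOn).setLIntegral_eq_volume hp
    (hξ.jacobianApprox hn hp.isOpen_right hΩ₂ hp.continuousOn_inv)
    (aestronglyMeasurable_det fun i j =>
      (hy.memLp_weakGradient hp.isOpen_left i j).aestronglyMeasurable).aemeasurable
    (aestronglyMeasurable_det fun i j =>
      (hξ.memLp_weakGradient hp.isOpen_right i j).aestronglyMeasurable).aemeasurable hpos hS hSΩ

end SobolevApprox

/-! ### Singular values, similarities and rotations -/

section SingularValues

variable {n : ℕ}

lemma singVal_nonneg (A : Matrix (Fin n) (Fin n) ℝ) (i : Fin n) : 0 ≤ singVal A i :=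
  LinearMap.singularValues_nonneg _ _

lemma det_toEuclideanLin (A : Matrix (Fin n) (Fin n) ℝ) :
    LinearMap.det (Matrix.toEuclideanLin A) = A.det := by
  rw [Matrix.toEuclideanLin_eq_toLin_orthonormal, LinearMap.det_toLin]

lemma prod_singVal (A : Matrix (Fin n) (Fin n) ℝ) : ∏ i, singVal A i = |A.det| := by
  rw [← det_toEuclideanLin, ← LinearMap.normDet_eq_abs_det,
    LinearMap.normDet_eq_prod_singularValues, finrank_euclideanSpace_fin,
    ← Fin.prod_univ_eq_prod_range]
  rfl

lemma singVal_pos {A : Matrix (Fin n) (Fin n) ℝ} (hA : 0 < A.det) (i : Fin n) :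
    0 < singVal A i := by
  refine (singVal_nonneg A i).lt_of_ne' fun h => ?_
  have := prod_singVal A
  rw [Finset.prod_eq_zero (Finset.mem_univ i) h, abs_of_pos hA] at this
  exact hA.ne this

/-- The square of the Frobenius norm. -/
noncomputable def frobSq (A : Matrix (Fin n) (Fin n) ℝ) : ℝ := ∑ i, ∑ j, A i j ^ 2

lemma sq_singVal (A : Matrix (Fin n) (Fin n) ℝ) (i : Fin n) : singVal A i ^ 2 =
    (Matrix.toEuclideanLin A).isSymmetric_adjoint_comp_self.eigenvalues
      finrank_euclideanSpace_fin i :=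
  LinearMap.sq_singularValues_fin _ finrank_euclideanSpace_fin i

/-- Both sides are the trace of `AᵀA`, computed in an eigenbasis and in the standard basis. -/
lemma sum_sq_singVal (A : Matrix (Fin n) (Fin n) ℝ) : ∑ i, singVal A i ^ 2 = frobSq A := by
  simp_rw [sq_singVal]
  have h2 := (Matrix.toEuclideanLin A).isSymmetric_adjoint_comp_self.trace_eq_sum_eigenvalues
    (finrank_euclideanSpace_fin (𝕜 := ℝ) (n := n))
  simp only [RCLike.ofReal_real_eq_id, id] at h2
  rw [← h2, LinearMap.trace_eq_sum_inner _ (EuclideanSpace.basisFun (Fin n) ℝ), frobSq,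
    Finset.sum_comm]
  refine Finset.sum_congr rfl fun i _ => ?_
  rw [LinearMap.comp_apply, LinearMap.adjoint_inner_right, real_inner_self_eq_norm_sq,
    EuclideanSpace.real_norm_sq_eq]
  simp [Matrix.toLpLin_apply]

lemma isSymmetric_eq_smul_id {V : Type*} [NormedAddCommGroup V] [InnerProductSpace ℝ V]
    [FiniteDimensional ℝ V] {S : V →ₗ[ℝ] V} (hS : S.IsSymmetric)
    (hn : Module.finrank ℝ V = n) {μ : ℝ} (h : ∀ i, hS.eigenvalues hn i = μ) :
    S = μ • LinearMap.id := by
  refine (hS.eigenvectorBasis hn).toBasis.ext fun i => ?_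
  have h1 := hS.apply_eigenvectorBasis hn i
  rw [h i] at h1
  simpa using h1

lemma norm_toEuclideanLin_of_singVal_eq {A : Matrix (Fin n) (Fin n) ℝ} {c : ℝ} (hc : 0 ≤ c)
    (h : ∀ i, singVal A i = c) (x : EuclideanSpace ℝ (Fin n)) :
    ‖Matrix.toEuclideanLin A x‖ = c * ‖x‖ := by
  have h1 : (Matrix.toEuclideanLin A).adjoint ∘ₗ Matrix.toEuclideanLin A =
      (c ^ 2) • LinearMap.id :=
    isSymmetric_eq_smul_id _ finrank_euclideanSpace_fin fun i => by rw [← sq_singVal, h i]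
  have h4 : ‖Matrix.toEuclideanLin A x‖ ^ 2 = (c * ‖x‖) ^ 2 := by
    rw [← real_inner_self_eq_norm_sq, ← LinearMap.adjoint_inner_right,
      ← LinearMap.comp_apply, h1, LinearMap.smul_apply, LinearMap.id_apply, real_inner_smul_right,
      real_inner_self_eq_norm_sq, mul_pow]
  exact (sq_eq_sq₀ (norm_nonneg _) (by positivity)).mp h4

lemma singVal_eq_of_norm_toEuclideanLin {A : Matrix (Fin n) (Fin n) ℝ} {c : ℝ} (hc : 0 ≤ c)
    (h : ∀ x, ‖Matrix.toEuclideanLin A x‖ = c * ‖x‖) (i : Fin n) : singVal A i = c := by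
  set T := Matrix.toEuclideanLin A with hT
  have hi : (i : ℕ) < Module.finrank ℝ (EuclideanSpace ℝ (Fin n)) := by
    rw [finrank_euclideanSpace_fin]; exact i.2
  obtain ⟨x, hx⟩ :=
    (LinearMap.hasEigenvalue_adjoint_comp_self_sq_singularValues T hi).exists_hasEigenvector
  have h1 : ‖T x‖ ^ 2 = singVal A i ^ 2 * ‖x‖ ^ 2 := by
    rw [← real_inner_self_eq_norm_sq, ← LinearMap.adjoint_inner_right,
      ← LinearMap.comp_apply, hx.apply_eq_smul, real_inner_smul_right, real_inner_self_eq_norm_sq]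
    rfl
  rw [h x, mul_pow] at h1
  have h2 : 0 < ‖x‖ := norm_pos_iff.mpr hx.2
  exact ((sq_eq_sq₀ hc (singVal_nonneg A i)).mp
    (mul_right_cancel₀ (pow_pos h2 2).ne' h1)).symm

lemma norm_toEuclideanLin_of_mem_orthogonalGroup {R : Matrix (Fin n) (Fin n) ℝ}
    (hR : R ∈ Matrix.orthogonalGroup (Fin n) ℝ) (x : EuclideanSpace ℝ (Fin n)) :
    ‖Matrix.toEuclideanLin R x‖ = ‖x‖ := by
  have h1 : R.conjTranspose * R = 1 := (Matrix.mem_unitaryGroup_iff' (A := R)).mp hR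
  have h2 : ‖Matrix.toEuclideanLin R x‖ ^ 2 = ‖x‖ ^ 2 := by
    rw [← real_inner_self_eq_norm_sq, ← LinearMap.adjoint_inner_right,
      ← Matrix.toEuclideanLin_conjTranspose_eq_adjoint]
    have : Matrix.toEuclideanLin R.conjTranspose (Matrix.toEuclideanLin R x) = x := by
      rw [Matrix.toLpLin_apply, Matrix.toLpLin_apply]
      rw [Matrix.mulVec_mulVec, h1, Matrix.one_mulVec]
    rw [this, real_inner_self_eq_norm_sq]
  exact (sq_eq_sq₀ (norm_nonneg _) (norm_nonneg _)).mp h2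

lemma mem_orthogonalGroup_of_norm_toEuclideanLin {R : Matrix (Fin n) (Fin n) ℝ}
    (h : ∀ x, ‖Matrix.toEuclideanLin R x‖ = ‖x‖) : R ∈ Matrix.orthogonalGroup (Fin n) ℝ := by
  refine (Matrix.mem_unitaryGroup_iff' (A := R)).mpr ?_
  have h1 := (LinearMap.norm_map_iff_inner_map_map (Matrix.toEuclideanLin R)).mp h
  apply Matrix.toEuclideanLin.injective
  refine LinearMap.ext fun x => ext_inner_right ℝ fun z => ?_
  have h2 : Matrix.toEuclideanLin (star R * R) x =
      Matrix.toEuclideanLin R.conjTranspose (Matrix.toEuclideanLin R x) := by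
    simp [Matrix.toLpLin_apply, Matrix.mulVec_mulVec, Matrix.star_eq_conjTranspose]
  have h3 : Matrix.toEuclideanLin (1 : Matrix (Fin n) (Fin n) ℝ) x = x := by
    simp
  rw [h2, h3, Matrix.toEuclideanLin_conjTranspose_eq_adjoint, LinearMap.adjoint_inner_left, h1]

lemma det_smul_of_mem_specialOrthogonalGroup {R : Matrix (Fin n) (Fin n) ℝ}
    (hR : R ∈ Matrix.specialOrthogonalGroup (Fin n) ℝ) (c : ℝ) : (c • R).det = c ^ n := by
  rw [Matrix.det_smul, Fintype.card_fin, (Matrix.mem_specialOrthogonalGroup_iff.mp hR).2, mul_one]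

lemma singVal_smul_of_mem_specialOrthogonalGroup {R : Matrix (Fin n) (Fin n) ℝ}
    (hR : R ∈ Matrix.specialOrthogonalGroup (Fin n) ℝ) {c : ℝ} (hc : 0 ≤ c) (i : Fin n) :
    singVal (c • R) i = c := by
  refine singVal_eq_of_norm_toEuclideanLin hc (fun x => ?_) i
  rw [map_smul, LinearMap.smul_apply, norm_smul, Real.norm_of_nonneg hc,
    norm_toEuclideanLin_of_mem_orthogonalGroup (Matrix.mem_specialOrthogonalGroup_iff.mp hR).1]

end SingularValues

/-! ### Pointwise lower bounds for the energy -/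

section Energy

variable {n : ℕ} {α : ℝ} {h : ℝ → ℝ}

/-- The energy `Ψ(δ^{1/n} R)` of a dilation with determinant `δ`. -/
noncomputable def dilationEnergy (n : ℕ) (α : ℝ) (h : ℝ → ℝ) (δ : ℝ) : ℝ :=
  n * δ ^ (α / n) + n * δ ^ (1 - α / n) + h δ

/-- A lower bound for `Ψ(A)` that depends on `A` through `|A|` and `det A` only. -/
noncomputable def isotropicEnergy (α : ℝ) (h : ℝ → ℝ) (A : Matrix (Fin n) (Fin n) ℝ) : ℝ :=
  n * (frobSq A / n) ^ (α / 2) + n * A.det ^ (1 - α / n) + h A.det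

/-- The derivative of the energy of dilations. -/
noncomputable def dilationSlope (n : ℕ) (α : ℝ) (h : ℝ → ℝ) (δ : ℝ) : ℝ :=
  n * (α / n * δ ^ (α / n - 1)) + n * ((1 - α / n) * δ ^ (-(α / n))) + deriv h δ

lemma prod_rpow_inv {v : Fin n → ℝ} (hv : ∀ i, 0 < v i) (r : ℝ) :
    ∏ i, (v i ^ r) ^ ((n : ℝ)⁻¹) = (∏ i, v i) ^ (r / n) := by
  rw [← Real.finsetProd_rpow _ _ fun i _ => (hv i).le]
  exact Finset.prod_congr rfl fun i _ => by rw [← Real.rpow_mul (hv i).le, div_eq_mul_inv]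

/-- AM-GM for the numbers `v i ^ r`. It is needed for `r = -α` and for `r = 2`. -/
lemma mul_rpow_prod_le_sum_rpow (hn : n ≠ 0) {v : Fin n → ℝ} (hv : ∀ i, 0 < v i) (r : ℝ) :
    n * (∏ i, v i) ^ (r / n) ≤ ∑ i, v i ^ r := by
  have hn' : (0 : ℝ) < n := by positivity
  have := Real.geom_mean_le_arith_mean_weighted Finset.univ (fun _ : Fin n => (n : ℝ)⁻¹)
    (fun i => v i ^ r) (fun _ _ => by positivity) (by simp [hn'.ne'])
    fun i _ => (Real.rpow_pos_of_pos (hv i) r).le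
  rw [prod_rpow_inv hv, ← Finset.mul_sum, inv_mul_eq_div, le_div_iff₀ hn'] at this
  linarith

lemma eq_of_mul_rpow_prod_eq_sum_rpow (hn : n ≠ 0) {v : Fin n → ℝ} (hv : ∀ i, 0 < v i) {r : ℝ}
    (hr : r ≠ 0) (h : n * (∏ i, v i) ^ (r / n) = ∑ i, v i ^ r) (i j : Fin n) : v i = v j := by
  have hn' : (0 : ℝ) < n := by positivity
  have := (Real.geom_mean_eq_arith_mean_weighted_iff_of_pos Finset.univ
    (fun _ : Fin n => (n : ℝ)⁻¹) (fun i => v i ^ r) (fun _ _ => by positivity) (by simp [hn'.ne'])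
    fun i _ => (Real.rpow_pos_of_pos (hv i) r).le).mp (by
      rw [prod_rpow_inv hv, ← Finset.mul_sum, inv_mul_eq_div, eq_div_iff hn'.ne', ← h]; ring)
    i (Finset.mem_univ i) j (Finset.mem_univ j)
  exact (Real.rpow_left_inj (hv i).le (hv j).le hr).mp this

lemma mul_rpow_mean_sq_le_sum_rpow (hn : n ≠ 0) (hα : (n : ℝ) ≤ α) {v : Fin n → ℝ}
    (hv : ∀ i, 0 < v i) : n * ((∑ i, v i ^ 2) / n) ^ (α / 2) ≤ ∑ i, v i ^ α := by
  have hn' : (0 : ℝ) < n := by positivity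
  have hsq : ∀ i, (v i ^ 2) ^ (α / 2) = v i ^ α := fun i => by
    rw [← Real.rpow_natCast, ← Real.rpow_mul (hv i).le]; congr 1; push_cast; ring
  -- The power mean inequality needs `α / 2 ≥ 1`, which `α ≥ n` yields only for `n ≥ 2`; for `n = 1`
  -- the two sides agree.
  rcases Nat.lt_or_ge n 2 with h1 | h2
  · obtain rfl : n = 1 := by omega
    simp [hsq]
  · have h3 : 1 ≤ α / 2 := by
      have : (2 : ℝ) ≤ n := by exact_mod_cast h2
      linarith
    have := Real.rpow_arith_mean_le_arith_mean_rpow Finset.univ (fun _ : Fin n => (n : ℝ)⁻¹)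
      (fun i => v i ^ 2) (fun _ _ => by positivity) (by simp [hn'.ne'])
      (fun i _ => by positivity) h3
    simp_rw [hsq] at this
    rw [← Finset.mul_sum, ← Finset.mul_sum, inv_mul_eq_div, inv_mul_eq_div, le_div_iff₀ hn'] at this
    linarith

lemma isotropicEnergy_le_elasticEnergy (hn : n ≠ 0) (hα : (n : ℝ) ≤ α)
    {A : Matrix (Fin n) (Fin n) ℝ} (hA : 0 < A.det) :
    isotropicEnergy α h A ≤ elasticEnergy α h A := by
  have h1 := mul_rpow_mean_sq_le_sum_rpow hn hα (singVal_pos hA)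
  have h2 := mul_le_mul_of_nonneg_left (mul_rpow_prod_le_sum_rpow hn (singVal_pos hA) (-α)) hA.le
  rw [prod_singVal, abs_of_pos hA] at h2
  rw [sum_sq_singVal] at h1
  have h3 : A.det ^ (1 - α / n) = A.det * A.det ^ (-α / n) := by
    rw [sub_eq_add_neg, Real.rpow_add hA, Real.rpow_one, neg_div]
  rw [isotropicEnergy, elasticEnergy, h3]
  linarith

lemma rpow_mean_frobSq (hn : n ≠ 0) (hα : (n : ℝ) ≤ α) {A : Matrix (Fin n) (Fin n) ℝ}
    (hA : 0 < A.det) :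
    A.det ^ (α / n) ≤ (frobSq A / n) ^ (α / 2) ∧
      (A.det ^ (α / n) = (frobSq A / n) ^ (α / 2) → ∀ i j, singVal A i = singVal A j) := by
  have hn' : (0 : ℝ) < n := by positivity
  have hα0 : 0 < α / 2 := by linarith
  have h1 := mul_rpow_prod_le_sum_rpow hn (singVal_pos hA) 2
  have h2 := eq_of_mul_rpow_prod_eq_sum_rpow hn (singVal_pos hA) (two_ne_zero (α := ℝ))
  rw [prod_singVal, abs_of_pos hA] at h1 h2
  have h3 : ∑ i, singVal A i ^ (2 : ℝ) = frobSq A := by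
    rw [← sum_sq_singVal]; exact Finset.sum_congr rfl fun i _ => Real.rpow_two _
  rw [h3] at h1 h2
  have h4 : A.det ^ (α / n) = (A.det ^ ((2 : ℝ) / n)) ^ (α / 2) := by
    rw [← Real.rpow_mul hA.le]; congr 1; field_simp
  have h5 : A.det ^ ((2 : ℝ) / n) ≤ frobSq A / n := by rw [le_div_iff₀ hn']; linarith
  have h6 : 0 ≤ A.det ^ ((2 : ℝ) / n) := Real.rpow_nonneg hA.le _
  rw [h4]
  refine ⟨Real.rpow_le_rpow h6 h5 hα0.le, fun h7 => h2 ?_⟩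
  rw [(Real.rpow_left_inj h6 (h6.trans h5) hα0.ne').mp h7]
  field_simp

lemma dilationEnergy_le_isotropicEnergy (hn : n ≠ 0) (hα : (n : ℝ) ≤ α)
    {A : Matrix (Fin n) (Fin n) ℝ} (hA : 0 < A.det) :
    dilationEnergy n α h A.det ≤ isotropicEnergy α h A := by
  have := mul_le_mul_of_nonneg_left (rpow_mean_frobSq hn hα hA).1 (Nat.cast_nonneg n)
  rw [dilationEnergy, isotropicEnergy]
  linarith

lemma singVal_eq_of_isotropicEnergy_eq (hn : n ≠ 0) (hα : (n : ℝ) ≤ α)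
    {A : Matrix (Fin n) (Fin n) ℝ} (hA : 0 < A.det)
    (he : isotropicEnergy α h A = dilationEnergy n α h A.det) (i j : Fin n) :
    singVal A i = singVal A j := by
  refine (rpow_mean_frobSq hn hα hA).2 ?_ i j
  rw [dilationEnergy, isotropicEnergy] at he
  have hn' : (0 : ℝ) < n := by positivity
  exact mul_left_cancel₀ hn'.ne' (by linarith)

lemma norm_toEuclideanLin_of_singVal_eq_singVal {A : Matrix (Fin n) (Fin n) ℝ} {c : ℝ} (hc : 0 < c)
    (hA : A.det = c ^ n) (hs : ∀ i j, singVal A i = singVal A j) (x : EuclideanSpace ℝ (Fin n)) :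
    ‖Matrix.toEuclideanLin A x‖ = c * ‖x‖ := by
  refine norm_toEuclideanLin_of_singVal_eq hc.le (fun i => ?_) x
  have h1 := prod_singVal A
  rw [hA, abs_of_pos (pow_pos hc n), Finset.prod_congr rfl fun j _ => hs j i, Finset.prod_const,
    Finset.card_univ, Fintype.card_fin] at h1
  exact (pow_left_inj₀ (singVal_nonneg A i) hc.le (Fin.pos i).ne').mp h1

lemma elasticEnergy_smul_of_mem_specialOrthogonalGroup (hn : n ≠ 0)
    {R : Matrix (Fin n) (Fin n) ℝ} (hR : R ∈ Matrix.specialOrthogonalGroup (Fin n) ℝ) {c : ℝ}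
    (hc : 0 < c) : elasticEnergy α h (c • R) = dilationEnergy n α h (c ^ n) := by
  have hn' : (n : ℝ) ≠ 0 := by positivity
  have h1 : (c ^ n) ^ (α / n) = c ^ α := by
    rw [← Real.rpow_natCast, ← Real.rpow_mul hc.le]; congr 1; field_simp
  have h2 : (c ^ n) ^ (1 - α / n) = c ^ n * c ^ (-α) := by
    rw [Real.rpow_sub (pow_pos hc n), h1, Real.rpow_one, Real.rpow_neg hc.le, div_eq_mul_inv]
  simp only [elasticEnergy, dilationEnergy, singVal_smul_of_mem_specialOrthogonalGroup hR hc.le,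
    det_smul_of_mem_specialOrthogonalGroup hR, h1, h2, Finset.sum_const, Finset.card_univ,
    Fintype.card_fin, nsmul_eq_mul]
  ring

/-! ### Tangent lines -/

lemma rpow_tangent_le {s δ δ₀ : ℝ} (hs : 1 ≤ s) (hδ : 0 < δ) (hδ₀ : 0 < δ₀) :
    δ₀ ^ s + s * δ₀ ^ (s - 1) * (δ - δ₀) ≤ δ ^ s ∧
      (1 < s → δ ^ s = δ₀ ^ s + s * δ₀ ^ (s - 1) * (δ - δ₀) → δ = δ₀) := by
  have h0 : (1 + (δ / δ₀ - 1)) ^ s = δ ^ s / δ₀ ^ s := by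
    rw [add_sub_cancel, Real.div_rpow hδ.le hδ₀.le]
  have h1 : -1 ≤ δ / δ₀ - 1 := by have := (div_pos hδ hδ₀).le; linarith
  have hp : 0 < δ₀ ^ s := Real.rpow_pos_of_pos hδ₀ s
  have h2 : δ₀ ^ s + s * δ₀ ^ (s - 1) * (δ - δ₀) = (1 + s * (δ / δ₀ - 1)) * δ₀ ^ s := by
    rw [Real.rpow_sub_one hδ₀.ne']; field_simp
  rw [h2]
  refine ⟨?_, fun h3 h4 => ?_⟩
  · have := one_add_mul_self_le_rpow_one_add h1 hs
    rwa [h0, le_div_iff₀ hp] at this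
  · by_contra h5
    have := one_add_mul_self_lt_rpow_one_add h1 (sub_ne_zero.mpr fun h6 =>
      h5 ((div_eq_one_iff_eq hδ₀.ne').mp h6)) h3
    rw [h0, lt_div_iff₀ hp] at this
    exact this.ne' h4

/-- Since `δ ^ (1 - s) = δ * (1/δ) ^ s`, take the tangent inequality for `x ^ s` at `1/δ₀`, evaluate
it at `1/δ` and multiply by `δ`. -/
lemma rpow_one_sub_tangent_le {s δ δ₀ : ℝ} (hs : 1 ≤ s) (hδ : 0 < δ) (hδ₀ : 0 < δ₀) :
    δ₀ ^ (1 - s) + (1 - s) * δ₀ ^ (-s) * (δ - δ₀) ≤ δ ^ (1 - s) := by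
  have h1 := mul_le_mul_of_nonneg_left
    (rpow_tangent_le hs (inv_pos.mpr hδ) (inv_pos.mpr hδ₀)).1 hδ.le
  have e : ∀ x : ℝ, 0 < x → x ^ (1 - s) = x * x⁻¹ ^ s := fun x hx => by
    rw [Real.rpow_sub hx, Real.rpow_one, Real.inv_rpow hx.le, div_eq_mul_inv]
  have e2 : (δ₀⁻¹) ^ (s - 1) = δ₀ * δ₀⁻¹ ^ s := by
    rw [Real.rpow_sub_one (inv_pos.mpr hδ₀).ne', div_inv_eq_mul, mul_comm]
  have e3 : δ₀ ^ (-s) = δ₀⁻¹ ^ s := by rw [Real.rpow_neg hδ₀.le, Real.inv_rpow hδ₀.le]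
  rw [e δ hδ, e δ₀ hδ₀, e3]
  rw [e2] at h1
  refine le_trans (le_of_eq ?_) h1
  field_simp
  ring

lemma differentiableAt_of_contDiffOn (h_C1 : ContDiffOn ℝ 1 h (Ioi 0)) {δ : ℝ} (hδ : 0 < δ) :
    DifferentiableAt ℝ h δ :=
  (h_C1.differentiableOn one_ne_zero).differentiableAt (Ioi_mem_nhds hδ)

lemma convex_tangent_le (h_C1 : ContDiffOn ℝ 1 h (Ioi 0)) (h_convex : ConvexOn ℝ (Ioi 0) h)
    {δ δ₀ : ℝ} (hδ : 0 < δ) (hδ₀ : 0 < δ₀) : h δ₀ + deriv h δ₀ * (δ - δ₀) ≤ h δ := by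
  have hd := (differentiableAt_of_contDiffOn h_C1 hδ₀).hasDerivAt
  rcases lt_trichotomy δ δ₀ with hlt | rfl | hlt
  · have := h_convex.slope_le_of_hasDerivAt (mem_Ioi.mpr hδ) (mem_Ioi.mpr hδ₀) hlt hd
    rw [slope_def_field, div_le_iff₀ (by linarith)] at this
    linarith
  · simp
  · have := h_convex.le_slope_of_hasDerivAt (mem_Ioi.mpr hδ₀) (mem_Ioi.mpr hδ) hlt hd
    rw [slope_def_field, le_div_iff₀ (by linarith)] at this
    linarith

/-- A sum of three tangent inequalities; equality in the sum forces equality in each. The first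
summand then decides `δ = δ₀` when `α > n`, and otherwise the contact of `h` with its tangent is
what remains. -/
lemma dilationEnergy_tangent_le (hn : n ≠ 0) (hα : (n : ℝ) ≤ α)
    (h_C1 : ContDiffOn ℝ 1 h (Ioi 0)) (h_convex : ConvexOn ℝ (Ioi 0) h)
    {δ δ₀ : ℝ} (hδ : 0 < δ) (hδ₀ : 0 < δ₀) :
    dilationEnergy n α h δ₀ + dilationSlope n α h δ₀ * (δ - δ₀) ≤ dilationEnergy n α h δ ∧
    (dilationEnergy n α h δ = dilationEnergy n α h δ₀ + dilationSlope n α h δ₀ * (δ - δ₀) →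
      ((n : ℝ) < α → δ = δ₀) ∧ h δ = h δ₀ + deriv h δ₀ * (δ - δ₀)) := by
  have hn' : (0 : ℝ) < n := by positivity
  have hs : 1 ≤ α / n := by rwa [le_div_iff₀ hn', one_mul]
  have h1 := rpow_tangent_le hs hδ hδ₀
  have h2 := mul_le_mul_of_nonneg_left h1.1 hn'.le
  have h3 := mul_le_mul_of_nonneg_left (rpow_one_sub_tangent_le hs hδ hδ₀) hn'.le
  have h4 := convex_tangent_le h_C1 h_convex hδ hδ₀
  simp only [dilationEnergy, dilationSlope]
  refine ⟨by linarith, fun h5 => ⟨fun h6 => h1.2 (by rwa [lt_div_iff₀ hn', one_mul])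
    (mul_left_cancel₀ hn'.ne' (by linarith)), by linarith⟩⟩

/-- Differentiating `h(δ) = δ h(1/δ)` at `1` gives `h'(1) = h(1) - h'(1)`. -/
lemma apply_one_of_symm (h_C1 : ContDiffOn ℝ 1 h (Ioi 0))
    (h_symm : ∀ δ : ℝ, 0 < δ → h δ = δ * h δ⁻¹) : h 1 = 2 * deriv h 1 := by
  have hd := (differentiableAt_of_contDiffOn h_C1 one_pos).hasDerivAt
  have hd' : HasDerivAt h (deriv h 1) (1 : ℝ)⁻¹ := by rwa [inv_one]
  have h1 := (hasDerivAt_id (1 : ℝ)).mul (hd'.comp (1 : ℝ) (hasDerivAt_inv one_ne_zero))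
  have h2 : h =ᶠ[𝓝 1] (id * (h ∘ Inv.inv)) := by
    filter_upwards [Ioi_mem_nhds one_pos] with δ hδ using h_symm δ hδ
  have h3 := hd.unique (h1.congr_of_eventuallyEq h2)
  simp at h3
  linarith

/-- The tangent at `δ = 1` is the zero line: its value is `2n + h(1) = 0` and its slope is `α + (n -
α) + h'(1) = 0`. -/
lemma dilationEnergy_nonneg (hn : n ≠ 0) (hα : (n : ℝ) ≤ α) (h_C1 : ContDiffOn ℝ 1 h (Ioi 0))
    (h_convex : ConvexOn ℝ (Ioi 0) h) (h_symm : ∀ δ : ℝ, 0 < δ → h δ = δ * h δ⁻¹)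
    (h_deriv : deriv h 1 = -(n : ℝ)) {δ : ℝ} (hδ : 0 < δ) : 0 ≤ dilationEnergy n α h δ := by
  have hn' : (n : ℝ) ≠ 0 := by positivity
  have h1 := (dilationEnergy_tangent_le hn hα h_C1 h_convex hδ one_pos).1
  have h2 : dilationEnergy n α h 1 = 0 := by
    simp [dilationEnergy, apply_one_of_symm h_C1 h_symm, h_deriv]; ring
  have h3 : dilationSlope n α h 1 = 0 := by
    simp [dilationSlope, h_deriv]; ring
  rwa [h2, h3, zero_mul, zero_add] at h1

/-- A convex function touching its tangent line on both sides of the base point is affine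
there. -/
lemma eventually_eq_affine_of_contact (h_C1 : ContDiffOn ℝ 1 h (Ioi 0))
    (h_convex : ConvexOn ℝ (Ioi 0) h) {a b δ₀ : ℝ} (ha : 0 < a) (haδ : a < δ₀) (hδb : δ₀ < b)
    (hca : h a = h δ₀ + deriv h δ₀ * (a - δ₀)) (hcb : h b = h δ₀ + deriv h δ₀ * (b - δ₀)) :
    ∃ p q : ℝ, ∀ᶠ δ in 𝓝 δ₀, h δ = p * δ + q := by
  refine ⟨deriv h δ₀, h δ₀ - deriv h δ₀ * δ₀, ?_⟩
  filter_upwards [Ioo_mem_nhds haδ hδb] with δ hδ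
  have hδ0 : 0 < δ := ha.trans hδ.1
  refine le_antisymm ?_ (by
    have := convex_tangent_le h_C1 h_convex hδ0 (ha.trans haδ); linarith)
  have hab : 0 < b - a := by linarith
  have := h_convex.2 (mem_Ioi.mpr ha) (mem_Ioi.mpr (ha.trans (haδ.trans hδb)))
    (div_nonneg (sub_nonneg.mpr hδ.2.le) hab.le) (div_nonneg (sub_nonneg.mpr hδ.1.le) hab.le)
    (by field_simp; ring)
  have e : ((b - δ) / (b - a)) • a + ((δ - a) / (b - a)) • b = δ := by
    simp only [smul_eq_mul]; field_simp; ring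
  rw [e, hca, hcb] at this
  refine this.trans (le_of_eq ?_)
  simp only [smul_eq_mul]
  field_simp
  ring

end Energy

/-! ### Rigidity -/

section Rigidity

variable {n : ℕ}

local notation "𝔼" => EuclideanSpace ℝ (Fin n)

lemma sum_smul_single (v : 𝔼) : ∑ j, v j • EuclideanSpace.single j (1 : ℝ) = v := by
  ext i
  simp [Finset.sum_apply, Pi.single_apply]

/-- An average of matrices of norm at most `c` has norm at most `c`. Pairing with `w`, the image of
`v`, writes `‖w‖²` as an average of `⟨w, G v⟩`, and one factor `‖w‖` cancels. -/
lemma norm_fderiv_mollify_le {Ω : Set 𝔼} (hΩ : MeasurableSet Ω) {y : 𝔼 → 𝔼}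
    {G : 𝔼 → Matrix (Fin n) (Fin n) ℝ} (hG : IsWeakGradient Ω y G)
    (hy : LocallyIntegrable (Ω.indicator y))
    (hGi : ∀ i j, LocallyIntegrable (Ω.indicator fun t => G t i j)) {c : ℝ} (hc : 0 ≤ c)
    (hGc : ∀ᵐ x ∂volume.restrict Ω, ∀ v, ‖Matrix.toEuclideanLin (G x) v‖ ≤ c * ‖v‖)
    {k : ℕ} {x : 𝔼} (hx : Metric.closedBall x (1 / ((k : ℝ) + 1)) ⊆ Ω) :
    ‖fderiv ℝ (mollify k (Ω.indicator y)) x‖ ≤ c := by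
  refine ContinuousLinearMap.opNorm_le_bound _ hc fun v => ?_
  set w : 𝔼 := fderiv ℝ (mollify k (Ω.indicator y)) x v with hw
  set g : Fin n → Fin n → 𝔼 → ℝ := fun i j => Ω.indicator fun t => G t i j with hg
  have hwi : ∀ i, w i = ∑ j, v j * mollify k (g i j) x := fun i => by
    rw [hw]
    conv_lhs => rw [← sum_smul_single v]
    simp only [map_sum, map_smul, smul_eq_mul, WithLp.ofLp_sum, Finset.sum_apply,
      WithLp.ofLp_smul, Pi.smul_apply]
    exact Finset.sum_congr rfl fun j _ => by rw [fderiv_mollify_apply hΩ hG hy hx]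
  have hI : ∀ i j, Integrable fun t => mollifier n k (x - t) * (w i * (v j * g i j t)) := by
    intro i j
    have := ((integrable_mollifier_smul (hGi i j) k x).const_mul (w i * v j))
    refine this.congr (Eventually.of_forall fun t => ?_)
    simp only [smul_eq_mul, hg]; ring
  have h1 : ‖w‖ ^ 2 = ∫ t, mollifier n k (x - t) * ∑ i, ∑ j, w i * (v j * g i j t) := by
    simp_rw [Finset.mul_sum]
    rw [integral_finsetSum _ fun i _ => integrable_finsetSum _ fun j _ => hI i j,
      EuclideanSpace.real_norm_sq_eq]
    refine Finset.sum_congr rfl fun i _ => ?_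
    rw [integral_finsetSum _ fun j _ => hI i j, pow_two]
    conv_lhs => enter [2]; rw [hwi i]
    rw [Finset.mul_sum]
    refine Finset.sum_congr rfl fun j _ => ?_
    rw [mollify_apply, ← integral_const_mul, ← integral_const_mul]
    refine integral_congr_ae (Eventually.of_forall fun t => ?_)
    simp only [smul_eq_mul]
    ring
  have h2 : ‖w‖ ^ 2 ≤ c * ‖v‖ * ‖w‖ := by
    rw [h1]
    have hb : Integrable fun t => mollifier n k (x - t) * (c * ‖v‖ * ‖w‖) :=
      ((integrable_mollifier k).comp_sub_left x).mul_const _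
    have hle : ∀ᵐ t, mollifier n k (x - t) * ∑ i, ∑ j, w i * (v j * g i j t) ≤
        mollifier n k (x - t) * (c * ‖v‖ * ‖w‖) := by
      filter_upwards [(ae_restrict_iff' hΩ).1 hGc] with t ht
      refine mul_le_mul_of_nonneg_left ?_ (mollifier_nonneg k _)
      by_cases htΩ : t ∈ Ω
      · have e : ∑ i, ∑ j, w i * (v j * g i j t) = inner ℝ w (Matrix.toEuclideanLin (G t) v) := by
          rw [PiLp.inner_apply]
          refine Finset.sum_congr rfl fun i _ => ?_
          simp only [hg, indicator_of_mem htΩ, Matrix.toLpLin_apply, Matrix.mulVec, dotProduct,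
            RCLike.inner_apply, conj_trivial, Finset.sum_mul]
          exact Finset.sum_congr rfl fun j _ => by ring
        rw [e]
        refine (real_inner_le_norm _ _).trans ?_
        rw [mul_comm]
        exact mul_le_mul_of_nonneg_right (ht htΩ v) (norm_nonneg _)
      · simp only [hg, indicator_of_notMem htΩ, mul_zero, Finset.sum_const_zero]
        positivity
    refine (integral_mono_ae ?_ hb hle).trans ?_
    · simp_rw [Finset.mul_sum]
      exact integrable_finsetSum _ fun i _ => integrable_finsetSum _ fun j _ => hI i j
    · rw [integral_mul_const, integral_mollifier_sub, one_mul]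
  rcases (norm_nonneg w).eq_or_lt with h0 | h0
  · rw [← h0]; positivity
  · rw [pow_two] at h2
    exact le_of_mul_le_mul_right h2 h0

/-- A continuous map is Lipschitz on closed balls if its weak gradient is bounded. -/
lemma IsWeakGradient.norm_sub_le {Ω : Set 𝔼} (hΩ : IsOpen Ω) {y : 𝔼 → 𝔼}
    {G : 𝔼 → Matrix (Fin n) (Fin n) ℝ} (hG : IsWeakGradient Ω y G) (hyc : ContinuousOn y Ω)
    (hy : LocallyIntegrable (Ω.indicator y))
    (hGi : ∀ i j, LocallyIntegrable (Ω.indicator fun t => G t i j)) {c : ℝ} (hc : 0 ≤ c)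
    (hGc : ∀ᵐ x ∂volume.restrict Ω, ∀ v, ‖Matrix.toEuclideanLin (G x) v‖ ≤ c * ‖v‖)
    {z : 𝔼} {r : ℝ} (hz : Metric.closedBall z r ⊆ Ω) {x₁ x₂ : 𝔼}
    (hx₁ : x₁ ∈ Metric.closedBall z r) (hx₂ : x₂ ∈ Metric.closedBall z r) :
    ‖y x₁ - y x₂‖ ≤ c * ‖x₁ - x₂‖ := by
  have hC := isCompact_closedBall z r
  have hlim := tendstoUniformlyOn_mollify hΩ hyc hy.aestronglyMeasurable hC hz
  refine le_of_tendsto ((hlim.tendsto_at hx₁).sub (hlim.tendsto_at hx₂)).norm ?_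
  filter_upwards [eventually_forall_closedBall_subset hΩ hC hz] with k hk
  exact (convex_closedBall z r).norm_image_sub_le_of_norm_fderiv_le
    (fun x _ => ((mollify_contDiff hy k).differentiable one_ne_zero).differentiableAt)
    (fun x hx => norm_fderiv_mollify_le hΩ.measurableSet hG hy hGi hc hGc (hk x hx)) hx₂ hx₁

/-- The image is a compact subset of the target ball with the same volume, so the part of the open
ball it misses is open and null, hence empty. -/
lemma IsHomeoPair.image_closedBall_eq (hn : n ≠ 0) {Ω₁ Ω₂ : Set 𝔼} {y ξ : 𝔼 → 𝔼}
    (hp : IsHomeoPair Ω₁ Ω₂ y ξ) {c : ℝ} (hc : 0 < c) {x : 𝔼} {r : ℝ} (hr : 0 < r)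
    (hx : Metric.closedBall x r ⊆ Ω₁)
    (hlip : ∀ z ∈ Metric.closedBall x r, ‖y z - y x‖ ≤ c * ‖z - x‖)
    (hvol : volume (y '' Metric.closedBall x r) =
      ENNReal.ofReal (c ^ n) * volume (Metric.closedBall x r)) :
    y '' Metric.closedBall x r = Metric.closedBall (y x) (c * r) := by
  have : Nonempty (Fin n) := ⟨⟨0, Nat.pos_of_ne_zero hn⟩⟩
  have hsub : y '' Metric.closedBall x r ⊆ Metric.closedBall (y x) (c * r) := by
    rintro _ ⟨z, hz, rfl⟩
    rw [mem_closedBall_iff_norm] at hz ⊢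
    exact (hlip z (mem_closedBall_iff_norm.mpr hz)).trans (mul_le_mul_of_nonneg_left hz hc.le)
  have hcomp : IsCompact (y '' Metric.closedBall x r) :=
    (isCompact_closedBall x r).image_of_continuousOn (hp.continuousOn.mono hx)
  refine hsub.antisymm ?_
  rw [← closure_ball (y x) (mul_pos hc hr).ne']
  refine closure_minimal ?_ hcomp.isClosed
  rw [← sdiff_eq_empty]
  refine (Metric.isOpen_ball.sdiff hcomp.isClosed).eq_empty_of_measure_zero (μ := volume) ?_
  refine measure_mono_null (sdiff_subset_sdiff_left Metric.ball_subset_closedBall) ?_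
  rw [measure_sdiff hsub hcomp.measurableSet.nullMeasurableSet hcomp.measure_lt_top.ne, hvol,
    Measure.addHaar_closedBall _ _ (mul_pos hc hr).le, Measure.addHaar_closedBall _ _ hr.le,
    finrank_euclideanSpace_fin, ← mul_assoc, ← ENNReal.ofReal_mul (pow_pos hc n).le, mul_pow,
    tsub_self]

/-- If the images were closer than claimed, two disjoint balls about `x₁` and `x₂` would have images
both containing the midpoint of `y x₁` and `y x₂`, against injectivity. -/
lemma IsHomeoPair.mul_norm_sub_le {Ω₁ Ω₂ : Set 𝔼} {y ξ : 𝔼 → 𝔼}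
    (hp : IsHomeoPair Ω₁ Ω₂ y ξ) {c : ℝ} (hc : 0 < c)
    (hball : ∀ x r, 0 < r → Metric.closedBall x r ⊆ Ω₁ →
      y '' Metric.closedBall x r = Metric.closedBall (y x) (c * r)) {x₁ x₂ : 𝔼}
    (h₁ : Metric.closedBall x₁ (‖x₁ - x₂‖ / 2) ⊆ Ω₁)
    (h₂ : Metric.closedBall x₂ (‖x₁ - x₂‖ / 2) ⊆ Ω₁) : c * ‖x₁ - x₂‖ ≤ ‖y x₁ - y x₂‖ := by
  by_contra! hlt
  have hne : y x₁ ≠ y x₂ := fun h => by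
    have := hp.invOn.1.injOn (h₁ (Metric.mem_closedBall_self (by positivity)))
      (h₂ (Metric.mem_closedBall_self (by positivity))) h
    rw [this] at hlt
    simp at hlt
  have hpos : 0 < ‖y x₁ - y x₂‖ := norm_pos_iff.mpr (sub_ne_zero.mpr hne)
  set s := ‖y x₁ - y x₂‖ / (2 * c) with hs
  have hs0 : 0 < s := by positivity
  have hs1 : s < ‖x₁ - x₂‖ / 2 := by
    rw [hs, div_lt_div_iff₀ (by positivity) two_pos]; linarith
  have hcs : c * s = ‖y x₁ - y x₂‖ / 2 := by rw [hs]; field_simp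
  have hb₁ := (Metric.closedBall_subset_closedBall hs1.le).trans h₁
  have hb₂ := (Metric.closedBall_subset_closedBall hs1.le).trans h₂
  have hm₁ : midpoint ℝ (y x₁) (y x₂) ∈ Metric.closedBall (y x₁) (c * s) := by
    rw [Metric.mem_closedBall, dist_midpoint_left, hcs, dist_eq_norm, Real.norm_of_nonneg two_pos.le]
    linarith
  have hm₂ : midpoint ℝ (y x₁) (y x₂) ∈ Metric.closedBall (y x₂) (c * s) := by
    rw [Metric.mem_closedBall, dist_midpoint_right, hcs, dist_eq_norm,
      Real.norm_of_nonneg two_pos.le]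
    linarith
  rw [← hball x₁ s hs0 hb₁] at hm₁
  rw [← hball x₂ s hs0 hb₂] at hm₂
  obtain ⟨a, ha, hya⟩ := hm₁
  obtain ⟨b, hb, hyb⟩ := hm₂
  have hab : a = b := hp.invOn.1.injOn (hb₁ ha) (hb₂ hb) (hya.trans hyb.symm)
  subst hab
  rw [Metric.mem_closedBall, dist_comm] at ha
  have := dist_triangle x₁ a x₂
  rw [dist_eq_norm x₁ x₂] at this
  rw [Metric.mem_closedBall] at hb
  linarith

/-- A map that preserves norms and distances on a ball around the origin is linear there. -/
lemma exists_linear_of_isometry_on_ball {f : 𝔼 → 𝔼} {ρ : ℝ} (hρ : 0 < ρ)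
    (hf0 : ∀ x ∈ Metric.ball (0 : 𝔼) ρ, ‖f x‖ = ‖x‖)
    (hf : ∀ x ∈ Metric.ball (0 : 𝔼) ρ, ∀ z ∈ Metric.ball (0 : 𝔼) ρ, ‖f x - f z‖ = ‖x - z‖) :
    ∃ L : 𝔼 →L[ℝ] 𝔼, (∀ v, ‖L v‖ = ‖v‖) ∧ ∀ x ∈ Metric.ball (0 : 𝔼) ρ, f x = L x := by
  have hinner : ∀ x ∈ Metric.ball (0 : 𝔼) ρ, ∀ z ∈ Metric.ball (0 : 𝔼) ρ,
      inner ℝ (f x) (f z) = inner ℝ x z := fun x hx z hz => by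
    rw [real_inner_eq_norm_mul_self_add_norm_mul_self_sub_norm_sub_mul_self_div_two,
      real_inner_eq_norm_mul_self_add_norm_mul_self_sub_norm_sub_mul_self_div_two, hf0 x hx,
      hf0 z hz, hf x hx z hz]
  set t := ρ / 2 with ht
  have ht0 : 0 < t := by positivity
  set e : Fin n → 𝔼 := fun i => t • EuclideanSpace.single i (1 : ℝ) with he
  have hemem : ∀ i, e i ∈ Metric.ball (0 : 𝔼) ρ := fun i => by
    rw [mem_ball_zero_iff, he, norm_smul, Real.norm_of_nonneg ht0.le]
    simp
    linarith
  -- Polarisation makes `f` preserve inner products on the ball, so the rescaled images of short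
  -- basis vectors form an orthonormal basis in which `f x` has the coordinates of `x`.
  have hon : Orthonormal ℝ fun i => t⁻¹ • f (e i) := by
    rw [orthonormal_iff_ite]
    intro i j
    rw [real_inner_smul_left, real_inner_smul_right, hinner _ (hemem i) _ (hemem j), he,
      real_inner_smul_left, real_inner_smul_right, EuclideanSpace.inner_single_left]
    by_cases hij : i = j
    · simp [hij]; field_simp
    · simp [hij]
  set b := OrthonormalBasis.mk hon (by
    refine (hon.linearIndependent.span_eq_top_of_card_eq_finrank' ?_).ge
    rw [Fintype.card_fin, finrank_euclideanSpace_fin]) with hb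
  have hbi : ∀ i, b i = t⁻¹ • f (e i) := fun i => by rw [hb, OrthonormalBasis.coe_mk]
  refine ⟨(b.repr.symm.toContinuousLinearEquiv : 𝔼 →L[ℝ] 𝔼), fun v => b.repr.symm.norm_map v,
    fun x hx => ?_⟩
  have h1 : b.repr (f x) = x := by
    ext i
    rw [b.repr_apply_apply, hbi, real_inner_smul_left, hinner _ (hemem i) _ hx, he,
      real_inner_smul_left, EuclideanSpace.inner_single_left]
    simp
    field_simp
  have h2 := congrArg b.repr.symm h1
  rw [b.repr.symm_apply_apply] at h2
  exact h2

/-- Rescaled by `1/c`, the map is linear near each point up to a translation. Its derivative is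
therefore locally constant, and connectedness makes it constant. -/
lemma exists_affine_of_local_similarity {Ω : Set 𝔼} (hΩ : IsOpen Ω) (hΩc : IsConnected Ω)
    {y : 𝔼 → 𝔼} {c : ℝ} (hc : 0 < c)
    (hy : ∀ z ∈ Ω, ∃ ρ > 0, ∀ x₁ ∈ Metric.ball z ρ, ∀ x₂ ∈ Metric.ball z ρ,
      ‖y x₁ - y x₂‖ = c * ‖x₁ - x₂‖) :
    ∃ (a : 𝔼) (L : 𝔼 →L[ℝ] 𝔼), (∀ v, ‖L v‖ = c * ‖v‖) ∧ EqOn y (fun x => a + L x) Ω := by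
  have hloc : ∀ z ∈ Ω, ∃ L : 𝔼 →L[ℝ] 𝔼, (∀ v, ‖L v‖ = c * ‖v‖) ∧
      ∀ᶠ x in 𝓝 z, y x = y z + L (x - z) := fun z hz => by
    obtain ⟨ρ, hρ, h⟩ := hy z hz
    have hmem : ∀ x ∈ Metric.ball (0 : 𝔼) ρ, z + x ∈ Metric.ball z ρ := fun x hx => by
      simpa using hx
    obtain ⟨L, hL, hLf⟩ := exists_linear_of_isometry_on_ball
      (f := fun x => c⁻¹ • (y (z + x) - y z)) hρ (fun x hx => by
        rw [norm_smul, h _ (hmem x hx) _ (Metric.mem_ball_self hρ), norm_inv,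
          Real.norm_of_nonneg hc.le, add_sub_cancel_left]
        field_simp) (fun x hx x' hx' => by
        rw [← smul_sub, sub_sub_sub_cancel_right, norm_smul, h _ (hmem x hx) _ (hmem x' hx'),
          norm_inv, Real.norm_of_nonneg hc.le, add_sub_add_left_eq_sub]
        field_simp)
    refine ⟨c • L, fun v => ?_, ?_⟩
    · rw [smul_apply, norm_smul, hL, Real.norm_of_nonneg hc.le]
    · filter_upwards [Metric.ball_mem_nhds z hρ] with x hx
      have hx' : x - z ∈ Metric.ball (0 : 𝔼) ρ := by
        rwa [mem_ball_zero_iff, ← mem_ball_iff_norm]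
      have := hLf _ hx'
      simp only [add_sub_cancel] at this
      rw [smul_apply, ← this, smul_inv_smul₀ hc.ne', add_sub_cancel]
  have hderiv : ∀ z ∈ Ω, ∃ L : 𝔼 →L[ℝ] 𝔼, (∀ v, ‖L v‖ = c * ‖v‖) ∧
      ∀ᶠ x in 𝓝 z, HasFDerivAt y L x := fun z hz => by
    obtain ⟨L, hL, hLy⟩ := hloc z hz
    refine ⟨L, hL, ?_⟩
    filter_upwards [hLy.eventually_nhds] with x hx
    refine HasFDerivAt.congr_of_eventuallyEq ?_ hx
    exact (L.hasFDerivAt.comp x ((hasFDerivAt_id x).sub_const z)).const_add (y z)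
  obtain ⟨z₀, hz₀⟩ := hΩc.nonempty
  have hdiff : DifferentiableOn ℝ y Ω := fun z hz =>
    (hderiv z hz).choose_spec.2.self_of_nhds.differentiableAt.differentiableWithinAt
  have hconst : ∀ z ∈ Ω, HasFDerivAt (fderiv ℝ y) (0 : 𝔼 →L[ℝ] 𝔼 →L[ℝ] 𝔼) z := fun z hz => by
    obtain ⟨L, -, hLy⟩ := hderiv z hz
    exact (hasFDerivAt_const L z).congr_of_eventuallyEq (hLy.mono fun x hx => hx.fderiv)
  obtain ⟨L, hL, hLy⟩ := hderiv z₀ hz₀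
  obtain ⟨a, ha⟩ := hΩ.exists_eq_add_of_fderiv_eq hΩc.isPreconnected hdiff
    L.differentiable.differentiableOn fun z hz => by
      rw [L.fderiv, ← hLy.self_of_nhds.fderiv]
      exact hΩ.is_const_of_fderiv_eq_zero hΩc.isPreconnected
        (fun x hx => (hconst x hx).differentiableAt.differentiableWithinAt)
        (fun x hx => (hconst x hx).fderiv) hz hz₀
  exact ⟨a, L, hL, fun x hx => (ha hx).trans (add_comm _ _)⟩

end Rigidity

/-! ### Affine maps -/

section Affine

variable {n : ℕ}

local notation "𝔼" => EuclideanSpace ℝ (Fin n)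

lemma isWeakGradient_of_eqOn_affine {Ω : Set 𝔼} (hΩ : MeasurableSet Ω) {y : 𝔼 → 𝔼} {a : 𝔼}
    {A : Matrix (Fin n) (Fin n) ℝ} (hy : EqOn y (fun x => a + Matrix.toEuclideanLin A x) Ω) :
    IsWeakGradient Ω y fun _ => A := by
  have hc : Continuous fun x : 𝔼 => a + Matrix.toEuclideanLin A x :=
    continuous_const.add (LinearMap.continuous_of_finiteDimensional _)
  have hyc : ContinuousOn y Ω := hc.continuousOn.congr hy
  refine ⟨fun i => ?_, fun i j => continuousOn_const.locallyIntegrableOn hΩ,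
    fun φ hφ hφc hφs i j => ?_⟩
  · exact ((EuclideanSpace.proj (𝕜 := ℝ) i).continuous.comp_continuousOn hyc).locallyIntegrableOn hΩ
  · set f : 𝔼 → ℝ := fun x => a i + Matrix.toEuclideanLin A x i with hf
    set L : 𝔼 →L[ℝ] ℝ := (EuclideanSpace.proj (𝕜 := ℝ) i).comp
      (LinearMap.toContinuousLinearMap (Matrix.toEuclideanLin A)) with hL
    have hfd : ∀ x, HasFDerivAt f L x := fun x => L.hasFDerivAt.const_add (a i)
    have hfc : Continuous f := continuous_iff_continuousAt.mpr fun x => (hfd x).continuousAt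
    have hLj : L (EuclideanSpace.single j 1) = A i j := by
      simp [hL, Matrix.toLpLin_apply]
    have hφd : Continuous fun x => fderiv ℝ φ x (EuclideanSpace.single j 1) :=
      (hφ.continuous_fderiv (by simp)).clm_apply continuous_const
    have hφdc : HasCompactSupport fun x => fderiv ℝ φ x (EuclideanSpace.single j 1) :=
      hφc.fderiv_apply ℝ _
    have h0 : ∀ x, x ∉ Ω → φ x = 0 := fun x hx =>
      image_eq_zero_of_notMem_tsupport fun h => hx (hφs h)
    have h0' : ∀ x, x ∉ Ω → fderiv ℝ φ x = 0 := fun x hx =>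
      image_eq_zero_of_notMem_tsupport fun h => hx (hφs (tsupport_fderiv_subset ℝ h))
    have e1 : ∫ x in Ω, y x i * fderiv ℝ φ x (EuclideanSpace.single j 1) =
        ∫ x, f x * fderiv ℝ φ x (EuclideanSpace.single j 1) := by
      rw [setIntegral_congr_fun hΩ (g := fun x => f x * fderiv ℝ φ x (EuclideanSpace.single j 1))
        fun x hx => by simp only [hy hx]; rfl]
      exact setIntegral_eq_integral_of_forall_compl_eq_zero fun x hx => by
        simp [h0' x hx]
    have e2 : ∫ x in Ω, A i j * φ x = ∫ x, A i j * φ x :=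
      setIntegral_eq_integral_of_forall_compl_eq_zero fun x hx => by rw [h0 x hx, mul_zero]
    rw [e1, e2, integral_mul_fderiv_eq_neg_fderiv_mul_of_integrable]
    · simp_rw [(hfd _).fderiv, hLj]
    · simp_rw [(hfd _).fderiv, hLj]
      exact (hφ.continuous.integrable_of_hasCompactSupport hφc).const_mul _
    · exact (hfc.mul hφd).integrable_of_hasCompactSupport hφdc.mul_left
    · exact (hfc.mul hφ.continuous).integrable_of_hasCompactSupport hφc.mul_left
    · exact fun x _ => (hfd x).differentiableAt
    · exact fun x _ => (hφ.differentiable (by simp)).differentiableAt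

lemma memSobolev_of_eqOn_affine {p : ℝ≥0∞} {Ω : Set 𝔼} (hΩ : MeasurableSet Ω)
    (hΩb : Bornology.IsBounded Ω) {y : 𝔼 → 𝔼} {a : 𝔼} {A : Matrix (Fin n) (Fin n) ℝ}
    (hy : EqOn y (fun x => a + Matrix.toEuclideanLin A x) Ω) : MemSobolev p Ω y := by
  have : IsFiniteMeasure (volume.restrict Ω) := ⟨by simpa using hΩb.measure_lt_top⟩
  have hc : Continuous fun x : 𝔼 => a + Matrix.toEuclideanLin A x :=
    continuous_const.add (LinearMap.continuous_of_finiteDimensional _)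
  refine ⟨?_, fun _ => A, isWeakGradient_of_eqOn_affine hΩ hy, fun i j => memLp_const _⟩
  obtain ⟨C, hC⟩ := hΩb.isCompact_closure.exists_bound_of_continuousOn hc.continuousOn
  refine MemLp.of_bound ((hc.continuousOn.congr hy).aestronglyMeasurable hΩ) C ?_
  filter_upwards [ae_restrict_mem hΩ] with x hx
  rw [hy hx]
  exact hC x (subset_closure hx)

lemma toEuclideanLin_smul_transpose_apply {R : Matrix (Fin n) (Fin n) ℝ}
    (hR : R ∈ Matrix.specialOrthogonalGroup (Fin n) ℝ) {c : ℝ} (hc : c ≠ 0) (x : 𝔼) :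
    Matrix.toEuclideanLin (c⁻¹ • R.transpose) (Matrix.toEuclideanLin (c • R) x) = x ∧
      Matrix.toEuclideanLin (c • R) (Matrix.toEuclideanLin (c⁻¹ • R.transpose) x) = x := by
  have hR' := (Matrix.mem_specialOrthogonalGroup_iff.mp hR).1
  have h1 : R.transpose * R = 1 := (Matrix.mem_orthogonalGroup_iff' (A := R)).mp hR'
  have h2 : R * R.transpose = 1 := (Matrix.mem_orthogonalGroup_iff (A := R)).mp hR'
  constructor
  · simp [Matrix.toLpLin_apply, Matrix.mulVec_mulVec, h1, smul_smul, hc]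
  · simp [Matrix.toLpLin_apply, Matrix.mulVec_mulVec, h2, smul_smul, hc]

lemma volume_image_smul {R : Matrix (Fin n) (Fin n) ℝ}
    (hR : R ∈ Matrix.specialOrthogonalGroup (Fin n) ℝ) {c : ℝ} (hc : 0 < c) (Ω : Set 𝔼) :
    volume (Matrix.toEuclideanLin (c • R) '' Ω) = ENNReal.ofReal (c ^ n) * volume Ω := by
  rw [Measure.addHaar_image_linearMap, det_toEuclideanLin, det_smul_of_mem_specialOrthogonalGroup hR,
    abs_of_pos (pow_pos hc n)]

lemma image_smul_eq_preimage {R : Matrix (Fin n) (Fin n) ℝ}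
    (hR : R ∈ Matrix.specialOrthogonalGroup (Fin n) ℝ) {c : ℝ} (hc : c ≠ 0) (Ω : Set 𝔼) :
    Matrix.toEuclideanLin (c • R) '' Ω = Matrix.toEuclideanLin (c⁻¹ • R.transpose) ⁻¹' Ω :=
  congrFun (image_eq_preimage_of_inverse
    (fun x => (toEuclideanLin_smul_transpose_apply hR hc x).1)
    fun x => (toEuclideanLin_smul_transpose_apply hR hc x).2) Ω

lemma isOpen_image_smul {R : Matrix (Fin n) (Fin n) ℝ}
    (hR : R ∈ Matrix.specialOrthogonalGroup (Fin n) ℝ) {c : ℝ} (hc : c ≠ 0) {Ω : Set 𝔼}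
    (hΩ : IsOpen Ω) : IsOpen (Matrix.toEuclideanLin (c • R) '' Ω) := by
  rw [image_smul_eq_preimage hR hc]
  exact hΩ.preimage (LinearMap.continuous_of_finiteDimensional _)

lemma weakGradient_ae_eq_of_eqOn_affine {Ω : Set 𝔼} (hΩ : IsOpen Ω) (hΩb : Bornology.IsBounded Ω)
    {y : 𝔼 → 𝔼} {a : 𝔼} {A : Matrix (Fin n) (Fin n) ℝ}
    (hy : EqOn y (fun x => a + Matrix.toEuclideanLin A x) Ω) :
    ∀ᵐ x ∂volume.restrict Ω, weakGradient Ω y x = A :=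
  (memSobolev_of_eqOn_affine (p := 1) hΩ.measurableSet hΩb hy).exists_weakGradient.ae_eq hΩ
    (isWeakGradient_of_eqOn_affine hΩ.measurableSet hy)

lemma toEuclideanLin_mem_admissible {p : ℝ≥0∞} {R : Matrix (Fin n) (Fin n) ℝ}
    (hR : R ∈ Matrix.specialOrthogonalGroup (Fin n) ℝ) {c : ℝ} (hc : 0 < c) {Ω : Set 𝔼}
    (hΩ : IsOpen Ω) (hΩb : Bornology.IsBounded Ω) :
    (fun x => Matrix.toEuclideanLin (c • R) x) ∈
      admissible p Ω (Matrix.toEuclideanLin (c • R) '' Ω) := by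
  have hy : EqOn (fun x => Matrix.toEuclideanLin (c • R) x)
      (fun x => 0 + Matrix.toEuclideanLin (c • R) x) Ω := fun x _ => (zero_add _).symm
  have hΩ₂b : Bornology.IsBounded (Matrix.toEuclideanLin (c • R) '' Ω) :=
    (LinearMap.toContinuousLinearMap (Matrix.toEuclideanLin (c • R))).lipschitz.isBounded_image hΩb
  refine ⟨memSobolev_of_eqOn_affine hΩ.measurableSet hΩb hy,
    (LinearMap.continuous_of_finiteDimensional _).continuousOn, ?_,
    fun x => Matrix.toEuclideanLin (c⁻¹ • R.transpose) x, mapsTo_image _ _, ?_, ⟨?_, ?_⟩,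
    (LinearMap.continuous_of_finiteDimensional _).continuousOn,
    memSobolev_of_eqOn_affine (a := 0) (isOpen_image_smul hR hc.ne' hΩ).measurableSet hΩ₂b
      fun x _ => (zero_add _).symm⟩
  · filter_upwards [weakGradient_ae_eq_of_eqOn_affine hΩ hΩb hy] with x hx
    rw [hx, det_smul_of_mem_specialOrthogonalGroup hR]
    exact pow_pos hc n
  · rw [image_smul_eq_preimage hR hc.ne']
    exact mapsTo_preimage _ _
  · exact fun x _ => (toEuclideanLin_smul_transpose_apply hR hc.ne' x).1
  · exact fun x _ => (toEuclideanLin_smul_transpose_apply hR hc.ne' x).2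

end Affine

/-! ### Consequences of the area formula -/

section Admissible

variable {n : ℕ}

local notation "𝔼" => EuclideanSpace ℝ (Fin n)

lemma setLIntegral_det_of_mem_admissible (hn : n ≠ 0) {Ω₁ Ω₂ : Set 𝔼} (hΩ₁ : IsOpen Ω₁)
    (hΩ₂ : IsOpen Ω₂) (hΩ₁f : volume Ω₁ ≠ ⊤) (hΩ₂f : volume Ω₂ ≠ ⊤) {y : 𝔼 → 𝔼}
    (hy : y ∈ admissible (n : ℝ≥0∞) Ω₁ Ω₂) {S : Set 𝔼} (hS : MeasurableSet S) (hSΩ : S ⊆ Ω₂) :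
    ∫⁻ x in Ω₁ ∩ y ⁻¹' S, ENNReal.ofReal (weakGradient Ω₁ y x).det = volume S := by
  obtain ⟨hyS, hyc, hpos, ξ, h1, h2, h3, h4, h5⟩ := hy
  exact setLIntegral_det_weakGradient_eq_volume hn ⟨hΩ₁, hΩ₂, h1, h2, h3, hyc, h4⟩ hΩ₁f hΩ₂f
    hyS h5 hpos hS hSΩ

lemma aestronglyMeasurable_weakGradient {Ω₁ Ω₂ : Set 𝔼} {p : ℝ≥0∞} {y : 𝔼 → 𝔼}
    (hΩ₁ : IsOpen Ω₁) (hy : y ∈ admissible p Ω₁ Ω₂) (i j : Fin n) :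
    AEStronglyMeasurable (fun x => weakGradient Ω₁ y x i j) (volume.restrict Ω₁) :=
  (hy.1.memLp_weakGradient hΩ₁ i j).aestronglyMeasurable

lemma integral_det_of_mem_admissible (hn : n ≠ 0) {Ω₁ Ω₂ : Set 𝔼} (hΩ₁ : IsOpen Ω₁)
    (hΩ₂ : IsOpen Ω₂) (hΩ₁f : volume Ω₁ ≠ ⊤) (hΩ₂f : volume Ω₂ ≠ ⊤) {y : 𝔼 → 𝔼}
    (hy : y ∈ admissible (n : ℝ≥0∞) Ω₁ Ω₂) :
    IntegrableOn (fun x => (weakGradient Ω₁ y x).det) Ω₁ ∧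
      ∫ x in Ω₁, (weakGradient Ω₁ y x).det = volume.real Ω₂ := by
  have h := setLIntegral_det_of_mem_admissible hn hΩ₁ hΩ₂ hΩ₁f hΩ₂f hy hΩ₂.measurableSet subset_rfl
  obtain ⟨ξ, hmaps, -⟩ := hy.2.2.2
  rw [inter_eq_left.mpr hmaps.subset_preimage] at h
  have hm := aestronglyMeasurable_det (aestronglyMeasurable_weakGradient hΩ₁ hy)
  have hpos : 0 ≤ᵐ[volume.restrict Ω₁] fun x => (weakGradient Ω₁ y x).det :=
    hy.2.2.1.mono fun x hx => hx.le
  refine ⟨⟨hm, ?_⟩, ?_⟩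
  · rw [hasFiniteIntegral_iff_ofReal hpos, h]
    exact hΩ₂f.lt_top
  · rw [integral_eq_lintegral_of_nonneg_ae hpos hm, h]
    rfl

/-- By the area formula a positive Jacobian has zero integral over the preimage of a null set, so
the preimage is null. This makes `c₂ ∘ y` measurable. -/
lemma map_absolutelyContinuous_of_mem_admissible (hn : n ≠ 0) {Ω₁ Ω₂ : Set 𝔼} (hΩ₁ : IsOpen Ω₁)
    (hΩ₂ : IsOpen Ω₂) (hΩ₁f : volume Ω₁ ≠ ⊤) (hΩ₂f : volume Ω₂ ≠ ⊤) {y : 𝔼 → 𝔼}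
    (hy : y ∈ admissible (n : ℝ≥0∞) Ω₁ Ω₂) :
    (volume.restrict Ω₁).map y ≪ volume.restrict Ω₂ := by
  have hym : AEMeasurable y (volume.restrict Ω₁) := hy.2.1.aemeasurable hΩ₁.measurableSet
  refine Measure.AbsolutelyContinuous.mk fun S hS h0 => ?_
  rw [Measure.restrict_apply hS] at h0
  obtain ⟨ξ, hmaps, -⟩ := hy.2.2.2
  have h := setLIntegral_det_of_mem_admissible hn hΩ₁ hΩ₂ hΩ₁f hΩ₂f hy
    (hS.inter hΩ₂.measurableSet) inter_subset_right
  have hset : Ω₁ ∩ y ⁻¹' (S ∩ Ω₂) = y ⁻¹' S ∩ Ω₁ := by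
    ext x
    exact ⟨fun hx => ⟨hx.2.1, hx.1⟩, fun hx => ⟨hx.2, hx.1, hmaps hx.2⟩⟩
  rw [h0, hset] at h
  have hm := (aestronglyMeasurable_det (aestronglyMeasurable_weakGradient hΩ₁ hy)).aemeasurable
  rw [lintegral_eq_zero_iff' (hm.ennreal_ofReal.mono_measure
    (Measure.restrict_mono inter_subset_right le_rfl))] at h
  have hpos := ae_restrict_of_ae_restrict_of_subset (inter_subset_right (s := y ⁻¹' S)) hy.2.2.1
  rw [Measure.map_apply_of_aemeasurable hym hS, Measure.restrict_apply' hΩ₁.measurableSet]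
  have hF : ∀ᵐ x ∂volume.restrict (y ⁻¹' S ∩ Ω₁), False := by
    filter_upwards [h, hpos] with x h1 h2
    exact (ENNReal.ofReal_pos.mpr h2).ne' h1
  rwa [eventually_false_iff_eq_bot, ae_eq_bot, Measure.restrict_eq_zero] at hF

/-- A conformal map of constant dilation in the admissible class is affine. -/
lemma exists_affine_of_conformal (hn : n ≠ 0) {Ω₁ Ω₂ : Set 𝔼} (hΩ₁ : IsBoundedDomain Ω₁)
    (hΩ₂ : IsOpen Ω₂) (hΩ₂f : volume Ω₂ ≠ ⊤) {y : 𝔼 → 𝔼}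
    (hy : y ∈ admissible (n : ℝ≥0∞) Ω₁ Ω₂) {c : ℝ} (hc : 0 < c)
    (hdet : ∀ᵐ x ∂volume.restrict Ω₁, (weakGradient Ω₁ y x).det = c ^ n)
    (hconf : ∀ᵐ x ∂volume.restrict Ω₁, ∀ v,
      ‖Matrix.toEuclideanLin (weakGradient Ω₁ y x) v‖ = c * ‖v‖) :
    ∃ (a : 𝔼) (Q : Matrix (Fin n) (Fin n) ℝ), Q ∈ Matrix.specialOrthogonalGroup (Fin n) ℝ ∧
      EqOn y (fun x => a + c • Matrix.toEuclideanLin Q x) Ω₁ := by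
  have hΩ₁f : volume Ω₁ ≠ ⊤ := hΩ₁.isBounded.measure_lt_top.ne
  have : IsFiniteMeasure (volume.restrict Ω₁) := ⟨by simpa using hΩ₁f.lt_top⟩
  have hΩm := hΩ₁.isOpen.measurableSet
  obtain ⟨hyS, hyc, -, ξ, h1, h2, h3, h4, -⟩ := id hy
  have hp : IsHomeoPair Ω₁ Ω₂ y ξ := ⟨hΩ₁.isOpen, hΩ₂, h1, h2, h3, hyc, h4⟩
  have hlip : ∀ z r, Metric.closedBall z r ⊆ Ω₁ → ∀ x₁ ∈ Metric.closedBall z r,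
      ∀ x₂ ∈ Metric.closedBall z r, ‖y x₁ - y x₂‖ ≤ c * ‖x₁ - x₂‖ := fun z r hz x₁ hx₁ x₂ hx₂ =>
    hyS.exists_weakGradient.norm_sub_le hΩ₁.isOpen hyc
      (hyS.integrable_indicator hn hΩm hΩ₁f).locallyIntegrable
      (fun i j => ((integrable_indicator_iff hΩm).2 ((hyS.memLp_weakGradient hΩ₁.isOpen i
        j).integrable (by exact_mod_cast Nat.one_le_iff_ne_zero.2 hn))).locallyIntegrable)
      hc.le (hconf.mono fun x hx v => (hx v).le) hz hx₁ hx₂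
  have hball : ∀ x r, 0 < r → Metric.closedBall x r ⊆ Ω₁ →
      y '' Metric.closedBall x r = Metric.closedBall (y x) (c * r) := fun x r hr hx => by
    refine hp.image_closedBall_eq hn hc hr hx (fun z hz => hlip x r hx z hz x
      (Metric.mem_closedBall_self hr.le)) ?_
    have hcomp := (isCompact_closedBall x r).image_of_continuousOn (hyc.mono hx)
    rw [← setLIntegral_det_of_mem_admissible hn hΩ₁.isOpen hΩ₂ hΩ₁f hΩ₂f hy hcomp.measurableSet
      (h1.mono_left hx).image_subset, ← hp.image_inv_eq (h1.mono_left hx).image_subset,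
      (hp.invOn.1.mono hx).image_image,
      ← setLIntegral_const]
    refine lintegral_congr_ae ?_
    filter_upwards [ae_restrict_of_ae_restrict_of_subset hx hdet] with z hz
    rw [hz]
  obtain ⟨a, L, hL, hyL⟩ := exists_affine_of_local_similarity hΩ₁.isOpen hΩ₁.isConnected hc
    (y := y) fun z hz => by
      obtain ⟨r, hr, hrΩ⟩ := Metric.isOpen_iff.mp hΩ₁.isOpen z hz
      -- Points of the `r/3`-ball are less than `2r/3` apart, so balls of half their distance about
      -- them stay inside the `r`-ball.
      refine ⟨r / 3, by positivity, fun x₁ hx₁ x₂ hx₂ => le_antisymm ?_ ?_⟩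
      · exact hlip z (r / 3) ((Metric.closedBall_subset_ball (by linarith)).trans hrΩ) _
          (Metric.ball_subset_closedBall hx₁) _ (Metric.ball_subset_closedBall hx₂)
      · rw [Metric.mem_ball] at hx₁ hx₂
        have h12 : ‖x₁ - x₂‖ / 2 ≤ r / 3 := by
          have := dist_triangle_right x₁ x₂ z
          rw [dist_eq_norm] at this
          linarith
        have hsub : ∀ x, dist x z < r / 3 → Metric.closedBall x (‖x₁ - x₂‖ / 2) ⊆ Ω₁ :=
          fun x hx => (Metric.closedBall_subset_ball' (by linarith)).trans hrΩ
        exact hp.mul_norm_sub_le hc hball (hsub x₁ hx₁) (hsub x₂ hx₂)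
  set A : Matrix (Fin n) (Fin n) ℝ := Matrix.toEuclideanLin.symm (L : 𝔼 →ₗ[ℝ] 𝔼) with hA
  have hAL : ∀ x, Matrix.toEuclideanLin A x = L x := fun x => by
    rw [hA, LinearEquiv.apply_symm_apply]; rfl
  have hyA : EqOn y (fun x => a + Matrix.toEuclideanLin A x) Ω₁ := fun x hx => by
    simp only [hyL hx, hAL]
  have hAdet : A.det = c ^ n := by
    have hne : NeZero (volume.restrict Ω₁) :=
      ⟨by rw [Ne, Measure.restrict_eq_zero]
          exact (hΩ₁.isOpen.measure_pos _ hΩ₁.isConnected.nonempty).ne'⟩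
    obtain ⟨x, hx1, hx2⟩ := ((weakGradient_ae_eq_of_eqOn_affine hΩ₁.isOpen hΩ₁.isBounded hyA).and
      hdet).exists
    rw [← hx1, hx2]
  refine ⟨a, c⁻¹ • A, Matrix.mem_specialOrthogonalGroup_iff.mpr
    ⟨mem_orthogonalGroup_of_norm_toEuclideanLin fun x => ?_, ?_⟩, fun x hx => ?_⟩
  · rw [map_smul, LinearMap.smul_apply, norm_smul, hAL, hL, norm_inv, Real.norm_of_nonneg hc.le,
      inv_mul_cancel_left₀ hc.ne']
  · rw [Matrix.det_smul, hAdet, Fintype.card_fin, ← mul_pow, inv_mul_cancel₀ hc.ne', one_pow]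
  · rw [hyA hx]
    simp only [map_smul, LinearMap.smul_apply, smul_inv_smul₀ hc.ne']

end Admissible

/-! ### The energy inequality and the equality case -/

section Minimality

variable {n : ℕ} {α : ℝ} {h : ℝ → ℝ}

local notation "𝔼" => EuclideanSpace ℝ (Fin n)

lemma ofReal_integral_le_lintegral_ofReal {X : Type*} [MeasurableSpace X] {μ : Measure X}
    {f : X → ℝ} (hf : Integrable f μ) :
    ENNReal.ofReal (∫ x, f x ∂μ) ≤ ∫⁻ x, ENNReal.ofReal (f x) ∂μ := by
  rw [integral_eq_lintegral_pos_part_sub_lintegral_neg_part hf]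
  refine (ENNReal.ofReal_le_ofReal (sub_le_self _ ENNReal.toReal_nonneg)).trans ?_
  exact ENNReal.ofReal_toReal_le

/-- The tangent line at `δ₀` of the energy of dilations. -/
noncomputable def dilationTangent (n : ℕ) (α : ℝ) (h : ℝ → ℝ) (δ₀ δ : ℝ) : ℝ :=
  dilationEnergy n α h δ₀ + dilationSlope n α h δ₀ * (δ - δ₀)

/-- An affine function averages to its value at the mean of `J`, which is `δ₀`. -/
lemma integral_dilationTangent {Ω₁ : Set 𝔼} (hΩ₁f : volume Ω₁ ≠ ⊤) {J : 𝔼 → ℝ} {δ₀ : ℝ}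
    (hJ : IntegrableOn J Ω₁) (hJi : ∫ x in Ω₁, J x = δ₀ * volume.real Ω₁) :
    IntegrableOn (fun x => dilationTangent n α h δ₀ (J x)) Ω₁ ∧
      ∫ x in Ω₁, dilationTangent n α h δ₀ (J x) =
        dilationEnergy n α h δ₀ * volume.real Ω₁ := by
  have : IsFiniteMeasure (volume.restrict Ω₁) := ⟨by simpa using hΩ₁f.lt_top⟩
  have i1 : Integrable (fun x => dilationSlope n α h δ₀ * (J x - δ₀)) (volume.restrict Ω₁) :=
    (hJ.sub (integrable_const _)).const_mul _
  refine ⟨(integrable_const _).add i1, ?_⟩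
  simp only [dilationTangent]
  rw [integral_add (integrable_const _) i1, integral_const_mul, integral_sub hJ
    (integrable_const _), hJi, integral_const, integral_const, measureReal_restrict_apply_univ]
  simp only [smul_eq_mul]
  ring

lemma dilationTangent_le_elasticEnergy (hn : n ≠ 0) (hα : (n : ℝ) ≤ α)
    (h_C1 : ContDiffOn ℝ 1 h (Ioi 0)) (h_convex : ConvexOn ℝ (Ioi 0) h)
    {δ₀ : ℝ} (hδ₀ : 0 < δ₀) {A : Matrix (Fin n) (Fin n) ℝ} (hA : 0 < A.det) :
    dilationTangent n α h δ₀ A.det ≤ elasticEnergy α h A :=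
  (dilationEnergy_tangent_le hn hα h_C1 h_convex hA hδ₀).1.trans
    ((dilationEnergy_le_isotropicEnergy hn hα hA).trans (isotropicEnergy_le_elasticEnergy hn hα hA))

lemma integral_det_eq_mul (hn : n ≠ 0) {Ω₁ : Set 𝔼} (hΩ₁ : IsBoundedDomain Ω₁)
    {R : Matrix (Fin n) (Fin n) ℝ} (hR : R ∈ Matrix.specialOrthogonalGroup (Fin n) ℝ) {c : ℝ}
    (hc : 0 < c) {y : 𝔼 → 𝔼}
    (hy : y ∈ admissible (n : ℝ≥0∞) Ω₁ (Matrix.toEuclideanLin (c • R) '' Ω₁)) :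
    IntegrableOn (fun x => (weakGradient Ω₁ y x).det) Ω₁ ∧
      ∫ x in Ω₁, (weakGradient Ω₁ y x).det = c ^ n * volume.real Ω₁ := by
  have hf : volume Ω₁ ≠ ⊤ := hΩ₁.isBounded.measure_lt_top.ne
  have hv := volume_image_smul hR hc Ω₁
  have := integral_det_of_mem_admissible hn hΩ₁.isOpen (isOpen_image_smul hR hc.ne' hΩ₁.isOpen)
    hf (by rw [hv]; exact ENNReal.mul_ne_top ENNReal.ofReal_ne_top hf) hy
  refine ⟨this.1, this.2.trans ?_⟩
  rw [measureReal_def, hv, ENNReal.toReal_mul, ENNReal.toReal_ofReal (pow_pos hc n).le,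
    measureReal_def]

/-- The lower bound for the energy of admissible maps. -/
lemma ofReal_mul_volume_le_lintegral (hn : n ≠ 0) {Ω₁ : Set 𝔼} (hΩ₁ : IsBoundedDomain Ω₁)
    {R : Matrix (Fin n) (Fin n) ℝ} (hR : R ∈ Matrix.specialOrthogonalGroup (Fin n) ℝ) {c : ℝ}
    (hc : 0 < c) {y : 𝔼 → 𝔼}
    (hy : y ∈ admissible (n : ℝ≥0∞) Ω₁ (Matrix.toEuclideanLin (c • R) '' Ω₁)) {F : 𝔼 → ℝ}
    (hF : ∀ᵐ x ∂volume.restrict Ω₁,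
      dilationTangent n α h (c ^ n) (weakGradient Ω₁ y x).det ≤ F x) :
    ENNReal.ofReal (dilationEnergy n α h (c ^ n)) * volume Ω₁ ≤
      ∫⁻ x in Ω₁, ENNReal.ofReal (F x) := by
  have hf : volume Ω₁ ≠ ⊤ := hΩ₁.isBounded.measure_lt_top.ne
  obtain ⟨hJ, hJi⟩ := integral_det_eq_mul hn hΩ₁ hR hc hy
  obtain ⟨h1, h2⟩ := integral_dilationTangent (α := α) (h := h) hf hJ hJi
  have h3 := ofReal_integral_le_lintegral_ofReal h1
  rw [h2, ENNReal.ofReal_mul' measureReal_nonneg, ofReal_measureReal hf] at h3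
  exact h3.trans (lintegral_mono_ae (hF.mono fun x hx => ENNReal.ofReal_le_ofReal hx))

lemma aemeasurable_comp_of_continuousOn {X : Type*} [MeasurableSpace X] {μ : Measure X}
    {f : ℝ → ℝ} (hf : ContinuousOn f (Ioi 0)) {J : X → ℝ} (hJ : AEMeasurable J μ)
    (hpos : ∀ᵐ x ∂μ, 0 < J x) : AEMeasurable (fun x => f (J x)) μ := by
  classical
  have hm : Measurable ((Ioi (0 : ℝ)).piecewise f 0) :=
    hf.measurable_piecewise continuousOn_const measurableSet_Ioi
  refine (hm.comp_aemeasurable hJ).congr ?_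
  filter_upwards [hpos] with x hx
  exact piecewise_eq_of_mem _ _ _ hx

lemma aemeasurable_isotropicEnergy {X : Type*} [MeasurableSpace X] {μ : Measure X}
    (hc : ContinuousOn h (Ioi 0)) {G : X → Matrix (Fin n) (Fin n) ℝ}
    (hG : ∀ i j, AEStronglyMeasurable (fun x => G x i j) μ) (hpos : ∀ᵐ x ∂μ, 0 < (G x).det) :
    AEMeasurable (fun x => isotropicEnergy α h (G x)) μ := by
  have hJ := (aestronglyMeasurable_det hG).aemeasurable
  have hq : AEMeasurable (fun x => frobSq (G x)) μ :=
    Finset.aemeasurable_fun_sum _ fun i _ => Finset.aemeasurable_fun_sum _ fun j _ =>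
      (hG i j).aemeasurable.pow_const 2
  exact ((((hq.div_const _).pow_const _).const_mul _).add ((hJ.pow_const _).const_mul _)).add
    (aemeasurable_comp_of_continuousOn hc hJ hpos)

/-- If convex `h` touches its tangent line at the mean `δ₀` of `J` in a.e. value of `J`, but `h` is
not affine near `δ₀`, then `J` is constant. -/
lemma ae_eq_const_of_contact {X : Type*} [MeasurableSpace X] {μ : Measure X} [IsFiniteMeasure μ]
    (h_C1 : ContDiffOn ℝ 1 h (Ioi 0)) (h_convex : ConvexOn ℝ (Ioi 0) h) {δ₀ : ℝ}
    (hna : ¬ ∃ p q : ℝ, ∀ᶠ δ in 𝓝 δ₀, h δ = p * δ + q) {J : X → ℝ} (hJ : Integrable J μ)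
    (hJi : ∫ x, J x ∂μ = δ₀ * μ.real univ) (hpos : ∀ᵐ x ∂μ, 0 < J x)
    (hcon : ∀ᵐ x ∂μ, h (J x) = h δ₀ + deriv h δ₀ * (J x - δ₀)) : ∀ᵐ x ∂μ, J x = δ₀ := by
  have hi : ∫ x, J x ∂μ = ∫ _, δ₀ ∂μ := by rw [hJi, integral_const, smul_eq_mul, mul_comm]
  -- Contact on both sides of `δ₀` would make `h` affine near it, so `J` stays on one side of its
  -- own mean and must equal it.
  by_cases ha : ∃ a, 0 < a ∧ a < δ₀ ∧ h a = h δ₀ + deriv h δ₀ * (a - δ₀)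
  · obtain ⟨a, ha, haδ, hca⟩ := ha
    refine (integral_eq_iff_of_ae_le hJ (integrable_const δ₀) ?_).mp hi
    filter_upwards [hcon] with x hx
    by_contra! hlt
    exact hna (eventually_eq_affine_of_contact h_C1 h_convex ha haδ hlt hca hx)
  · refine EventuallyEq.symm
      ((integral_eq_iff_of_ae_le (integrable_const δ₀) hJ ?_).mp hi.symm)
    filter_upwards [hcon, hpos] with x hx hx0
    by_contra! hlt
    exact ha ⟨_, hx0, hlt, hx⟩

/-- Admissible maps of minimal energy are similarities matching the intensities. -/
lemma exists_affine_of_lintegral_le (hn : n ≠ 0) (hα : (n : ℝ) ≤ α)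
    (h_C1 : ContDiffOn ℝ 1 h (Ioi 0)) (h_convex : ConvexOn ℝ (Ioi 0) h)
    (h_symm : ∀ δ : ℝ, 0 < δ → h δ = δ * h δ⁻¹) (h_deriv : deriv h 1 = -(n : ℝ))
    {Ω₁ : Set 𝔼} (hΩ₁ : IsBoundedDomain Ω₁)
    {R : Matrix (Fin n) (Fin n) ℝ} (hR : R ∈ Matrix.specialOrthogonalGroup (Fin n) ℝ) {c : ℝ}
    (hc : 0 < c) (hna : α = n → ¬ ∃ p q : ℝ, ∀ᶠ δ in 𝓝 (c ^ n), h δ = p * δ + q) {y : 𝔼 → 𝔼}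
    (hy : y ∈ admissible (n : ℝ≥0∞) Ω₁ (Matrix.toEuclideanLin (c • R) '' Ω₁)) {γ : 𝔼 → ℝ}
    (hγ : AEMeasurable γ (volume.restrict Ω₁)) (hγ0 : ∀ x, 0 ≤ γ x)
    (hle : ∫⁻ x in Ω₁, ENNReal.ofReal (elasticEnergy α h (weakGradient Ω₁ y x) +
      (1 + (weakGradient Ω₁ y x).det) * γ x) ≤
        ENNReal.ofReal (dilationEnergy n α h (c ^ n)) * volume Ω₁) :
    (∃ (a : 𝔼) (Q : Matrix (Fin n) (Fin n) ℝ), Q ∈ Matrix.specialOrthogonalGroup (Fin n) ℝ ∧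
      EqOn y (fun x => a + c • Matrix.toEuclideanLin Q x) Ω₁) ∧
      ∀ᵐ x ∂volume.restrict Ω₁, γ x = 0 := by
  have hf : volume Ω₁ ≠ ⊤ := hΩ₁.isBounded.measure_lt_top.ne
  have : IsFiniteMeasure (volume.restrict Ω₁) := ⟨by simpa using hf.lt_top⟩
  have hcn : 0 < c ^ n := pow_pos hc n
  have hpos := hy.2.2.1
  obtain ⟨hJ, hJi⟩ := integral_det_eq_mul hn hΩ₁ hR hc hy
  obtain ⟨hT, hTi⟩ := integral_dilationTangent (α := α) (h := h) hf hJ hJi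
  have hG := aestronglyMeasurable_weakGradient hΩ₁.isOpen hy
  set G := weakGradient Ω₁ y with hGdef
  -- `B` replaces the integrand by a measurable lower bound, which still lies above the tangent line
  -- and still detects equality of the singular values.
  set B : 𝔼 → ℝ := fun x => isotropicEnergy α h (G x) + (1 + (G x).det) * γ x with hB
  have hBm : AEMeasurable B (volume.restrict Ω₁) :=
    (aemeasurable_isotropicEnergy h_C1.continuousOn hG hpos).add
      ((hJ.aestronglyMeasurable.aemeasurable.const_add 1).mul hγ)
  have hiso : ∀ᵐ x ∂volume.restrict Ω₁, isotropicEnergy α h (G x) ≤ B x := by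
    filter_upwards [hpos] with x hx
    exact le_add_of_nonneg_right (mul_nonneg (by linarith) (hγ0 x))
  have hB0 : 0 ≤ᵐ[volume.restrict Ω₁] B := by
    filter_upwards [hpos, hiso] with x hx hx'
    exact ((dilationEnergy_nonneg hn hα h_C1 h_convex h_symm h_deriv hx).trans
      (dilationEnergy_le_isotropicEnergy hn hα hx)).trans hx'
  have hBle : ∫⁻ x in Ω₁, ENNReal.ofReal (B x) ≤
      ENNReal.ofReal (dilationEnergy n α h (c ^ n)) * volume Ω₁ := by
    refine (lintegral_mono_ae ?_).trans hle
    filter_upwards [hpos] with x hx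
    exact ENNReal.ofReal_le_ofReal
      (add_le_add_left (isotropicEnergy_le_elasticEnergy hn hα hx) _)
  have hBfin : ENNReal.ofReal (dilationEnergy n α h (c ^ n)) * volume Ω₁ ≠ ⊤ :=
    ENNReal.mul_ne_top ENNReal.ofReal_ne_top hf
  have hBi : Integrable B (volume.restrict Ω₁) :=
    ⟨hBm.aestronglyMeasurable, by
      rw [hasFiniteIntegral_iff_ofReal hB0]; exact hBle.trans_lt hBfin.lt_top⟩
  have hTB : (fun x => dilationTangent n α h (c ^ n) (G x).det) ≤ᵐ[volume.restrict Ω₁] B := by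
    filter_upwards [hpos, hiso] with x hx hx'
    exact (dilationEnergy_tangent_le hn hα h_C1 h_convex hx hcn).1.trans
      ((dilationEnergy_le_isotropicEnergy hn hα hx).trans hx')
  have hBint : ∫ x in Ω₁, B x ≤ dilationEnergy n α h (c ^ n) * volume.real Ω₁ := by
    rw [integral_eq_lintegral_of_nonneg_ae hB0 hBm.aestronglyMeasurable]
    refine (ENNReal.toReal_mono hBfin hBle).trans (le_of_eq ?_)
    rw [ENNReal.toReal_mul, ENNReal.toReal_ofReal
      (dilationEnergy_nonneg hn hα h_C1 h_convex h_symm h_deriv hcn), measureReal_def]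
  have heq := (integral_eq_iff_of_ae_le hT hBi hTB).mp
    ((integral_mono_ae hT hBi hTB).antisymm (by rw [hTi]; exact hBint))
  -- The chain tangent ≤ dilation energy ≤ isotropic energy ≤ `B` has equal ends, so each link is an
  -- equality.
  have hall : ∀ᵐ x ∂volume.restrict Ω₁, γ x = 0 ∧
      isotropicEnergy α h (G x) = dilationEnergy n α h (G x).det ∧
      dilationEnergy n α h (G x).det = dilationTangent n α h (c ^ n) (G x).det := by
    filter_upwards [heq, hpos] with x h1 hx
    have h2 := dilationEnergy_le_isotropicEnergy (h := h) hn hα hx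
    have h3 : dilationTangent n α h (c ^ n) (G x).det ≤ dilationEnergy n α h (G x).det :=
      (dilationEnergy_tangent_le hn hα h_C1 h_convex hx hcn).1
    have h4 : 0 ≤ (1 + (G x).det) * γ x := mul_nonneg (by linarith) (hγ0 x)
    have h5 : dilationTangent n α h (c ^ n) (G x).det =
      isotropicEnergy α h (G x) + (1 + (G x).det) * γ x := h1
    have h6 : (1 + (G x).det) * γ x = 0 := by linarith
    exact ⟨(mul_eq_zero.mp h6).resolve_left (by linarith), by linarith, by linarith⟩
  have hdet : ∀ᵐ x ∂volume.restrict Ω₁, (G x).det = c ^ n := by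
    rcases hα.lt_or_eq with hlt | heqα
    · filter_upwards [hall, hpos] with x hx hx0
      exact ((dilationEnergy_tangent_le hn hα h_C1 h_convex hx0 hcn).2 hx.2.2).1 hlt
    · refine ae_eq_const_of_contact h_C1 h_convex (hna heqα.symm) hJ
        (by rw [hJi, measureReal_restrict_apply_univ]) hpos ?_
      filter_upwards [hall, hpos] with x hx hx0
      exact ((dilationEnergy_tangent_le hn hα h_C1 h_convex hx0 hcn).2 hx.2.2).2
  refine ⟨exists_affine_of_conformal hn hΩ₁ (isOpen_image_smul hR hc.ne' hΩ₁.isOpen) ?_ hy hc hdet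
    ?_, hall.mono fun x hx => hx.1⟩
  · rw [volume_image_smul hR hc]
    exact ENNReal.mul_ne_top ENNReal.ofReal_ne_top hf
  · filter_upwards [hall, hpos, hdet] with x hx hx0 hxd
    exact norm_toEuclideanLin_of_singVal_eq_singVal hc hxd
      (singVal_eq_of_isotropicEnergy_eq hn hα hx0 hx.2.1)

end Minimality

end ImageMatching

/-! ### The main theorem -/

open ImageMatching

theorem theorem4p1 (n : ℕ) (hn : 1 ≤ n) (α : ℝ) (hα : (n : ℝ) ≤ α) (h : ℝ → ℝ)
    (h_C1 : ContDiffOn ℝ 1 h (Ioi 0))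
    (h_convex : ConvexOn ℝ (Ioi 0) h)
    (h_bddBelow : BddBelow (h '' Ioi 0))
    (h_symm : ∀ δ : ℝ, 0 < δ → h δ = δ * h δ⁻¹)
    (h_deriv : deriv h 1 = -(n : ℝ)) :
    (∀ A : Matrix (Fin n) (Fin n) ℝ, 0 < A.det → 0 ≤ ImageMatching.elasticEnergy α h A) ∧
    ∀ (lam : ℝ) (R M : Matrix (Fin n) (Fin n) ℝ) (Ω₁ Ω₂ : Set (EuclideanSpace ℝ (Fin n))),
      0 < lam → R ∈ Matrix.specialOrthogonalGroup (Fin n) ℝ → M = lam • R →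
      ImageMatching.IsBoundedDomain Ω₁ → Ω₂ = Matrix.toEuclideanLin M '' Ω₁ →
      (∀ y ∈ ImageMatching.admissible (n : ℝ≥0∞) Ω₁ Ω₂,
        ENNReal.ofReal (ImageMatching.elasticEnergy α h M) ≤
          ⨍⁻ x in Ω₁,
            ENNReal.ofReal (ImageMatching.elasticEnergy α h
              (ImageMatching.weakGradient Ω₁ y x)) ∂volume) ∧
      ((α = n → ¬ ∃ p q : ℝ, ∀ᶠ δ in 𝓝 (lam ^ n), h δ = p * δ + q) →
        ∀ (m : ℕ) (K : Set (EuclideanSpace ℝ (Fin m)))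
          (g : EuclideanSpace ℝ (Fin m) → EuclideanSpace ℝ (Fin m) → ℝ)
          (c₁ c₂ : EuclideanSpace ℝ (Fin n) → EuclideanSpace ℝ (Fin m)),
          K.Nonempty → Bornology.IsBounded K → IsClosed K → Convex ℝ K →
          Continuous (fun p : EuclideanSpace ℝ (Fin m) × EuclideanSpace ℝ (Fin m) => g p.1 p.2) →
          (∀ c d, 0 ≤ g c d) → (∀ c d, g c d = g d c) → (∀ c d, g c d = 0 ↔ c = d) →
          ImageMatching.IsIntensityMap Ω₁ K c₁ → ImageMatching.IsIntensityMap Ω₂ K c₂ →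
          (∀ᵐ x ∂volume.restrict Ω₁, c₂ (Matrix.toEuclideanLin M x) = c₁ x) →
          (∀ (a : EuclideanSpace ℝ (Fin n)) (Q : Matrix (Fin n) (Fin n) ℝ),
            Q ∈ Matrix.specialOrthogonalGroup (Fin n) ℝ →
            (fun x => a + lam • Matrix.toEuclideanLin Q x) '' Ω₁ = Ω₂ →
            (∀ᵐ x ∂volume.restrict Ω₁,
              c₂ (a + lam • Matrix.toEuclideanLin Q x) =
                c₂ (lam • Matrix.toEuclideanLin R x)) →
            a = 0 ∧ Q = R) →
          ImageMatching.IsUniqueMinimiser Ω₁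
            (ImageMatching.admissible (n : ℝ≥0∞) Ω₁ Ω₂)
            (ImageMatching.functional
              (ImageMatching.integrand (ImageMatching.elasticEnergy α h) g) Ω₁ c₁ c₂)
            (fun x => lam • Matrix.toEuclideanLin R x)) := by
  have hn0 : n ≠ 0 := Nat.one_le_iff_ne_zero.mp hn
  refine ⟨fun A hA => (dilationEnergy_nonneg hn0 hα h_C1 h_convex h_symm h_deriv hA).trans
    ((dilationEnergy_le_isotropicEnergy hn0 hα hA).trans
      (isotropicEnergy_le_elasticEnergy hn0 hα hA)), ?_⟩
  rintro lam R M Ω₁ Ω₂ hlam hR rfl hΩ₁ rfl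
  have hf : volume Ω₁ ≠ ⊤ := hΩ₁.isBounded.measure_lt_top.ne
  have hv0 : volume Ω₁ ≠ 0 := (hΩ₁.isOpen.measure_pos _ hΩ₁.isConnected.nonempty).ne'
  have hcn : 0 < lam ^ n := pow_pos hlam n
  refine ⟨fun y hy => ?_, ?_⟩
  · rw [elasticEnergy_smul_of_mem_specialOrthogonalGroup hn0 hR hlam, setLAverage_eq,
      ENNReal.le_div_iff_mul_le (Or.inl hv0) (Or.inl hf)]
    exact ofReal_mul_volume_le_lintegral hn0 hΩ₁ hR hlam hy (hy.2.2.1.mono fun x hx =>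
      dilationTangent_le_elasticEnergy hn0 hα h_C1 h_convex hcn hx)
  rintro hna m K g c₁ c₂ - - - - hgc hg0 - hg hc₁ hc₂ hcc hgen
  have hy₀ := toEuclideanLin_mem_admissible (p := (n : ℝ≥0∞)) hR hlam hΩ₁.isOpen hΩ₁.isBounded
  have hfun : (fun x => lam • Matrix.toEuclideanLin R x) =
      fun x => Matrix.toEuclideanLin (lam • R) x := by
    funext x
    rw [map_smul, LinearMap.smul_apply]
  -- At `λR` the intensities match, so only the elastic part remains and the lower bound is
  -- attained.
  have hIy₀ : functional (integrand (elasticEnergy α h) g) Ω₁ c₁ c₂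
      (fun x => Matrix.toEuclideanLin (lam • R) x) =
        ENNReal.ofReal (dilationEnergy n α h (lam ^ n)) * volume Ω₁ := by
    rw [functional, ← setLIntegral_const]
    refine lintegral_congr_ae ?_
    filter_upwards [hcc, weakGradient_ae_eq_of_eqOn_affine hΩ₁.isOpen hΩ₁.isBounded
      (y := fun x => Matrix.toEuclideanLin (lam • R) x) (a := 0) (A := lam • R)
      fun x _ => (zero_add _).symm] with x h1 h2
    rw [h2, integrand, h1, (hg _ _).mpr rfl, mul_zero, add_zero,
      elasticEnergy_smul_of_mem_specialOrthogonalGroup hn0 hR hlam]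
  rw [hfun]
  refine ⟨hy₀, fun y hy => ?_, fun y hy hmin => ?_⟩
  · rw [mem_ofPred_eq, hIy₀]
    refine ofReal_mul_volume_le_lintegral hn0 hΩ₁ hR hlam hy (hy.2.2.1.mono fun x hx => ?_)
    exact (dilationTangent_le_elasticEnergy hn0 hα h_C1 h_convex hcn hx).trans
      (le_add_of_nonneg_right (mul_nonneg (by linarith) (hg0 _ _)))
  · have hle := hmin hy₀
    rw [mem_ofPred_eq, hIy₀] at hle
    have hΩ₂ := isOpen_image_smul hR hlam.ne' hΩ₁.isOpen
    have hΩ₂f : volume (Matrix.toEuclideanLin (lam • R) '' Ω₁) ≠ ⊤ := by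
      rw [volume_image_smul hR hlam]
      exact ENNReal.mul_ne_top ENNReal.ofReal_ne_top hf
    have hym : AEMeasurable y (volume.restrict Ω₁) :=
      hy.2.1.aemeasurable hΩ₁.isOpen.measurableSet
    have hc₂y : AEMeasurable (fun x => c₂ (y x)) (volume.restrict Ω₁) :=
      (hc₂.1.aemeasurable.mono_ac (map_absolutelyContinuous_of_mem_admissible hn0 hΩ₁.isOpen hΩ₂
        hf hΩ₂f hy)).comp_aemeasurable hym
    obtain ⟨⟨a, Q, hQ, hyQ⟩, hγ⟩ := exists_affine_of_lintegral_le hn0 hα h_C1 h_convex h_symm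
      h_deriv hΩ₁ hR hlam hna hy (γ := fun x => g (c₁ x) (c₂ (y x)))
      (hgc.measurable.comp_aemeasurable (hc₁.1.aemeasurable.prodMk hc₂y)) (fun x => hg0 _ _) hle
    obtain ⟨ξ, h1, h2, h3, -⟩ := hy.2.2.2
    -- The similarity maps `Ω₁` onto `Ω₂` because `y` does; the vanishing of `g` gives `c₂(y x) =
    -- c₁(x) = c₂(λRx)` almost everywhere, so genericity applies.
    obtain ⟨rfl, rfl⟩ := hgen a Q hQ (by
      rw [← image_congr hyQ]
      exact h1.image_subset.antisymm fun z hz => ⟨ξ z, h2 hz, h3.2 hz⟩) (by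
      filter_upwards [hγ, hcc, ae_restrict_mem hΩ₁.isOpen.measurableSet] with x hx hx' hxΩ
      rw [← show y x = a + lam • Matrix.toEuclideanLin Q x from hyQ hxΩ, ← (hg _ _).mp hx, ← hx', map_smul, LinearMap.smul_apply])
    intro x hx
    rw [hyQ hx, ← hfun]
    exact zero_add _
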